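/- **Network.** For each $n$, $n$ nodes live in the unit square. Time is slotted; at the start of each slot all nodes are re-placed independently and uniformly at random (reshuffling mobility). The library has $M=\Theta(n^\beta)$ contents ($M\ge 1$), each needing $K=\Theta(n^\gamma)$ subpackets, and nodes have cache size $S=\Theta(K)$, where $0<\beta,\gamma<1$. Successive requests of all nodes are independent with the Zipf law $p_m=m^{-\alpha}/\sum_{i=1}^M i^{-\alpha}$, $\alpha>0$, and independent of the mobility. The transmission range $R=R(n)>0$ satisfies $R=\Omega(\sqrt{\log n/n})$ and $R=O(1)$; put $a(n)=R^2$. The guard factor is $\Delta>0$. **Placement and reception.** One of the following holds for all large $n$. (i) *Uncoded caching, sequential reception*: each of the $K$ subpackets of content $m$ is stored at $X_m$ distinct nodes, where $1\le X_m\le n$ and $\sum_m KX_m\le Sn$; a node asks for the subpackets of its requested content in order. (ii) *MDS-coded caching, random reception*: content $m$ is encoded into $r_m\ge K$ coded subpackets, stored at $r_m$ distinct nodes (one at each), where $\sum_m r_m\le Sn$; any $K$ of them recover the content, and a node asks for any that it still lacks. The placements are otherwise arbitrary. **Slot allocation.** Only active requesters may receive in a slot. Fix $\kappa\ge 2+\Delta$.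 The set of active requesters of a slot is determined, by one and the same measurable rule in all slots, from the positions and from i.i.d. uniform marks of the nodes drawn afresh in each slot (not from the requests or caches); the rule treats all nodes alike, and almost surely the active set is a maximal set of nodes at pairwise distance at least $\kappa R$. **Delivery protocol.** An active requester $d$ selects the nearest node $s$ within distance $R$ whose cache holds a subpacket that it asks for (a node is within range of itself). It receives one such subpacket in the slot if every node $b$ that simultaneously transmits to another active requester is at distance at least $(1+\Delta)R$ from $d$; if there is no such $s$, it waits. When it has $K$ distinct subpackets of the content, its next request becomes pending in the next slot. **Metrics.** Let $T(j,\tau)$ be the number of contents completely received by node $j$ in the first $\tau$ slots, and let $D(j,i)$ be the number of slots during which the $i$th request of node $j$ is pending when node $j$ is the active requester in every slot. Put $$\lambda(n)=\mathbb E\Big[\frac1n\sum_{j=1}^n\liminf_{\tau\to\infty}\frac{T(j,\tau)}{\tau}\Big],\qquad D_{avg}(n)=\mathbb E\Big[\frac1n\sum_{j=1}^n\limsup_{z\to\infty}\frac1z\sum_{i=1}^zD(j,i)\Big].$$ **Theorem.** In both cases (i) and (ii), for all large $n$ the quantities $\lambda(n)$ and $D_{avg}(n)$ are finite and $D_{avg}(n)>0$,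 and $$\lambda(n)=\Theta\!\left(\frac1{n\,a(n)\,D_{avg}(n)}\right)\qquad(n\to\infty).$$ -/

import Mathlib

open Filter Topology MeasureTheory Asymptotics
open scoped ENNReal

noncomputable section

namespace ContentNetwork

/-! ### Geometry and randomness -/

/-- A position in the network area, the unit square. -/
abbrev Point : Type := unitInterval × unitInterval

/-- Euclidean distance in the unit square (the product type itself carries the sup distance). -/
def eucl (x y : Point) : ℝ :=
  Real.sqrt (((x.1 : ℝ) - (y.1 : ℝ)) ^ 2 + ((x.2 : ℝ) - (y.2 : ℝ)) ^ 2)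

/-- What is drawn for one node in one slot: its position, and a mark that randomised slot
allocations may use. -/
abbrev Mark : Type := Point × unitInterval

/-- What is drawn for all nodes in one slot. -/
abbrev Slot (n : ℕ) : Type := Fin n → Mark

/-- Reshuffling: in each slot the positions are i.i.d. uniform on the unit square; the marks are
i.i.d. uniform on the unit interval, independent of the positions. -/
def slotLaw (n : ℕ) : Measure (Slot n) :=
  Measure.pi fun _ => ((volume : Measure unitInterval).prod volume).prod volume

instance (n : ℕ) : IsProbabilityMeasure (slotLaw n) := by
  unfold slotLaw; infer_instance

/-- The normalisation `H_α(M) = ∑_{i=1}^M i^{-α}`. -/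
def zipfNorm (α : ℝ) (M : ℕ) : ℝ := ∑ i : Fin M, ((i : ℝ) + 1) ^ (-α)

lemma zipfNorm_pos (α : ℝ) (M : ℕ) [NeZero M] : 0 < zipfNorm α M :=
  Finset.sum_pos (fun _ _ => by positivity) ⟨0, Finset.mem_univ _⟩

/-- The Zipf law on the library; the content with index `m : Fin M` is the `(m+1)`-st most
popular one. -/
def zipf (α : ℝ) (M : ℕ) [NeZero M] : PMF (Fin M) :=
  PMF.ofFintype (fun m => ENNReal.ofReal (((m : ℝ) + 1) ^ (-α) / zipfNorm α M)) (by
    rw [← ENNReal.ofReal_sum_of_nonneg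
      (fun m _ => div_nonneg (by positivity) (zipfNorm_pos α M).le), ← Finset.sum_div]
    change ENNReal.ofReal (zipfNorm α M / zipfNorm α M) = 1
    rw [div_self (zipfNorm_pos α M).ne', ENNReal.ofReal_one])

/-- A realization of the network: the sequence of slots, and the contents requested
(`ω.2 i j` is the content of the request number `i` of node `j`, counted from `0`). -/
abbrev Realization (n M : ℕ) : Type := (ℕ → Slot n) × (ℕ → Fin n → Fin M)

/-- The law of the network: the slots are i.i.d., the requests are i.i.d. with the Zipf law, and
requests and slots are independent. -/
def networkLaw (α : ℝ) (n M : ℕ) [NeZero M] : Measure (Realization n M) :=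
  (Measure.infinitePi fun _ : ℕ => slotLaw n).prod
    (Measure.infinitePi fun _ : ℕ => Measure.pi fun _ : Fin n => (zipf α M).toMeasure)

/-! ### Content placement -/

/-- `cache s m` is the set of labels of the subpackets of content `m` in the cache of node `s`. -/
abbrev Cache (n M : ℕ) : Type := Fin n → Fin M → Finset ℕ

/-- Feasible placement of uncoded content: each of the `K` subpackets (labels `0, …, K-1`) of
content `m` is stored at exactly `X m` distinct nodes, with `1 ≤ X m ≤ n`, under the total cache
constraint `∑ K X_m ≤ S n`. -/
structure IsUncodedPlacement {n M : ℕ} (K S : ℕ) (X : Fin M → ℕ) (cache : Cache n M) : Prop where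
  labels : ∀ s m, cache s m ⊆ Finset.range K
  replicas : ∀ m, ∀ k < K, (Finset.univ.filter fun s => k ∈ cache s m).card = X m
  one_le : ∀ m, 1 ≤ X m
  le_nodes : ∀ m, X m ≤ n
  total : ∑ m, K * X m ≤ S * n

/-- Feasible placement of MDS-coded content: the `r m` coded subpackets (labels `0, …, r m - 1`)
of content `m` are stored at `r m` distinct nodes, one at each, with `K ≤ r m`, under the total
cache constraint `∑ r_m ≤ S n`. -/
structure IsCodedPlacement {n M : ℕ} (K S : ℕ) (r : Fin M → ℕ) (cache : Cache n M) : Prop where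
  labels : ∀ s m, cache s m ⊆ Finset.range (r m)
  once : ∀ m, ∀ l < r m, (Finset.univ.filter fun s => l ∈ cache s m).card = 1
  distinct : ∀ s m, (cache s m).card ≤ 1
  le_coded : ∀ m, K ≤ r m
  total : ∑ m, r m ≤ S * n

/-! ### Reception strategies -/

/-- `wanted m Y` is the set of labels of the subpackets of content `m` that a node asks for when
it has already received those in `Y`. -/
abbrev Reception (M : ℕ) : Type := Fin M → Finset ℕ → Finset ℕ

/-- Sequential reception: ask for the next subpacket only. -/
def sequentialReception (M : ℕ) : Reception M := fun _ Y => {Y.card}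

/-- Random reception: ask for any coded subpacket that is still missing. -/
def randomReception {M : ℕ} (r : Fin M → ℕ) : Reception M := fun m Y => Finset.range (r m) \ Y

/-! ### Delivery -/

/-- The data of a network with `n` nodes and `M` contents. -/
structure System (n M : ℕ) where
  /-- number of subpackets needed to recover a content -/
  K : ℕ
  /-- transmission range -/
  R : ℝ
  /-- guard factor of the protocol model -/
  Δ : ℝ
  cache : Cache n M
  wanted : Reception M

/-- State of a node: number of contents received completely, and the labels of the subpackets
received so far of the content that is currently requested. -/
structure NodeState where
  done : ℕ
  got : Finset ℕ

namespace System

variable {n M : ℕ} (N : System n M)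

/-- The subpackets in the cache of `s` that are asked for by a node which requests content `m`
and already has the subpackets in `Y`. -/
def useful (s : Fin n) (m : Fin M) (Y : Finset ℕ) : Finset ℕ := N.cache s m ∩ N.wanted m Y

/-- The nodes within the range of `j` that can serve it.  A node is within its own range. -/
def sources (x : Fin n → Point) (j : Fin n) (m : Fin M) (Y : Finset ℕ) : Finset (Fin n) := by
  classical
  exact Finset.univ.filter fun s => eucl (x s) (x j) ≤ N.R ∧ (N.useful s m Y).Nonempty

/-- The nearest node within the range of `j` that can serve it (the one of least index, if there
are several), or `⊤` if no node within range can. -/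
def source (x : Fin n → Point) (j : Fin n) (m : Fin M) (Y : Finset ℕ) : WithTop (Fin n) := by
  classical
  exact ((N.sources x j m Y).filter fun s =>
    ∀ s' ∈ N.sources x j m Y, eucl (x s) (x j) ≤ eucl (x s') (x j)).min

/-- The protocol model at the receiver `j`: every node `b` that transmits to another active
requester is at distance at least `(1 + Δ) R` from `j`. -/
def NoInterference (req : ℕ → Fin n → Fin M) (A : Finset (Fin n)) (x : Fin n → Point)
    (σ : Fin n → NodeState) (j : Fin n) : Prop :=
  ∀ i ∈ A, i ≠ j → ∀ b : Fin n, N.source x i (req (σ i).done i) (σ i).got = b →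
    (1 + N.Δ) * N.R ≤ eucl (x b) (x j)

/-- The subpacket delivered to node `j` in a slot with active requesters `A` and positions `x`,
as a set with at most one element. -/
def delivered (req : ℕ → Fin n → Fin M) (A : Finset (Fin n)) (x : Fin n → Point)
    (σ : Fin n → NodeState) (j : Fin n) : Finset ℕ := by
  classical
  exact (N.wanted (req (σ j).done j) (σ j).got).filter fun l =>
    j ∈ A ∧ N.NoInterference req A x σ j ∧
      ∃ s : Fin n, N.source x j (req (σ j).done j) (σ j).got = s ∧
        (N.useful s (req (σ j).done j) (σ j).got).min = l

/-- One slot: an active requester receives the delivered subpacket; as soon as it has `K`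
subpackets, the content is complete and the next request is pending. -/
def step (req : ℕ → Fin n → Fin M) (A : Finset (Fin n)) (x : Fin n → Point)
    (σ : Fin n → NodeState) (j : Fin n) : NodeState :=
  let Y := (σ j).got ∪ N.delivered req A x σ j
  if N.K ≤ Y.card then ⟨(σ j).done + 1, ∅⟩ else ⟨(σ j).done, Y⟩

/-- The state after `t` slots, when `act` determines the active requesters of each slot. -/
def run (act : Slot n → Finset (Fin n)) (ω : Realization n M) : ℕ → Fin n → NodeState
  | 0 => fun _ => ⟨0, ∅⟩
  | t + 1 => N.step ω.2 (act (ω.1 t)) (fun j => (ω.1 t j).1) (run act ω t)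

/-! ### Performance metrics -/

/-- Transfer delay of the request number `i` (from `0`) of node `j`, when `j` is an active
requester in every slot: the number of slots at whose beginning this request is pending. -/
def delay (ω : Realization n M) (j : Fin n) (i : ℕ) : ℝ≥0∞ :=
  ∑' t : ℕ, if (N.run (fun _ => {j}) ω t j).done = i then 1 else 0

/-- Average content transfer delay. -/
def avgDelay (α : ℝ) [NeZero M] : ℝ≥0∞ :=
  ∫⁻ ω, (∑ j : Fin n, limsup (fun z : ℕ => (∑ i ∈ Finset.range z, N.delay ω j i) / (z : ℝ≥0∞))
    atTop) / (n : ℝ≥0∞) ∂(networkLaw α n M)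

/-- Per-node throughput when the active requesters are determined by `act`; the number of contents
received by `j` during `τ` slots is `(N.run act ω τ j).done`. -/
def throughput (α : ℝ) [NeZero M] (act : Slot n → Finset (Fin n)) : ℝ≥0∞ :=
  ∫⁻ ω, (∑ j : Fin n, liminf (fun τ : ℕ => ((N.run act ω τ j).done : ℝ≥0∞) / (τ : ℝ≥0∞))
    atTop) / (n : ℝ≥0∞) ∂(networkLaw α n M)

end System

/-! ### Slot allocation -/

/-- A fair slot allocation with exclusion distance `ρ`: a measurable rule that chooses the active
requesters of a slot from the positions and marks alone (it sees neither requests nor caches),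
treats all nodes alike, and almost surely activates a maximal set of nodes at pairwise distance at
least `ρ`.  (Example: go through the nodes by increasing mark and activate each one that is not
too close to those activated before.) -/
structure IsFairAllocation {n : ℕ} (ρ : ℝ) (act : Slot n → Finset (Fin n)) : Prop where
  measurable : ∀ j, MeasurableSet {w | j ∈ act w}
  symmetric : ∀ π : Equiv.Perm (Fin n), ∀ᵐ w ∂(slotLaw n),
    ∀ j, j ∈ act (fun i => w (π i)) ↔ π j ∈ act w
  exclusive : ∀ᵐ w ∂(slotLaw n), ∀ i ∈ act w, ∀ j ∈ act w, i ≠ j → ρ ≤ eucl (w i).1 (w j).1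
  maximal : ∀ᵐ w ∂(slotLaw n), ∀ j, j ∉ act w → ∃ i ∈ act w, eucl (w i).1 (w j).1 < ρ

/-- The trade-off `λ(n) = Θ(1 / (n a(n) D(n)))` with `a(n) = R(n)²`, both metrics being genuine
positive (respectively finite) numbers for large `n`. -/
def Tradeoff (R : ℕ → ℝ) (lam D : ℕ → ℝ≥0∞) : Prop :=
  (∀ᶠ n in atTop, 0 < D n ∧ D n < ∞ ∧ lam n < ∞) ∧
    (fun n => (lam n).toReal) =Θ[atTop] fun n => 1 / ((n : ℝ) * R n ^ 2 * (D n).toReal)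

end ContentNetwork

end

/-! Fix a node `j` that has `y` subpackets of content `m`. Its probability `g m y` of a reception in
the next slot depends on nothing else. Indeed, a server lies within `R` of its own requester and
active requesters are `κ R ≥ (2 + Δ) R` apart, so interference almost surely never blocks a
reception. By exchangeability, the chance of being active with one of `u` other nodes in range
depends only on `u`. For both placements `u` is a function of `m` and `y` (`NodeProfile`); a node
with a useful subpacket of its own is served by itself.

Credit each reception with `1 / g m y`. Credit minus elapsed time has bounded increments of
conditional mean zero, hence is `o(t)` (`ae_tendsto_reward_div`). With the strong law for the
requests and a renewal argument, node `j` completes contents at the almost sure rate `1 / T_j`,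
where `T_j` is the Zipf average of `∑ y, 1 / g m y` (`meanTime`). So `λ` is the mean over `j` of `1
/ T_j` for the given allocation, and `D_avg` is the mean of `T_j` for a node that is always active
(`System.throughput_eq`, `System.avgDelay_eq`).

Put `ψ u = min 1 (u R²)`. For a lone requester the rate is `1` with a useful subpacket of its own
and of order `ψ u` otherwise. Under a fair allocation both orders are multiplied by `1 / (n R²)`
(`exists_fair_bounds`). This is the delicate point, because the rule may correlate activity with the
positions, for instance by favouring nodes with few neighbours. Packing makes the expected number of
active nodes of order `1 / R²`. Each node is in range of at most one active node, so the total
degree of the active nodes is at most `n`. Its mean is also at least of order `n`: an active node of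
small degree is surrounded by a sparsely populated disc, and the mean amount of such area is
exponentially small in `n R²`. Exchangeability turns this into `P(j active, s in range)` of order `1
/ n`. Two given nodes are both in range of an active `j` with probability `O(R² / n)`, and a second
moment bound gives the rate for `u` candidates.

Let `E_j` be the mean time computed with the rates `1` and `ψ u`. Then `λ n a D_avg` is comparable
to `n⁻² (∑ E_j) (∑ 1 / E_j)`. This is at least `1` by Cauchy-Schwarz. It is at most `2`, although
own copies make the `E_j` unequal, because at most `u` nodes own a useful copy and `u ≤ n ψ u` once
`n R² ≥ 1` (`sum_mul_sum_inv_le`). -/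

noncomputable section

namespace ContentNetwork

/-! ### Euclidean geometry of the unit square -/

/-- The unit square as a subset of the complex plane. -/
def toC (x : Point) : ℂ := ⟨x.1, x.2⟩

lemma eucl_eq_dist (x y : Point) : eucl x y = dist (toC x) (toC y) := by
  rw [Complex.dist_eq_re_im]; rfl

lemma eucl_comm (x y : Point) : eucl x y = eucl y x := by
  simp only [eucl_eq_dist, dist_comm]

lemma eucl_triangle (x y z : Point) : eucl x z ≤ eucl x y + eucl y z := by
  simp only [eucl_eq_dist]; exact dist_triangle _ _ _

lemma eucl_nonneg (x y : Point) : 0 ≤ eucl x y := Real.sqrt_nonneg _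

@[simp] lemma eucl_self (x : Point) : eucl x x = 0 := by simp [eucl]

@[fun_prop]
lemma measurable_eucl {β : Type*} [MeasurableSpace β] {f g : β → Point} (hf : Measurable f)
    (hg : Measurable g) : Measurable fun b => eucl (f b) (g b) := by
  unfold eucl; fun_prop

/-- The uniform law on the unit square. -/
def area : Measure Point := (volume : Measure unitInterval).prod volume

instance : IsProbabilityMeasure area := by unfold area; infer_instance

/-- The part of the unit square within distance `r` of `z`. -/
def disc (z : Point) (r : ℝ) : Set Point := {x | eucl x z ≤ r}

lemma measurableSet_disc (z : Point) (r : ℝ) : MeasurableSet (disc z r) :=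
  measurableSet_le (by fun_prop) (by fun_prop)

lemma volume_near_le (z : unitInterval) {r : ℝ} (hr : 0 ≤ r) :
    (volume : Measure unitInterval).real {x | |(x : ℝ) - z| ≤ r} ≤ 2 * r := by
  have h : (volume : Measure unitInterval) {x | |(x : ℝ) - z| ≤ r} ≤ ENNReal.ofReal (2 * r) := by
    rw [unitInterval.volume_apply]
    calc _ ≤ volume (Set.Icc ((z : ℝ) - r) (z + r)) := by
          apply measure_mono
          rintro _ ⟨x, hx, rfl⟩
          have := abs_le.1 (show |(x : ℝ) - z| ≤ r from hx)
          constructor <;> linarith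
      _ = _ := by rw [Real.volume_Icc]; congr 1; ring
  exact ENNReal.toReal_le_of_le_ofReal (by linarith) h

/-- At least one of the two intervals of length `r` adjacent to `z` stays inside the unit interval,
so the bound is uniform up to the boundary. -/
lemma le_volume_near (z : unitInterval) {r : ℝ} (hr : 0 ≤ r) (hr' : r ≤ 1 / 2) :
    r ≤ (volume : Measure unitInterval).real {x | |(x : ℝ) - z| ≤ r} := by
  have hz0 := z.2.1
  have hz1 := z.2.2
  rcases le_total (z : ℝ) (1 / 2) with h | h
  · have hm : (z : ℝ) + r ∈ unitInterval := ⟨by linarith, by linarith⟩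
    calc r = (volume : Measure unitInterval).real (Set.Icc z ⟨z + r, hm⟩) := by
          rw [Measure.real, unitInterval.volume_Icc, ENNReal.toReal_ofReal] <;> simp [hr]
      _ ≤ _ := by
          refine measureReal_mono ?_ (measure_ne_top _ _)
          intro x hx
          have h1 : (z : ℝ) ≤ x := hx.1
          have h2 : (x : ℝ) ≤ z + r := hx.2
          show |(x : ℝ) - z| ≤ r
          exact abs_le.2 ⟨by linarith, by linarith⟩
  · have hm : (z : ℝ) - r ∈ unitInterval := ⟨by linarith, by linarith⟩
    calc r = (volume : Measure unitInterval).real (Set.Icc ⟨z - r, hm⟩ z) := by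
          rw [Measure.real, unitInterval.volume_Icc, ENNReal.toReal_ofReal] <;> simp [hr]
      _ ≤ _ := by
          refine measureReal_mono ?_ (measure_ne_top _ _)
          intro x hx
          have h1 : (z : ℝ) - r ≤ x := hx.1
          have h2 : (x : ℝ) ≤ z := hx.2
          show |(x : ℝ) - z| ≤ r
          exact abs_le.2 ⟨by linarith, by linarith⟩

lemma area_disc_le (z : Point) {r : ℝ} (hr : 0 ≤ r) : area.real (disc z r) ≤ 4 * r ^ 2 := by
  calc area.real (disc z r)
      ≤ area.real ({x : unitInterval | |(x : ℝ) - z.1| ≤ r} ×ˢ {x : unitInterval | |(x : ℝ) - z.2| ≤ r}) := by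
        refine measureReal_mono ?_ (measure_ne_top _ _)
        intro x hx
        have hx : eucl x z ≤ r := hx
        rw [eucl_eq_dist, Complex.dist_eq] at hx
        exact ⟨(Complex.abs_re_le_norm _).trans hx, (Complex.abs_im_le_norm _).trans hx⟩
    _ ≤ (2 * r) * (2 * r) := by
        rw [area, measureReal_prod_prod]
        exact mul_le_mul (volume_near_le _ hr) (volume_near_le _ hr) measureReal_nonneg (by linarith)
    _ = _ := by ring

/-- The disc contains the square of half-side `r / 2` about `z`; even at a corner of the network
area a quarter of that square remains. -/
lemma le_area_disc (z : Point) {r : ℝ} (hr : 0 ≤ r) (hr' : r ≤ 1) :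
    r ^ 2 / 4 ≤ area.real (disc z r) := by
  calc r ^ 2 / 4 = (r / 2) * (r / 2) := by ring
    _ ≤ area.real ({x : unitInterval | |(x : ℝ) - z.1| ≤ r / 2} ×ˢ {x : unitInterval | |(x : ℝ) - z.2| ≤ r / 2}) := by
        rw [area, measureReal_prod_prod]
        exact mul_le_mul (le_volume_near _ (by linarith) (by linarith))
          (le_volume_near _ (by linarith) (by linarith)) (by linarith) measureReal_nonneg
    _ ≤ _ := by
        refine measureReal_mono ?_ (measure_ne_top _ _)
        rintro x ⟨h1, h2⟩
        have h1 : |(x.1 : ℝ) - z.1| ≤ r / 2 := h1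
        have h2 : |(x.2 : ℝ) - z.2| ≤ r / 2 := h2
        show eucl x z ≤ r
        rw [eucl, Real.sqrt_le_left hr, ← sq_abs, ← sq_abs ((x.2 : ℝ) - z.2)]
        nlinarith [abs_nonneg ((x.1 : ℝ) - z.1), abs_nonneg ((x.2 : ℝ) - z.2)]

/-- A version of `le_area_disc` for radii that are only bounded by some `B ≥ 1`. -/
lemma le_area_disc_of_le (z : Point) {r B : ℝ} (hr : 0 ≤ r) (hB : 1 ≤ B) (hr' : r ≤ B) :
    r ^ 2 / (4 * B ^ 2) ≤ area.real (disc z r) := by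
  have hB0 : 0 < B := by linarith
  have h := le_area_disc z (r := r / B) (by positivity) ((div_le_one hB0).2 hr')
  have h2 : area.real (disc z (r / B)) ≤ area.real (disc z r) := by
    refine measureReal_mono ?_ (measure_ne_top _ _)
    intro x hx
    exact le_trans (show eucl x z ≤ r / B from hx) (div_le_self hr hB)
  calc _ = (r / B) ^ 2 / 4 := by field_simp
    _ ≤ _ := h.trans h2

/-- Disjoint discs: a family of points at pairwise distance more than `2 r` is bounded. -/
lemma card_mul_area_le {ι : Type*} (A : Finset ι) (x : ι → Point) {r c : ℝ}
    (hA : ∀ i ∈ A, ∀ j ∈ A, i ≠ j → 2 * r < eucl (x i) (x j))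
    (hc : ∀ z, c ≤ area.real (disc z r)) : A.card * c ≤ 1 := by
  calc A.card * c = ∑ i ∈ A, c := by simp
    _ ≤ ∑ i ∈ A, area.real (disc (x i) r) := Finset.sum_le_sum fun i _ => hc _
    _ = area.real (⋃ i ∈ A, disc (x i) r) := by
        rw [measureReal_biUnion_finset]
        · intro i hi j hj hij
          refine Set.disjoint_left.2 fun y hy hy' => ?_
          have h1 : eucl y (x i) ≤ r := hy
          have h2 : eucl y (x j) ≤ r := hy'
          have := hA i hi j hj hij
          have := eucl_triangle (x i) y (x j)
          rw [eucl_comm (x i) y] at this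
          linarith
        · exact fun i _ => measurableSet_disc _ _
    _ ≤ 1 := measureReal_le_one

/-! ### Probabilities in one slot -/

/-- The law of a single mark. -/
def markLaw : Measure Mark := area.prod volume

instance : IsProbabilityMeasure markLaw := by unfold markLaw; infer_instance

lemma slotLaw_eq (n : ℕ) : slotLaw n = Measure.pi fun _ => markLaw := rfl

lemma markLaw_real_fst (s : Set Point) : markLaw.real {w | w.1 ∈ s} = area.real s := by
  have : {w : Mark | w.1 ∈ s} = s ×ˢ Set.univ := by ext; simp
  rw [this, markLaw, measureReal_prod_prod]; simp

lemma integrable_of_bounded {β : Type*} [MeasurableSpace β] {μ : Measure β} [IsFiniteMeasure μ]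
    {f : β → ℝ} (hf : Measurable f) (C : ℝ) (h : ∀ b, |f b| ≤ C) : Integrable f μ :=
  Integrable.of_bound hf.aestronglyMeasurable C (Eventually.of_forall h)

/-- Expected number of events that occur. -/
lemma sum_measureReal_eq_integral {β ι : Type*} [MeasurableSpace β] (μ : Measure β)
    [IsFiniteMeasure μ] (I : Finset ι) (E : ι → Set β) (hE : ∀ i ∈ I, MeasurableSet (E i)) :
    Integrable (fun b => ∑ i ∈ I, (E i).indicator (fun _ => (1 : ℝ)) b) μ ∧
    ∫ b, ∑ i ∈ I, (E i).indicator (fun _ => (1 : ℝ)) b ∂μ = ∑ i ∈ I, μ.real (E i) := by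
  have h : ∀ i ∈ I, Integrable (fun b => (E i).indicator (fun _ => (1 : ℝ)) b) μ := fun i hi =>
    (integrable_const (1 : ℝ)).indicator (hE i hi)
  refine ⟨integrable_finsetSum _ h, ?_⟩
  rw [integral_finsetSum _ h]
  refine Finset.sum_congr rfl fun i hi => ?_
  rw [integral_indicator (hE i hi)]; simp

open Classical in
lemma sum_indicator_eq_card {β ι : Type*} (I : Finset ι) (E : ι → Set β) (b : β) :
    ∑ i ∈ I, (E i).indicator (fun _ => (1 : ℝ)) b = ((I.filter fun i => b ∈ E i).card : ℝ) := by
  simp [Set.indicator_apply]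

/-- Permuting the nodes preserves the law of a slot. -/
lemma measurePreserving_perm {n : ℕ} (π : Equiv.Perm (Fin n)) :
    MeasurePreserving (fun (w : Slot n) i => w (π i)) (slotLaw n) (slotLaw n) := by
  have h := measurePreserving_piCongrLeft (fun _ : Fin n => markLaw) π.symm
  have he : (fun (w : Slot n) i => w (π i)) =
      MeasurableEquiv.piCongrLeft (fun _ : Fin n => Mark) π.symm := by
    funext w i
    have := Equiv.piCongrLeft_apply_apply (fun _ : Fin n => Mark) π.symm w (π i)
    rw [Equiv.symm_apply_apply] at this
    exact this.symm
  rw [he]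
  exact h

lemma measureReal_eq_of_perm {n : ℕ} (π : Equiv.Perm (Fin n)) {E E' : Set (Slot n)}
    (hE : MeasurableSet E)
    (h : ∀ᵐ w ∂(slotLaw n), (fun i => w (π i)) ∈ E ↔ w ∈ E') :
    (slotLaw n).real E' = (slotLaw n).real E := by
  rw [Measure.real, Measure.real, ← (measurePreserving_perm π).measure_preimage hE.nullMeasurableSet]
  congr 1
  refine measure_congr ?_
  filter_upwards [h] with w hw
  exact propext hw.symm

/-- A measurable rule for choosing active nodes that treats all nodes alike. -/
structure IsSymmetricRule {n : ℕ} (act : Slot n → Finset (Fin n)) : Prop where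
  measurable : ∀ j, MeasurableSet {w | j ∈ act w}
  symmetric : ∀ π : Equiv.Perm (Fin n), ∀ᵐ w ∂(slotLaw n),
    ∀ j, j ∈ act (fun i => w (π i)) ↔ π j ∈ act w

lemma IsFairAllocation.isSymmetricRule {n : ℕ} {ρ : ℝ} {act : Slot n → Finset (Fin n)}
    (h : IsFairAllocation ρ act) : IsSymmetricRule act := ⟨h.measurable, h.symmetric⟩

/-- Stands in for a lone requester: activating only `j` is not a symmetric rule, but for what
happens at `j` it defines the same events. -/
lemma isSymmetricRule_univ (n : ℕ) :
    IsSymmetricRule (fun _ : Slot n => (Finset.univ : Finset (Fin n))) :=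
  ⟨fun j => by simp, fun π => by simp⟩

/-- Extend a bijection from `V` to `V'` to a permutation, then correct the image of `j` by a
transposition of two points outside `V'`. -/
lemma exists_perm_map {n : ℕ} {V V' : Finset (Fin n)} {j j' : Fin n} (hj : j ∉ V) (hj' : j' ∉ V')
    (h : V.card = V'.card) : ∃ π : Equiv.Perm (Fin n), π j = j' ∧ ∀ s, π s ∈ V' ↔ s ∈ V := by
  classical
  let e : {x // x ∈ V} ≃ {x // x ∈ V'} := Finset.equivOfCardEq h
  let π₁ : Equiv.Perm (Fin n) := e.extendSubtype
  have h₁ : ∀ s, π₁ s ∈ V' ↔ s ∈ V := fun s =>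
    ⟨fun hs => by_contra fun hn => e.extendSubtype_not_mem s hn hs, fun hs => e.extendSubtype_mem s hs⟩
  refine ⟨π₁.trans (Equiv.swap (π₁ j) j'), by simp, fun s => ?_⟩
  rw [← h₁ s, Equiv.trans_apply]
  by_cases h1 : π₁ s = π₁ j
  · rw [h1, Equiv.swap_apply_left]; simp [hj', h₁, hj]
  by_cases h2 : π₁ s = j'
  · rw [h2, Equiv.swap_apply_right]; simp [hj', h₁, hj]
  · rw [Equiv.swap_apply_of_ne_of_ne h1 h2]

/-- Node `j` is active and some node of `V` is within its range. -/
def hit {n : ℕ} (R : ℝ) (act : Slot n → Finset (Fin n)) (j : Fin n) (V : Finset (Fin n)) :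
    Set (Slot n) := {w | j ∈ act w ∧ ∃ s ∈ V, eucl (w s).1 (w j).1 ≤ R}

/-- Node `j` is active and all nodes of `V` are within its range. -/
def hitAll {n : ℕ} (R : ℝ) (act : Slot n → Finset (Fin n)) (j : Fin n) (V : Finset (Fin n)) :
    Set (Slot n) := {w | j ∈ act w ∧ ∀ s ∈ V, eucl (w s).1 (w j).1 ≤ R}

lemma measurableSet_near {n : ℕ} (R : ℝ) (s j : Fin n) :
    MeasurableSet {w : Slot n | eucl (w s).1 (w j).1 ≤ R} :=
  measurableSet_le (by fun_prop) (by fun_prop)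

/-! ### Exchangeability and the second moment bound -/

section rule

variable {n : ℕ} {R : ℝ} {act : Slot n → Finset (Fin n)}

lemma IsSymmetricRule.measurableSet_hit (h : IsSymmetricRule act) (j : Fin n)
    (V : Finset (Fin n)) : MeasurableSet (hit R act j V) := by
  have : hit R act j V = {w | j ∈ act w} ∩ ⋃ s ∈ V, {w | eucl (w s).1 (w j).1 ≤ R} := by
    ext; simp [hit]
  rw [this]
  exact (h.measurable j).inter (Finset.measurableSet_biUnion _ fun s _ => measurableSet_near R s j)

lemma IsSymmetricRule.measurableSet_hitAll (h : IsSymmetricRule act) (j : Fin n)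
    (V : Finset (Fin n)) : MeasurableSet (hitAll R act j V) := by
  have : hitAll R act j V = {w | j ∈ act w} ∩ ⋂ s ∈ V, {w | eucl (w s).1 (w j).1 ≤ R} := by
    ext; simp [hitAll]
  rw [this]
  exact (h.measurable j).inter (Finset.measurableSet_biInter _ fun s _ => measurableSet_near R s j)

/-- Exchangeability: only the number of candidate nodes matters. This is what makes the reception
rates functions of that number. -/
lemma IsSymmetricRule.measureReal_hit_congr (h : IsSymmetricRule act) {j j' : Fin n}
    {V V' : Finset (Fin n)} (hj : j ∉ V) (hj' : j' ∉ V') (hV : V.card = V'.card) :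
    (slotLaw n).real (hit R act j V) = (slotLaw n).real (hit R act j' V') := by
  obtain ⟨π, rfl, hπ⟩ := exists_perm_map hj hj' hV
  refine (measureReal_eq_of_perm π (h.measurableSet_hit _ _) ?_).symm
  filter_upwards [h.symmetric π] with w hw
  refine and_congr (hw j) ⟨?_, ?_⟩
  · rintro ⟨s, hs, h⟩; exact ⟨π s, (hπ s).2 hs, h⟩
  · rintro ⟨s, hs, h⟩
    refine ⟨π.symm s, (hπ _).1 (by simpa using hs), by simpa using h⟩

lemma IsSymmetricRule.measureReal_hitAll_congr (h : IsSymmetricRule act) {j j' : Fin n}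
    {V V' : Finset (Fin n)} (hj : j ∉ V) (hj' : j' ∉ V') (hV : V.card = V'.card) :
    (slotLaw n).real (hitAll R act j V) = (slotLaw n).real (hitAll R act j' V') := by
  obtain ⟨π, rfl, hπ⟩ := exists_perm_map hj hj' hV
  refine (measureReal_eq_of_perm π (h.measurableSet_hitAll _ _) ?_).symm
  filter_upwards [h.symmetric π] with w hw
  refine and_congr (hw j) ⟨?_, ?_⟩
  · intro h s hs
    have := h (π.symm s) ((hπ _).1 (by simpa using hs))
    simpa using this
  · intro h s hs; exact h (π s) ((hπ s).2 hs)

lemma IsSymmetricRule.measureReal_mem_congr (h : IsSymmetricRule act) (j j' : Fin n) :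
    (slotLaw n).real {w | j ∈ act w} = (slotLaw n).real {w | j' ∈ act w} := by
  have h' := h.measureReal_hitAll_congr (R := 0) (j := j) (j' := j') (V := ∅) (V' := ∅)
    (by simp) (by simp) rfl
  simpa [hitAll] using h'

/-- Second moment bound for the probability to be hit. -/
lemma IsSymmetricRule.le_measureReal_hit (h : IsSymmetricRule act) {j : Fin n}
    {V : Finset (Fin n)} {g₁ g₂ : ℝ} (hg₁ : 0 < g₁) (hg₂ : 0 ≤ g₂)
    (h₁ : ∀ s ∈ V, (slotLaw n).real (hit R act j {s}) = g₁)
    (h₂ : ∀ s ∈ V, ∀ s' ∈ V, s ≠ s' → (slotLaw n).real (hitAll R act j {s, s'}) ≤ g₂) :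
    (V.card : ℝ) * g₁ ^ 2 / (g₁ + V.card * g₂) ≤ (slotLaw n).real (hit R act j V) := by
  set u : ℝ := (V.card : ℝ) with hu
  have hu0 : 0 ≤ u := by positivity
  -- For the number `Z` of nodes of `V` in range of an active `j`, this maximises `2 l E[Z] - l²
  -- E[Z²]`, with `E[Z²]` replaced by its bound `u (g₁ + u g₂)`.
  set l : ℝ := g₁ / (g₁ + u * g₂) with hl
  have hden : 0 < g₁ + u * g₂ := by positivity
  obtain ⟨hi1, he1⟩ := sum_measureReal_eq_integral (slotLaw n) V (fun s => hit R act j {s})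
    (fun s _ => h.measurableSet_hit _ _)
  obtain ⟨hi2, he2⟩ := sum_measureReal_eq_integral (slotLaw n) (V ×ˢ V)
    (fun s => hitAll R act j {s.1, s.2}) (fun s _ => h.measurableSet_hitAll _ _)
  have hi3 : Integrable ((hit R act j V).indicator (fun _ => (1 : ℝ))) (slotLaw n) :=
    (integrable_const (1 : ℝ)).indicator (h.measurableSet_hit _ _)
  have hsq : ∀ w : Slot n, ∑ s ∈ V ×ˢ V, (hitAll R act j {s.1, s.2}).indicator (fun _ => (1 : ℝ)) w
      = (∑ s ∈ V, (hit R act j {s}).indicator (fun _ => (1 : ℝ)) w) ^ 2 := by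
    intro w
    rw [Finset.sum_product, sq, Finset.sum_mul_sum]
    refine Finset.sum_congr rfl fun s _ => Finset.sum_congr rfl fun s' _ => ?_
    simp only [Set.indicator_apply, hit, hitAll, Set.mem_ofPred_eq, Finset.mem_insert,
      Finset.mem_singleton, forall_eq_or_imp, forall_eq, exists_eq_left]
    by_cases h1 : j ∈ act w <;> by_cases h2 : eucl (w s).1 (w j).1 ≤ R <;>
      by_cases h3 : eucl (w s').1 (w j).1 ≤ R <;> simp [h1, h2, h3]
  -- In terms of `Z` the left side is `1 - (1 - l Z)²`, which is at most `1` and vanishes for `Z =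
  -- 0`.
  have hpt : ∀ w : Slot n,
      2 * l * ∑ s ∈ V, (hit R act j {s}).indicator (fun _ => (1 : ℝ)) w -
        l ^ 2 * ∑ s ∈ V ×ˢ V, (hitAll R act j {s.1, s.2}).indicator (fun _ => (1 : ℝ)) w
      ≤ (hit R act j V).indicator (fun _ => (1 : ℝ)) w := by
    intro w
    rw [hsq]
    by_cases hw : w ∈ hit R act j V
    · rw [Set.indicator_of_mem hw]
      nlinarith [sq_nonneg (1 - l * ∑ s ∈ V, (hit R act j {s}).indicator (fun _ => (1 : ℝ)) w)]
    · rw [Set.indicator_of_notMem hw, Finset.sum_eq_zero]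
      · simp
      · intro s hs
        refine Set.indicator_of_notMem (fun hs' => hw ?_) _
        obtain ⟨ha, s', hs', hn⟩ := hs'
        rw [Finset.mem_singleton] at hs'
        exact ⟨ha, s, hs, hs' ▸ hn⟩
  have hint := integral_mono ((hi1.const_mul (2 * l)).sub (hi2.const_mul (l ^ 2))) hi3 hpt
  rw [integral_indicator (h.measurableSet_hit _ _), integral_sub' (hi1.const_mul _) (hi2.const_mul _),
    integral_const_mul, integral_const_mul, he1, he2, Finset.sum_congr rfl h₁,
    Finset.sum_product] at hint
  have hb : ∑ s ∈ V, ∑ s' ∈ V, (slotLaw n).real (hitAll R act j {s, s'}) ≤ u * (g₁ + u * g₂) := by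
    rw [hu, ← nsmul_eq_mul, ← Finset.sum_const]
    refine Finset.sum_le_sum fun s hs => ?_
    classical
    rw [← Finset.add_sum_erase _ _ hs]
    refine add_le_add ?_ ?_
    · rw [← h₁ s hs]; simp [hit, hitAll]
    · calc _ ≤ ∑ s' ∈ V.erase s, g₂ := Finset.sum_le_sum fun s' hs' =>
            h₂ s hs s' (Finset.mem_of_mem_erase hs') (Finset.ne_of_mem_erase hs').symm
        _ ≤ ∑ s' ∈ V, g₂ :=
            Finset.sum_le_sum_of_subset_of_nonneg (Finset.erase_subset _ _) fun _ _ _ => hg₂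
        _ = _ := by simp
  simp only [Finset.sum_const, nsmul_eq_mul, integral_const, MeasurableSet.univ,
    measureReal_restrict_apply, Set.univ_inter, smul_eq_mul, mul_one] at hint
  refine le_trans ?_ hint
  have : l ^ 2 * ∑ s ∈ V, ∑ s' ∈ V, (slotLaw n).real (hitAll R act j {s, s'})
      ≤ l ^ 2 * (u * (g₁ + u * g₂)) := mul_le_mul_of_nonneg_left hb (sq_nonneg _)
  calc u * g₁ ^ 2 / (g₁ + u * g₂) = 2 * l * (u * g₁) - l ^ 2 * (u * (g₁ + u * g₂)) := by
        rw [hl]; field_simp; ring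
    _ ≤ _ := by linarith

end rule

/-! ### Independence of the positions within a slot -/

open Classical in
/-- Integrating out the node `s`: if `E` does not depend on `s` and `F` has probability at most
`C` given the other nodes, then `P (E ∩ F) ≤ C P(E)`. -/
lemma measureReal_inter_le {n : ℕ} (s : Fin n) {E F : Set (Slot n)} (hE : MeasurableSet E)
    (hF : MeasurableSet F) (hEs : ∀ w y, Function.update w s y ∈ E ↔ w ∈ E) {C : ℝ} (hC0 : 0 ≤ C)
    (hC : ∀ w : Slot n, markLaw.real {y | Function.update w s y ∈ F} ≤ C) :
    (slotLaw n).real (E ∩ F) ≤ C * (slotLaw n).real E := by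
  have hmE : Measurable (E.indicator (fun _ => (1 : ℝ≥0∞))) := measurable_const.indicator hE
  have hmF : Measurable (F.indicator (fun _ => (1 : ℝ≥0∞))) := measurable_const.indicator hF
  have hmEF : Measurable ((E ∩ F).indicator (fun _ => (1 : ℝ≥0∞))) :=
    measurable_const.indicator (hE.inter hF)
  have key : slotLaw n (E ∩ F) ≤ ENNReal.ofReal C * slotLaw n E := by
    have hone : ∀ {t : Set (Slot n)}, MeasurableSet t →
        ∫⁻ w, t.indicator (fun _ => (1 : ℝ≥0∞)) w ∂(slotLaw n) = slotLaw n t :=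
      fun ht => lintegral_indicator_one ht
    rw [← hone hE, ← hone (hE.inter hF), ← lintegral_const_mul _ (measurable_const.indicator hE), slotLaw_eq]
    refine lintegral_le_of_lmarginal_le (μ := fun _ : Fin n => markLaw) {s} hmEF
      (hmE.const_mul _) ?_
    intro w
    rw [lmarginal_singleton, lmarginal_singleton]
    have h1 : ∀ y, (E ∩ F).indicator (fun _ => (1 : ℝ≥0∞)) (Function.update w s y) =
        E.indicator (fun _ => (1 : ℝ≥0∞)) w *
          {y | Function.update w s y ∈ F}.indicator (fun _ => (1 : ℝ≥0∞)) y := by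
      intro y
      have := hEs w y
      by_cases h1 : w ∈ E <;> by_cases h2 : Function.update w s y ∈ F <;>
        simp [this, h1, h2]
    have h2 : ∀ y, E.indicator (fun _ => (1 : ℝ≥0∞)) (Function.update w s y) =
        E.indicator (fun _ => (1 : ℝ≥0∞)) w := by
      intro y; simp [Set.indicator_apply, hEs w y]
    have hms : MeasurableSet {y | Function.update w s y ∈ F} := (measurable_update w) hF
    show ∫⁻ y, (E ∩ F).indicator (fun _ => (1 : ℝ≥0∞)) (Function.update w s y) ∂markLaw ≤
      ∫⁻ y, ENNReal.ofReal C * E.indicator (fun _ => (1 : ℝ≥0∞)) (Function.update w s y) ∂markLaw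
    simp_rw [h1, h2]
    rw [lintegral_const_mul _ (measurable_const.indicator hms), lintegral_const, measure_univ,
      mul_one, mul_comm]
    have h3 : ∫⁻ y, {y | Function.update w s y ∈ F}.indicator (fun _ => (1 : ℝ≥0∞)) y ∂markLaw =
        markLaw {y | Function.update w s y ∈ F} := lintegral_indicator_one hms
    rw [h3]
    gcongr
    rw [← ENNReal.ofReal_toReal (measure_ne_top markLaw _)]
    exact ENNReal.ofReal_le_ofReal (hC w)
  have := ENNReal.toReal_mono (ENNReal.mul_ne_top ENNReal.ofReal_ne_top (measure_ne_top _ _)) key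
  rwa [ENNReal.toReal_mul, ENNReal.toReal_ofReal hC0] at this

lemma markLaw_real_update_near {n : ℕ} {s j : Fin n} (hsj : s ≠ j) (w : Slot n) (r : ℝ) :
    markLaw.real {y | Function.update w s y ∈ {w : Slot n | eucl (w s).1 (w j).1 ≤ r}} =
      area.real (disc (w j).1 r) := by
  rw [← markLaw_real_fst]
  congr 1
  ext y
  simp [disc, Function.update_of_ne hsj.symm]

/-- Two given nodes are close to each other with probability at most `4 r²`. -/
lemma measureReal_near_le {n : ℕ} {s j : Fin n} (hsj : s ≠ j) {r : ℝ} (hr : 0 ≤ r) :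
    (slotLaw n).real {w | eucl (w s).1 (w j).1 ≤ r} ≤ 4 * r ^ 2 := by
  have := measureReal_inter_le s MeasurableSet.univ (measurableSet_near r s j) (by simp)
    (C := 4 * r ^ 2) (by positivity)
    (fun w => by rw [markLaw_real_update_near hsj]; exact area_disc_le _ hr)
  simpa using this

/-- The probability that no node of `V` is close to `j`. -/
lemma measureReal_forall_not_near_le {n : ℕ} {j : Fin n} {r a : ℝ} (ha1 : a ≤ 1)
    (ha : ∀ z, a ≤ area.real (disc z r)) (V : Finset (Fin n)) (hj : j ∉ V) :
    (slotLaw n).real {w | ∀ s ∈ V, ¬ eucl (w s).1 (w j).1 ≤ r} ≤ (1 - a) ^ V.card := by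
  induction V using Finset.induction_on with
  | empty => simp
  | insert s V hs ih =>
    rw [Finset.mem_insert, not_or] at hj
    rw [Finset.card_insert_of_notMem hs, pow_succ']
    have hE : MeasurableSet {w : Slot n | ∀ s ∈ V, ¬ eucl (w s).1 (w j).1 ≤ r} := by
      have : {w : Slot n | ∀ s ∈ V, ¬ eucl (w s).1 (w j).1 ≤ r} =
        ⋂ s ∈ V, {w : Slot n | eucl (w s).1 (w j).1 ≤ r}ᶜ := by ext; simp
      rw [this]
      exact Finset.measurableSet_biInter _ fun s _ => (measurableSet_near r s j).compl
    have h := measureReal_inter_le s hE (measurableSet_near r s j).compl (C := 1 - a) ?_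
      (by linarith) ?_
    · refine le_trans (le_of_eq ?_) (h.trans (mul_le_mul_of_nonneg_left (ih hj.2) (by linarith)))
      congr 1
      ext w
      simp [and_comm]
    · intro w y
      refine forall₂_congr fun s' hs' => ?_
      have h1 : s' ≠ s := fun h => hs (h ▸ hs')
      rw [Function.update_of_ne h1, Function.update_of_ne hj.1]
    · intro w
      have h2 : {y | Function.update w s y ∈ {w : Slot n | eucl (w s).1 (w j).1 ≤ r}ᶜ} =
        {y | Function.update w s y ∈ {w : Slot n | eucl (w s).1 (w j).1 ≤ r}}ᶜ := rfl
      rw [h2, probReal_compl_eq_one_sub, markLaw_real_update_near (Ne.symm hj.1)]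
      · linarith [ha (w j).1]
      · exact (measurable_update w) (measurableSet_near r s j)

/-- Converts the probability that all of `u` nodes miss into a hit probability of at least `min 1 (u
a) / 2`. With `x = u a` the power is at most `exp (-x)`, which is at most `1 / (1 + x) ≤ 1 - x / 2`
for `x ≤ 1` and at most `exp (-1) < 1 / 2` beyond. -/
lemma one_sub_pow_le {a : ℝ} (ha : 0 ≤ a) (ha1 : a ≤ 1) (u : ℕ) :
    (1 - a) ^ u ≤ 1 - min 1 (u * a) / 2 := by
  have h1 : (1 - a) ^ u ≤ Real.exp (-(u * a)) := by
    calc (1 - a) ^ u ≤ (Real.exp (-a)) ^ u :=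
          pow_le_pow_left₀ (by linarith) (Real.one_sub_le_exp_neg a) u
      _ = _ := by rw [← Real.exp_nat_mul]; congr 1; ring
  refine h1.trans ?_
  have hx : 0 ≤ u * a := by positivity
  set x := (u : ℝ) * a
  rcases le_total 1 x with h | h
  · rw [min_eq_left h]
    have : Real.exp (-x) ≤ Real.exp (-1) := Real.exp_le_exp.2 (by linarith)
    have := Real.exp_neg_one_lt_half
    linarith
  · rw [min_eq_right h]
    have h2 : Real.exp (-x) * Real.exp x = 1 := by rw [← Real.exp_add]; simp
    have h3 := Real.add_one_le_exp x
    have h4 := Real.exp_pos (-x)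
    nlinarith

/-- The probability that a node without the wanted subpacket finds it within range. -/
lemma measureReal_hit_univ_bounds {n : ℕ} {R a : ℝ} (hR : 0 ≤ R) (ha0 : 0 ≤ a) (ha1 : a ≤ 1)
    (ha : ∀ z, a ≤ area.real (disc z R)) (j : Fin n) (V : Finset (Fin n)) (hj : j ∉ V) :
    min 1 (V.card * a) / 2 ≤ (slotLaw n).real (hit R (fun _ => Finset.univ) j V) ∧
    (slotLaw n).real (hit R (fun _ => Finset.univ) j V) ≤ min 1 (V.card * (4 * R ^ 2)) := by
  constructor
  · have h1 := measureReal_forall_not_near_le ha1 ha V hj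
    have h2 : {w : Slot n | ∀ s ∈ V, ¬ eucl (w s).1 (w j).1 ≤ R} =
        (hit R (fun _ => Finset.univ) j V)ᶜ := by
      ext w; simp [hit]
    rw [h2, probReal_compl_eq_one_sub ((isSymmetricRule_univ n).measurableSet_hit _ _)] at h1
    linarith [one_sub_pow_le ha0 ha1 V.card]
  · refine le_min measureReal_le_one ?_
    have h1 : hit R (fun _ => Finset.univ) j V = ⋃ s ∈ V, {w : Slot n | eucl (w s).1 (w j).1 ≤ R} := by
      ext w; simp [hit]
    rw [h1]
    calc _ ≤ ∑ s ∈ V, (slotLaw n).real {w : Slot n | eucl (w s).1 (w j).1 ≤ R} :=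
          measureReal_biUnion_finset_le _ _
      _ ≤ ∑ s ∈ V, 4 * R ^ 2 := Finset.sum_le_sum fun s hs =>
          measureReal_near_le (ne_of_mem_of_not_mem hs hj) hR
      _ = _ := by simp

/-- Almost surely no two nodes are at the same place. -/
lemma ae_eucl_ne_zero (n : ℕ) :
    ∀ᵐ w ∂(slotLaw n), ∀ s j : Fin n, s ≠ j → eucl (w s).1 (w j).1 ≠ 0 := by
  rw [ae_all_iff]; intro s
  rw [ae_all_iff]; intro j
  by_cases hsj : s = j
  · simp [hsj]
  · have h := measureReal_near_le hsj (le_refl (0 : ℝ))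
    have h0 : slotLaw n {w | eucl (w s).1 (w j).1 ≤ 0} = 0 := by
      have : (slotLaw n).real {w | eucl (w s).1 (w j).1 ≤ 0} = 0 :=
        le_antisymm (by simpa using h) measureReal_nonneg
      rwa [measureReal_eq_zero_iff] at this
    filter_upwards [measure_eq_zero_iff_ae_notMem.1 h0] with w hw _ h
    exact hw (show eucl (w s).1 (w j).1 ≤ 0 from h.le)

/-! ### Geometry of fair allocations -/

/-- Weight `1/2` within distance `r` of `z`, weight `1` elsewhere. -/
def halfWeight (r : ℝ) (z x : Point) : ℝ := 1 - (disc z r).indicator (fun _ => 1 / 2) x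

lemma halfWeight_of_le {r : ℝ} {z x : Point} (h : eucl x z ≤ r) : halfWeight r z x = 1 / 2 := by
  rw [halfWeight, Set.indicator_of_mem (show x ∈ disc z r from h)]; norm_num

lemma halfWeight_of_lt {r : ℝ} {z x : Point} (h : r < eucl x z) : halfWeight r z x = 1 := by
  rw [halfWeight, Set.indicator_of_notMem (show x ∉ disc z r from not_le.2 h)]; norm_num

lemma halfWeight_mem (r : ℝ) (z x : Point) : 1 / 2 ≤ halfWeight r z x ∧ halfWeight r z x ≤ 1 := by
  rcases le_or_gt (eucl x z) r with h | h
  · rw [halfWeight_of_le h]; norm_num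
  · rw [halfWeight_of_lt h]; norm_num

@[fun_prop]
lemma measurable_halfWeight {β : Type*} [MeasurableSpace β] (r : ℝ) {f g : β → Point}
    (hf : Measurable f) (hg : Measurable g) : Measurable fun b => halfWeight r (f b) (g b) := by
  have : (fun b => halfWeight r (f b) (g b)) =
      fun b => 1 - {b | eucl (g b) (f b) ≤ r}.indicator (fun _ => 1 / 2) b := by
    funext b
    simp [halfWeight, disc, Set.indicator_apply]
  rw [this]
  exact measurable_const.sub (measurable_const.indicator
    (measurableSet_le (by fun_prop) measurable_const))

lemma integral_halfWeight (r : ℝ) (z : Point) :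
    ∫ w : Mark, halfWeight r z w.1 ∂markLaw = 1 - area.real (disc z r) / 2 := by
  have hm : MeasurableSet {w : Mark | w.1 ∈ disc z r} := measurable_fst (measurableSet_disc z r)
  have h : ∀ w : Mark, halfWeight r z w.1 =
      1 - {w : Mark | w.1 ∈ disc z r}.indicator (fun _ => (1 / 2 : ℝ)) w := fun _ => rfl
  simp_rw [h]
  rw [integral_sub (integrable_const _) ((integrable_const _).indicator hm),
    integral_indicator hm, ← markLaw_real_fst]
  simp
  ring

/-- A measure of how much of the square is far from all nodes. -/
def emptiness {n : ℕ} (r : ℝ) (x : Fin n → Point) : ℝ := ∫ z, ∏ i, halfWeight r z (x i) ∂area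

lemma prod_halfWeight_mem {n : ℕ} (r : ℝ) (z : Point) (x : Fin n → Point) :
    0 ≤ ∏ i, halfWeight r z (x i) ∧ ∏ i, halfWeight r z (x i) ≤ 1 :=
  ⟨Finset.prod_nonneg fun i _ => by linarith [(halfWeight_mem r z (x i)).1],
    Finset.prod_le_one (fun i _ => by linarith [(halfWeight_mem r z (x i)).1])
      fun i _ => (halfWeight_mem r z (x i)).2⟩

lemma integrable_prod_halfWeight {n : ℕ} (r : ℝ) (x : Fin n → Point) :
    Integrable (fun z => ∏ i, halfWeight r z (x i)) area :=
  integrable_of_bounded (by fun_prop) 1 fun z =>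
    abs_le.2 ⟨by linarith [(prod_halfWeight_mem r z x).1], (prod_halfWeight_mem r z x).2⟩

lemma integrable_prod_halfWeight_prod (n : ℕ) (r : ℝ) :
    Integrable (fun p : Slot n × Point => ∏ i, halfWeight r p.2 (p.1 i).1)
      ((slotLaw n).prod area) :=
  integrable_of_bounded (by fun_prop) 1 fun p =>
    abs_le.2 ⟨by linarith [(prod_halfWeight_mem r p.2 fun i => (p.1 i).1).1],
      (prod_halfWeight_mem r p.2 fun i => (p.1 i).1).2⟩

lemma integrable_emptiness (n : ℕ) (r : ℝ) :
    Integrable (fun w : Slot n => emptiness r fun i => (w i).1) (slotLaw n) :=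
  (integrable_prod_halfWeight_prod n r).integral_prod_left

/-- For fixed `z` the factors are independent with mean `1 - area / 2`; Fubini integrates over `z`.
The weight `1 / 2` instead of `0` lets places with a few nodes nearby count as well, which is needed
to control active nodes of small positive degree. -/
lemma integral_emptiness_le (n : ℕ) {r a : ℝ} (ha : ∀ z, a ≤ area.real (disc z r)) :
    ∫ w : Slot n, emptiness r (fun i => (w i).1) ∂(slotLaw n) ≤ Real.exp (-(n * a / 2)) := by
  have hf : Integrable (Function.uncurry fun (w : Slot n) (z : Point) =>
      ∏ i, halfWeight r z (w i).1) ((slotLaw n).prod area) := integrable_prod_halfWeight_prod n r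
  simp only [emptiness]
  rw [integral_integral_swap hf]
  have h : ∀ z, ∫ w : Slot n, ∏ i, halfWeight r z (w i).1 ∂(slotLaw n) =
      (1 - area.real (disc z r) / 2) ^ n := by
    intro z
    rw [slotLaw_eq, integral_fintype_prod_eq_pow (fun w : Mark => halfWeight r z w.1),
      integral_halfWeight, Fintype.card_fin]
  have hb : ∀ z, (1 - area.real (disc z r) / 2) ^ n ≤ Real.exp (-(n * a / 2)) := by
    intro z
    have h1 : area.real (disc z r) ≤ 1 := measureReal_le_one
    calc (1 - area.real (disc z r) / 2) ^ n ≤ (Real.exp (-(a / 2))) ^ n := by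
          refine pow_le_pow_left₀ (by linarith) ?_ n
          exact le_trans (by linarith [ha z]) (Real.one_sub_le_exp_neg (a / 2))
      _ = _ := by rw [← Real.exp_nat_mul]; congr 1; ring
  simp_rw [h]
  calc ∫ z, (1 - area.real (disc z r) / 2) ^ n ∂area ≤ ∫ z, Real.exp (-(n * a / 2)) ∂area := by
        refine integral_mono_of_nonneg (Eventually.of_forall fun z => ?_) (integrable_const _)
          (Eventually.of_forall hb)
        have h1 : area.real (disc z r) ≤ 1 := measureReal_le_one
        exact pow_nonneg (by linarith) _
    _ = _ := by simp

/-! ### Packing and covering estimates for a fixed configuration -/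

section pointwise

variable {n : ℕ} {R κ : ℝ} {A : Finset (Fin n)} {x : Fin n → Point}

/-- Number of other nodes within distance `R`. -/
def degree (R : ℝ) (x : Fin n → Point) (j : Fin n) : ℕ :=
  (Finset.univ.filter fun s => s ≠ j ∧ eucl (x s) (x j) ≤ R).card

/-- By maximality, a point with some node within `R / 2` lies within `(κ + 1) R` of an active node.
Where there is no such node the product is `1`, so these larger discs pay for everything that is not
empty. -/
lemma one_sub_emptiness_le (hR : 0 < R) (hκ : 0 ≤ κ)
    (hmax : ∀ j, j ∉ A → ∃ i ∈ A, eucl (x i) (x j) < κ * R) :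
    1 - emptiness (R / 2) x ≤ A.card * (4 * ((κ + 1) * R) ^ 2) := by
  have hpt : ∀ z, 1 - ∏ i, halfWeight (R / 2) z (x i) ≤
      ∑ j ∈ A, (disc (x j) ((κ + 1) * R)).indicator (fun _ => (1 : ℝ)) z := by
    intro z
    by_cases h : ∃ j ∈ A, eucl z (x j) ≤ (κ + 1) * R
    · obtain ⟨j, hj, hz⟩ := h
      have h1 : (disc (x j) ((κ + 1) * R)).indicator (fun _ => (1 : ℝ)) z ≤
          ∑ j ∈ A, (disc (x j) ((κ + 1) * R)).indicator (fun _ => (1 : ℝ)) z :=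
        Finset.single_le_sum (f := fun j => (disc (x j) ((κ + 1) * R)).indicator (fun _ => (1 : ℝ)) z)
          (fun i _ => Set.indicator_nonneg (fun _ _ => zero_le_one) _) hj
      rw [Set.indicator_of_mem (show z ∈ disc (x j) ((κ + 1) * R) from hz)] at h1
      linarith [(prod_halfWeight_mem (R / 2) z x).1]
    · push Not at h
      have h1 : ∏ i, halfWeight (R / 2) z (x i) = 1 := by
        refine Finset.prod_eq_one fun i _ => halfWeight_of_lt ?_
        by_contra hi
        rw [not_lt] at hi
        by_cases hA : i ∈ A
        · have := h i hA
          rw [eucl_comm] at this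
          nlinarith
        · obtain ⟨j, hj, hij⟩ := hmax i hA
          have h2 := h j hj
          have h3 := eucl_triangle z (x i) (x j)
          rw [eucl_comm z (x i), eucl_comm (x i) (x j)] at h3
          nlinarith
      rw [h1, sub_self]
      exact Finset.sum_nonneg fun i _ => Set.indicator_nonneg (fun _ _ => zero_le_one) _
  have hm : ∀ j ∈ A, MeasurableSet (disc (x j) ((κ + 1) * R)) := fun j _ => measurableSet_disc _ _
  obtain ⟨hi, he⟩ := sum_measureReal_eq_integral area A (fun j => disc (x j) ((κ + 1) * R)) hm
  calc 1 - emptiness (R / 2) x = ∫ z, (1 - ∏ i, halfWeight (R / 2) z (x i)) ∂area := by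
        rw [integral_sub (integrable_const _) (integrable_prod_halfWeight _ _)]; simp [emptiness]
    _ ≤ _ := integral_mono ((integrable_const _).sub (integrable_prod_halfWeight _ _)) hi hpt
    _ = ∑ j ∈ A, area.real (disc (x j) ((κ + 1) * R)) := he
    _ ≤ ∑ j ∈ A, 4 * ((κ + 1) * R) ^ 2 :=
        Finset.sum_le_sum fun j _ => area_disc_le _ (by positivity)
    _ = _ := by simp

/-- The discs of radius `R / 2` about active nodes are disjoint. At a point of the disc about `j`,
only `j` and its neighbours can be within `R / 2`, so the product is at least `(1 / 2) ^ (degree +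
1)` there. -/
lemma sum_half_pow_degree_le (hR : 0 < R) (hκ : 2 < κ)
    (hexc : ∀ i ∈ A, ∀ j ∈ A, i ≠ j → κ * R ≤ eucl (x i) (x j))
    {a : ℝ} (ha : ∀ z, a ≤ area.real (disc z (R / 2))) :
    a * ∑ j ∈ A, (1 / 2 : ℝ) ^ (degree R x j + 1) ≤ emptiness (R / 2) x := by
  have hpt : ∀ z, ∑ j ∈ A, (disc (x j) (R / 2)).indicator
      (fun _ => (1 / 2 : ℝ) ^ (degree R x j + 1)) z ≤ ∏ i, halfWeight (R / 2) z (x i) := by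
    intro z
    by_cases h : ∃ j ∈ A, eucl z (x j) ≤ R / 2
    · obtain ⟨j, hj, hz⟩ := h
      rw [Finset.sum_eq_single_of_mem j hj, Set.indicator_of_mem (show z ∈ disc (x j) (R / 2) from hz)]
      · have h1 : ∏ i, halfWeight (R / 2) z (x i) =
            (1 / 2) ^ (Finset.univ.filter fun i => eucl (x i) z ≤ R / 2).card := by
          rw [← Finset.prod_const, Finset.prod_filter]
          refine Finset.prod_congr rfl fun i _ => ?_
          split_ifs with hi
          · exact halfWeight_of_le hi
          · exact halfWeight_of_lt (not_le.1 hi)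
        rw [h1]
        refine pow_le_pow_of_le_one (by norm_num) (by norm_num) ?_
        classical
        calc _ ≤ (insert j (Finset.univ.filter fun s => s ≠ j ∧ eucl (x s) (x j) ≤ R)).card := by
              refine Finset.card_le_card fun i hi => ?_
              rw [Finset.mem_filter] at hi
              rw [Finset.mem_insert, Finset.mem_filter]
              by_cases hij : i = j
              · exact Or.inl hij
              · refine Or.inr ⟨Finset.mem_univ _, hij, ?_⟩
                linarith [eucl_triangle (x i) z (x j), hi.2]
          _ ≤ _ := Finset.card_insert_le _ _
      · intro i hi hij
        refine Set.indicator_of_notMem (M := ℝ) (fun hzi => ?_) _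
        have h1 : eucl z (x i) ≤ R / 2 := hzi
        have h2 := hexc i hi j hj hij
        have h3 := eucl_triangle (x i) z (x j)
        rw [eucl_comm (x i) z] at h3
        nlinarith
    · push Not at h
      rw [Finset.sum_congr rfl fun j hj => Set.indicator_of_notMem
        (show z ∉ disc (x j) (R / 2) from not_le.2 (h j hj)) _, Finset.sum_const_zero]
      exact (prod_halfWeight_mem _ _ _).1
  have hint : ∀ j ∈ A, Integrable ((disc (x j) (R / 2)).indicator
      (fun _ => (1 / 2 : ℝ) ^ (degree R x j + 1))) area := fun j _ =>
    (integrable_const _).indicator (measurableSet_disc _ _)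
  calc a * ∑ j ∈ A, (1 / 2 : ℝ) ^ (degree R x j + 1)
      ≤ ∑ j ∈ A, area.real (disc (x j) (R / 2)) * (1 / 2 : ℝ) ^ (degree R x j + 1) := by
        rw [Finset.mul_sum]
        exact Finset.sum_le_sum fun j _ => mul_le_mul_of_nonneg_right (ha _) (by positivity)
    _ = ∫ z, ∑ j ∈ A, (disc (x j) (R / 2)).indicator
          (fun _ => (1 / 2 : ℝ) ^ (degree R x j + 1)) z ∂area := by
        rw [integral_finsetSum _ hint]
        refine Finset.sum_congr rfl fun j _ => ?_
        rw [integral_indicator (measurableSet_disc _ _)]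
        simp
    _ ≤ emptiness (R / 2) x :=
        integral_mono (integrable_finsetSum _ hint) (integrable_prod_halfWeight _ _) hpt

/-- For `k ≤ T` the penalty exceeds `T` because `2 ^ k ≤ exp T`. Summed over the active nodes, this
bounds the total degree below by `T` times their number, minus a penalty that `emptiness` controls.
-/
lemma le_natCast_of_half_pow {T : ℝ} (hT : 0 ≤ T) (k : ℕ) :
    T - T * Real.exp T * (1 / 2) ^ k ≤ k := by
  rcases le_total T k with h | h
  · have : 0 ≤ T * Real.exp T * (1 / 2) ^ k := by positivity
    linarith
  · have h1 : 1 ≤ Real.exp T * (1 / 2) ^ k := by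
      have h2 : (2 : ℝ) ^ k ≤ Real.exp T := by
        calc (2 : ℝ) ^ k ≤ (Real.exp 1) ^ k :=
              pow_le_pow_left₀ (by norm_num) (by linarith [Real.add_one_le_exp (1 : ℝ)]) k
          _ = Real.exp k := by rw [← Real.exp_nat_mul, mul_one]
          _ ≤ _ := Real.exp_le_exp.2 h
      calc (1 : ℝ) = 2 ^ k * (1 / 2) ^ k := by rw [← mul_pow]; norm_num
        _ ≤ _ := mul_le_mul_of_nonneg_right h2 (by positivity)
    have : (0 : ℝ) ≤ k := by positivity
    nlinarith

/-- The active nodes have many neighbours in total. -/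
lemma le_sum_degree (hR : 0 < R) (hκ : 2 < κ)
    (hexc : ∀ i ∈ A, ∀ j ∈ A, i ≠ j → κ * R ≤ eucl (x i) (x j))
    (hmax : ∀ j, j ∉ A → ∃ i ∈ A, eucl (x i) (x j) < κ * R)
    {a T : ℝ} (ha0 : 0 < a) (ha : ∀ z, a ≤ area.real (disc z (R / 2))) (hT : 0 ≤ T) :
    T * (1 - emptiness (R / 2) x) / (4 * ((κ + 1) * R) ^ 2) -
      2 * T * Real.exp T * emptiness (R / 2) x / a ≤ ∑ j ∈ A, (degree R x j : ℝ) := by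
  have h1 := one_sub_emptiness_le hR (by linarith) hmax
  have h2 := sum_half_pow_degree_le hR hκ hexc ha
  have h3 : T * A.card - T * Real.exp T * ∑ j ∈ A, (1 / 2 : ℝ) ^ degree R x j ≤
      ∑ j ∈ A, (degree R x j : ℝ) := by
    calc _ = ∑ j ∈ A, (T - T * Real.exp T * (1 / 2) ^ degree R x j) := by
          rw [Finset.sum_sub_distrib, Finset.mul_sum]; simp [mul_comm]
      _ ≤ _ := Finset.sum_le_sum fun j _ => le_natCast_of_half_pow hT _
  have h4 : ∑ j ∈ A, (1 / 2 : ℝ) ^ degree R x j ≤ 2 * emptiness (R / 2) x / a := by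
    rw [le_div_iff₀ ha0]
    have : ∑ j ∈ A, (1 / 2 : ℝ) ^ (degree R x j + 1) = (∑ j ∈ A, (1 / 2 : ℝ) ^ degree R x j) / 2 := by
      rw [Finset.sum_div]; exact Finset.sum_congr rfl fun j _ => by rw [pow_succ]; ring
    rw [this] at h2
    linarith
  have hκR : 0 < (κ + 1) * R := mul_pos (by linarith) hR
  have h5 : (1 - emptiness (R / 2) x) / (4 * ((κ + 1) * R) ^ 2) ≤ A.card :=
    (div_le_iff₀ (by positivity)).2 h1
  have h6 := mul_le_mul_of_nonneg_left h5 hT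
  have h7 := mul_le_mul_of_nonneg_left h4 (show 0 ≤ T * Real.exp T by positivity)
  calc _ = T * ((1 - emptiness (R / 2) x) / (4 * ((κ + 1) * R) ^ 2)) -
        T * Real.exp T * (2 * emptiness (R / 2) x / a) := by ring
    _ ≤ _ := by linarith

/-- Each node is within range of at most one active node. -/
lemma eq_of_near (hR : 0 < R) (hκ : 2 < κ)
    (hexc : ∀ i ∈ A, ∀ j ∈ A, i ≠ j → κ * R ≤ eucl (x i) (x j)) {i j s : Fin n}
    (hi : i ∈ A) (hj : j ∈ A) (hsi : eucl (x s) (x i) ≤ R) (hsj : eucl (x s) (x j) ≤ R) :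
    i = j := by
  by_contra hij
  have h2 := hexc i hi j hj hij
  have h3 := eucl_triangle (x i) (x s) (x j)
  rw [eucl_comm (x i) (x s)] at h3
  nlinarith

end pointwise

/-! ### Probabilities under a fair allocation -/

section expectation

variable {n : ℕ} {R κ : ℝ} {act : Slot n → Finset (Fin n)}

lemma sum_indicator_mem_eq_card (act : Slot n → Finset (Fin n)) (w : Slot n) :
    ∑ j, {w | j ∈ act w}.indicator (fun _ => (1 : ℝ)) w = (act w).card := by
  classical
  rw [sum_indicator_eq_card]
  congr 2
  ext j; simp

/-! ### Expected number of active nodes and of their neighbours -/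

open Classical in
lemma sum_indicator_hit_eq_degree (act : Slot n → Finset (Fin n)) (w : Slot n) :
    ∑ q ∈ (Finset.univ : Finset (Fin n)).offDiag, (hit R act q.1 {q.2}).indicator (fun _ => (1 : ℝ)) w
      = ∑ j ∈ act w, (degree R (fun i => (w i).1) j : ℝ) := by
  rw [sum_indicator_eq_card, ← Nat.cast_sum]
  congr 1
  simp only [degree]
  rw [← Finset.card_sigma]
  refine Finset.card_bij' (fun q _ => ⟨q.1, q.2⟩) (fun q _ => (q.1, q.2)) ?_ ?_ ?_ ?_
  · rintro ⟨j, s⟩ h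
    simp [hit] at h ⊢
    exact ⟨h.2.1, Ne.symm h.1, h.2.2⟩
  · rintro ⟨j, s⟩ h
    simp [hit] at h ⊢
    exact ⟨Ne.symm h.2.1, h.1, h.2.2⟩
  · simp
  · simp

lemma IsSymmetricRule.sum_measureReal_mem (h : IsSymmetricRule act) (j : Fin n) :
    Integrable (fun w => ((act w).card : ℝ)) (slotLaw n) ∧
    ∫ w, ((act w).card : ℝ) ∂(slotLaw n) = n * (slotLaw n).real {w | j ∈ act w} := by
  obtain ⟨hi, he⟩ := sum_measureReal_eq_integral (slotLaw n) Finset.univ (fun j => {w | j ∈ act w})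
    (fun j _ => h.measurable j)
  simp_rw [sum_indicator_mem_eq_card] at hi he
  refine ⟨hi, he.trans ?_⟩
  rw [Finset.sum_congr rfl fun i _ => h.measureReal_mem_congr i j]
  simp

/-- The total degree counts ordered pairs of an active node and another node in its range, and all
`n (n - 1)` pairs are equally likely. -/
lemma IsSymmetricRule.integral_sum_degree (h : IsSymmetricRule act) {j s : Fin n} (hjs : j ≠ s) :
    Integrable (fun w => ∑ j ∈ act w, (degree R (fun i => (w i).1) j : ℝ)) (slotLaw n) ∧
    ∫ w, ∑ j ∈ act w, (degree R (fun i => (w i).1) j : ℝ) ∂(slotLaw n) =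
      n * (n - 1) * (slotLaw n).real (hit R act j {s}) := by
  classical
  obtain ⟨hi, he⟩ := sum_measureReal_eq_integral (slotLaw n)
    (Finset.univ : Finset (Fin n)).offDiag (fun q => hit R act q.1 {q.2})
    (fun q _ => h.measurableSet_hit _ _)
  simp_rw [sum_indicator_hit_eq_degree] at hi he
  refine ⟨hi, he.trans ?_⟩
  have hc : ∀ q ∈ (Finset.univ : Finset (Fin n)).offDiag,
      (slotLaw n).real (hit R act q.1 {q.2}) = (slotLaw n).real (hit R act j {s}) := by
    intro q hq
    rw [Finset.mem_offDiag] at hq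
    exact h.measureReal_hit_congr (by simpa using hq.2.2) (by simpa using hjs) (by simp)
  rw [Finset.sum_congr rfl hc, Finset.sum_const, nsmul_eq_mul]
  congr 1
  have hn : 1 ≤ n := Fin.pos j
  rw [Finset.offDiag_card, Finset.card_univ, Fintype.card_fin, Nat.cast_sub (Nat.le_mul_self n)]
  push_cast; ring

lemma IsFairAllocation.one_le (h : IsFairAllocation (κ * R) act) (hR : 0 < R) (hκ : 2 < κ) :
    ∀ᵐ w ∂(slotLaw n), ∀ s, ∀ i ∈ act w, ∀ j ∈ act w,
      eucl (w s).1 (w i).1 ≤ R → eucl (w s).1 (w j).1 ≤ R → i = j := by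
  filter_upwards [h.exclusive] with w hw s i hi j hj h1 h2
  exact eq_of_near (x := fun i => (w i).1) hR hκ hw hi hj h1 h2

/-- A pair of an active node and a neighbour is determined by the neighbour. -/
lemma IsFairAllocation.sum_degree_le (h : IsFairAllocation (κ * R) act) (hR : 0 < R) (hκ : 2 < κ) :
    ∀ᵐ w ∂(slotLaw n), ∑ j ∈ act w, (degree R (fun i => (w i).1) j : ℝ) ≤ n := by
  classical
  filter_upwards [h.one_le hR hκ] with w hw
  rw [← sum_indicator_hit_eq_degree, sum_indicator_eq_card]
  norm_cast
  calc _ ≤ (Finset.univ : Finset (Fin n)).card := by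
        refine Finset.card_le_card_of_injOn Prod.snd (fun _ _ => Finset.mem_coe.2 (Finset.mem_univ _)) ?_
        rintro ⟨i, s⟩ hi ⟨j, s'⟩ hj (rfl : s = s')
        simp [hit] at hi hj
        rw [hw s i hi.2.1 j hj.2.1 hi.2.2 hj.2.2]
    _ = n := by simp

/-- The probability that two given nodes are within range of a given active node. -/
lemma IsFairAllocation.measureReal_hitAll_pair_le (h : IsFairAllocation (κ * R) act) (hR : 0 < R)
    (hκ : 2 < κ) (hn : 3 ≤ n) {j s s' : Fin n} (hs : s ≠ j) (hs' : s' ≠ j) (hss : s ≠ s') :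
    (slotLaw n).real (hitAll R act j {s, s'}) ≤ 48 * R ^ 2 / n := by
  classical
  set I : Finset (Fin n × Fin n × Fin n) := Finset.univ.filter fun q =>
    q.2.1 ≠ q.1 ∧ q.2.2 ≠ q.1 ∧ q.2.1 ≠ q.2.2 with hI
  have hsym := h.isSymmetricRule
  obtain ⟨hi, he⟩ := sum_measureReal_eq_integral (slotLaw n) I
    (fun q => hitAll R act q.1 {q.2.1, q.2.2}) (fun q _ => hsym.measurableSet_hitAll _ _)
  obtain ⟨hi', he'⟩ := sum_measureReal_eq_integral (slotLaw n)
    (Finset.univ : Finset (Fin n)).offDiag (fun q => {w | eucl (w q.1).1 (w q.2).1 ≤ 2 * R})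
    (fun q _ => measurableSet_near _ _ _)
  have hle : ∫ w, ∑ q ∈ I, (hitAll R act q.1 {q.2.1, q.2.2}).indicator (fun _ => (1 : ℝ)) w
      ∂(slotLaw n) ≤ ∫ w, ∑ q ∈ (Finset.univ : Finset (Fin n)).offDiag,
        {w : Slot n | eucl (w q.1).1 (w q.2).1 ≤ 2 * R}.indicator (fun _ => (1 : ℝ)) w ∂(slotLaw n) := by
    refine integral_mono_ae hi hi' ?_
    filter_upwards [h.one_le hR hκ] with w hw
    rw [sum_indicator_eq_card, sum_indicator_eq_card]
    norm_cast
    -- A triple `(j, s, s')` is determined by `(s, s')`, as `s` is in range of only one active node;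
    -- moreover `s` and `s'` are within `2 R` of each other. So the triples are no more numerous
    -- than the close pairs.
    refine Finset.card_le_card_of_injOn Prod.snd ?_ ?_
    · rintro ⟨j, s, s'⟩ hq
      simp [hitAll, hI] at hq ⊢
      refine ⟨hq.1.2.2, ?_⟩
      have := eucl_triangle (w s).1 (w j).1 (w s').1
      rw [eucl_comm (w j).1] at this
      linarith
    · rintro ⟨j, s, s'⟩ hq ⟨j', t, t'⟩ hq' hst
      simp [hitAll, hI] at hq hq' hst
      obtain ⟨rfl, rfl⟩ := hst
      rw [hw s j hq.2.1 j' hq'.2.1 hq.2.2.1 hq'.2.2.1]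
  have hc : ∀ q ∈ I, (slotLaw n).real (hitAll R act q.1 {q.2.1, q.2.2}) =
      (slotLaw n).real (hitAll R act j {s, s'}) := by
    rintro ⟨i, t, t'⟩ hq
    simp only [hI, Finset.mem_filter, Finset.mem_univ, true_and] at hq
    refine hsym.measureReal_hitAll_congr ?_ ?_ ?_
    · simp [hq.1.symm, hq.2.1.symm]
    · simp [hs.symm, hs'.symm]
    · rw [Finset.card_pair hq.2.2, Finset.card_pair hss]
  rw [he, he', Finset.sum_congr rfl hc, Finset.sum_const, nsmul_eq_mul] at hle
  have hoff : ((Finset.univ : Finset (Fin n)).offDiag.card : ℝ) = n * (n - 1) := by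
    rw [Finset.offDiag_card, Finset.card_univ, Fintype.card_fin, Nat.cast_sub (Nat.le_mul_self n)]
    push_cast; ring
  have hIcard : (I.card : ℝ) = n * (n - 1) * (n - 2) := by
    have h1 : I.card = ∑ q ∈ (Finset.univ : Finset (Fin n)).offDiag, (n - 2) := by
      have h2 : I.card = ((Finset.univ : Finset (Fin n)).offDiag.sigma fun q =>
          (Finset.univ : Finset (Fin n)) \ {q.1, q.2}).card := by
        refine Finset.card_bij' (fun q _ => ⟨q.2, q.1⟩) (fun q _ => (q.2, q.1)) ?_ ?_ ?_ ?_
        · rintro ⟨j, s, s'⟩ h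
          simp [hI] at h ⊢
          exact ⟨h.2.2, Ne.symm h.1, Ne.symm h.2.1⟩
        · rintro ⟨⟨s, s'⟩, j⟩ h
          simp [hI] at h ⊢
          exact ⟨Ne.symm h.2.1, Ne.symm h.2.2, h.1⟩
        · simp
        · simp
      rw [h2, Finset.card_sigma]
      refine Finset.sum_congr rfl fun q hq => ?_
      rw [Finset.mem_offDiag] at hq
      rw [Finset.card_sdiff_of_subset (Finset.subset_univ _), Finset.card_pair hq.2.2]
      simp
    rw [h1, Finset.sum_const, smul_eq_mul, Nat.cast_mul, hoff, Nat.cast_sub (by omega)]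
    push_cast; ring
  have hnear : ∑ q ∈ (Finset.univ : Finset (Fin n)).offDiag,
      (slotLaw n).real {w | eucl (w q.1).1 (w q.2).1 ≤ 2 * R} ≤ n * (n - 1) * (16 * R ^ 2) := by
    rw [← hoff, ← nsmul_eq_mul, ← Finset.sum_const]
    refine Finset.sum_le_sum fun q hq => ?_
    rw [Finset.mem_offDiag] at hq
    refine (measureReal_near_le hq.2.2 (by positivity)).trans (le_of_eq (by ring))
  have hn' : (3 : ℝ) ≤ n := by exact_mod_cast hn
  rw [hIcard] at hle
  have h3 := hle.trans hnear
  have hpos : (0 : ℝ) < n * (n - 1) := by nlinarith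
  have h4 : (n - 2) * (slotLaw n).real (hitAll R act j {s, s'}) ≤ 16 * R ^ 2 := by
    rw [mul_assoc] at h3
    exact le_of_mul_le_mul_left h3 hpos
  rw [le_div_iff₀ (by linarith)]
  -- Here `n ≥ 3` turns `16 R² / (n - 2)` into `48 R² / n`.
  have h5 : (n : ℝ) ≤ 3 * (n - 2) := by linarith
  have h6 : 0 ≤ (slotLaw n).real (hitAll R act j {s, s'}) := measureReal_nonneg
  nlinarith

/-- The expected total degree of the active nodes is of order `n`. -/
lemma IsFairAllocation.le_integral_sum_degree (h : IsFairAllocation (κ * R) act) (hR : 0 < R)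
    (hκ : 2 < κ) {a : ℝ} (ha0 : 0 < a) (ha : ∀ z, a ≤ area.real (disc z (R / 2)))
    (hint : Integrable (fun w => ∑ j ∈ act w, (degree R (fun i => (w i).1) j : ℝ)) (slotLaw n))
    (hlarge : Real.exp (-(n * a / 4)) ≤ 1 / 2)
    (hlarge' : 64 * ((κ + 1) * R) ^ 2 * Real.exp (-(n * a / 4)) ≤ a) :
    n * a / (64 * ((κ + 1) * R) ^ 2) ≤
      ∫ w, ∑ j ∈ act w, (degree R (fun i => (w i).1) j : ℝ) ∂(slotLaw n) := by
  -- A degree threshold of the order of the mean number of nodes in a disc, yet small enough for the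
  -- factor `exp T` of the penalty to be beaten by the mean emptiness `exp (-n a / 2)`.
  set T : ℝ := n * a / 4 with hT
  have hT0 : 0 ≤ T := by positivity
  set J : ℝ := ∫ w : Slot n, emptiness (R / 2) (fun i => (w i).1) ∂(slotLaw n) with hJ
  have hJle : J ≤ Real.exp (-(n * a / 2)) := integral_emptiness_le n ha
  have hem := integrable_emptiness n (R / 2)
  set q : ℝ := 4 * ((κ + 1) * R) ^ 2 with hq
  have hq0 : 0 < q := by have : 0 < (κ + 1) * R := mul_pos (by linarith) hR; positivity
  have h1 : T * (1 - J) / q - 2 * T * Real.exp T * J / a ≤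
      ∫ w, ∑ j ∈ act w, (degree R (fun i => (w i).1) j : ℝ) ∂(slotLaw n) := by
    have hi1 : Integrable (fun w : Slot n => T * (1 - emptiness (R / 2) (fun i => (w i).1)) / q)
        (slotLaw n) := (((integrable_const _).sub hem).const_mul T).div_const q
    have hi2 : Integrable (fun w : Slot n => 2 * T * Real.exp T *
        emptiness (R / 2) (fun i => (w i).1) / a) (slotLaw n) := (hem.const_mul _).div_const a
    calc _ = ∫ w : Slot n, (T * (1 - emptiness (R / 2) (fun i => (w i).1)) / q -
          2 * T * Real.exp T * emptiness (R / 2) (fun i => (w i).1) / a) ∂(slotLaw n) := by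
          rw [integral_sub hi1 hi2, integral_div, integral_div, integral_const_mul,
            integral_const_mul, integral_sub (integrable_const _) hem]
          simp [hJ]
      _ ≤ _ := by
          refine integral_mono_ae (hi1.sub hi2) hint ?_
          filter_upwards [h.exclusive, h.maximal] with w hw1 hw2
          exact le_sum_degree (x := fun i => (w i).1) hR hκ hw1 hw2 ha0 ha hT0
  refine le_trans ?_ h1
  have hJ2 : Real.exp T * J ≤ Real.exp (-(n * a / 4)) := by
    calc Real.exp T * J ≤ Real.exp T * Real.exp (-(n * a / 2)) :=
          mul_le_mul_of_nonneg_left hJle (Real.exp_pos _).le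
      _ = _ := by rw [← Real.exp_add]; congr 1; rw [hT]; ring
  have hJ1 : J ≤ 1 / 2 := by
    refine hJle.trans (le_trans (Real.exp_le_exp.2 ?_) hlarge)
    have : 0 ≤ n * a := by positivity
    linarith
  have e1 : T * (1 / 2) / q ≤ T * (1 - J) / q := by gcongr; linarith
  have e2 : 2 * T * Real.exp T * J / a ≤ 2 * T * (1 / (16 * q)) := by
    rw [div_le_iff₀ ha0]
    have e3 : Real.exp T * J ≤ 1 / (16 * q) * a := by
      refine hJ2.trans ?_
      rw [div_mul_eq_mul_div, one_mul, le_div_iff₀ (by positivity)]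
      calc _ = 64 * ((κ + 1) * R) ^ 2 * Real.exp (-(n * a / 4)) := by rw [hq]; ring
        _ ≤ a := hlarge'
    calc 2 * T * Real.exp T * J = 2 * T * (Real.exp T * J) := by ring
      _ ≤ 2 * T * (1 / (16 * q) * a) := by gcongr
      _ = _ := by ring
  have e4 : n * a / (64 * ((κ + 1) * R) ^ 2) = T * (1 / 2) / q - 2 * T * (1 / (8 * q)) := by
    have : 64 * ((κ + 1) * R) ^ 2 = 16 * q := by rw [hq]; ring
    rw [this, hT]; field_simp; ring
  rw [e4]
  have e5 : 2 * T * (1 / (16 * q)) ≤ 2 * T * (1 / (8 * q)) := by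
    gcongr; norm_num
  linarith

/-- The expected number of active nodes is of order `1 / R²`. -/
lemma IsFairAllocation.le_integral_card (h : IsFairAllocation (κ * R) act) (hR : 0 < R)
    (hκ : 2 < κ) {a : ℝ} (ha : ∀ z, a ≤ area.real (disc z (R / 2)))
    (hint : Integrable (fun w => ((act w).card : ℝ)) (slotLaw n))
    (hlarge : Real.exp (-(n * a / 2)) ≤ 1 / 2) :
    1 / (8 * ((κ + 1) * R) ^ 2) ≤ ∫ w, ((act w).card : ℝ) ∂(slotLaw n) := by
  have hem := integrable_emptiness n (R / 2)
  have hJle := integral_emptiness_le n ha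
  have hq0 : 0 < (κ + 1) * R := mul_pos (by linarith) hR
  have h1 : ∫ w : Slot n, (1 - emptiness (R / 2) (fun i => (w i).1)) ∂(slotLaw n) ≤
      ∫ w, ((act w).card : ℝ) * (4 * ((κ + 1) * R) ^ 2) ∂(slotLaw n) := by
    refine integral_mono_ae ((integrable_const _).sub hem) (hint.mul_const _) ?_
    filter_upwards [h.maximal] with w hw
    exact one_sub_emptiness_le (x := fun i => (w i).1) hR (by linarith) hw
  rw [integral_sub (integrable_const _) hem, integral_mul_const] at h1
  simp only [integral_const, probReal_univ, smul_eq_mul, mul_one] at h1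
  rw [div_le_iff₀ (by positivity)]
  linarith

/-- As `κ > 2`, the discs of radius `R` about the active nodes are disjoint, and each has area at
least `a`. -/
lemma IsFairAllocation.integral_card_le (h : IsFairAllocation (κ * R) act) (hR : 0 < R)
    (hκ : 2 < κ) {a : ℝ} (ha0 : 0 < a) (ha : ∀ z, a ≤ area.real (disc z R))
    (hint : Integrable (fun w => ((act w).card : ℝ)) (slotLaw n)) :
    ∫ w, ((act w).card : ℝ) ∂(slotLaw n) ≤ 1 / a := by
  calc ∫ w, ((act w).card : ℝ) ∂(slotLaw n) ≤ ∫ w, 1 / a ∂(slotLaw n) := by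
        refine integral_mono_ae hint (integrable_const _) ?_
        filter_upwards [h.exclusive] with w hw
        rw [le_div_iff₀ ha0]
        refine card_mul_area_le (r := R) (act w) (fun i => (w i).1) (fun i hi j hj hij => ?_) ha
        exact lt_of_lt_of_le (by nlinarith) (hw i hi j hj hij)
    _ = 1 / a := by simp

end expectation

set_option maxHeartbeats 800000 in
/-- Probabilities of activity and of reception under a fair allocation. -/
lemma exists_fair_bounds {κ B : ℝ} (hκ : 2 < κ) (hB : 1 ≤ B) :
    ∃ c C N₀ : ℝ, 0 < c ∧ 0 < C ∧ ∀ {n : ℕ} {R : ℝ} {act : Slot n → Finset (Fin n)}, 3 ≤ n → 0 < R →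
      R ≤ B → N₀ ≤ n * R ^ 2 → IsFairAllocation (κ * R) act → ∀ j : Fin n,
      (c / (n * R ^ 2) ≤ (slotLaw n).real {w | j ∈ act w} ∧
        (slotLaw n).real {w | j ∈ act w} ≤ C / (n * R ^ 2)) ∧
      ∀ V : Finset (Fin n), j ∉ V →
        c / (n * R ^ 2) * min 1 (V.card * R ^ 2) ≤ (slotLaw n).real (hit R act j V) ∧
        (slotLaw n).real (hit R act j V) ≤ C / (n * R ^ 2) * min 1 (V.card * R ^ 2) := by
  have hB0 : 0 < B := by linarith
  have hκ1 : 0 < κ + 1 := by linarith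
  -- Discs of radius `R / 2` have area at least `b R²`, the mean total degree will be at least `d
  -- n`, and `η` is how small `exp (-n a / 4)` has to be for that.
  set b : ℝ := 1 / (16 * B ^ 2) with hb
  have hb0 : 0 < b := by positivity
  set d : ℝ := b / (64 * (κ + 1) ^ 2) with hd
  have hd0 : 0 < d := by positivity
  set η : ℝ := min (1 / 2) d with hη
  have hη0 : 0 < η := lt_min (by norm_num) hd0
  -- The first bound is for the probability of being active. The second comes from the second moment
  -- bound with single probabilities at least `d / n` and pair probabilities at most `48 R² / n`.
  obtain ⟨c₁, hc₁, hc₁'⟩ : ∃ c : ℝ, 0 < c ∧ c ≤ 1 / (8 * (κ + 1) ^ 2) ∧ c ≤ d ^ 2 / (d + 48) :=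
    ⟨min (1 / (8 * (κ + 1) ^ 2)) (d ^ 2 / (d + 48)), lt_min (by positivity) (by positivity),
      min_le_left _ _, min_le_right _ _⟩
  -- `4 B²` is the packing constant, `2` comes from `g ≤ 2 / n`, and the last entry guarantees `exp
  -- (-n a / 4) ≤ η`.
  refine ⟨c₁, 4 * B ^ 2 + 2, 4 / b * (-Real.log η), hc₁, by positivity, ?_⟩
  intro n R act hn hR hRB hN h j
  have hn' : (3 : ℝ) ≤ n := by exact_mod_cast hn
  have hn0 : (0 : ℝ) < n := by linarith
  have hR2 : 0 < R ^ 2 := by positivity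
  have hsym := h.isSymmetricRule
  set a : ℝ := b * R ^ 2 with ha
  have ha0 : 0 < a := by positivity
  have haR : ∀ z, a ≤ area.real (disc z (R / 2)) := fun z => by
    refine le_trans (le_of_eq ?_) (le_area_disc_of_le z (r := R / 2) (B := B) (by positivity) hB
      (by linarith))
    rw [ha, hb]; field_simp; ring
  have haR' : ∀ z, 1 / (4 * B ^ 2) * R ^ 2 ≤ area.real (disc z R) := fun z =>
    le_trans (le_of_eq (by ring)) (le_area_disc_of_le z hR.le hB hRB)
  have hexp : Real.exp (-(n * a / 4)) ≤ η := by
    rw [← Real.exp_log hη0, Real.exp_le_exp, ha]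
    have : 4 / b * (-Real.log η) * (b / 4) ≤ n * R ^ 2 * (b / 4) :=
      mul_le_mul_of_nonneg_right hN (by positivity)
    have e : 4 / b * (-Real.log η) * (b / 4) = -Real.log η := by field_simp
    rw [e] at this
    linarith
  have hexp1 : Real.exp (-(n * a / 4)) ≤ 1 / 2 := hexp.trans (min_le_left _ _)
  have hexp2 : 64 * ((κ + 1) * R) ^ 2 * Real.exp (-(n * a / 4)) ≤ a := by
    calc _ ≤ 64 * ((κ + 1) * R) ^ 2 * d := by
          gcongr; exact hexp.trans (min_le_right _ _)
      _ = a := by rw [hd, ha]; field_simp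
  have hexp3 : Real.exp (-(n * a / 2)) ≤ 1 / 2 := by
    refine le_trans (Real.exp_le_exp.2 ?_) hexp1
    have : 0 ≤ n * a := by positivity
    linarith
  obtain ⟨hci, hce⟩ := hsym.sum_measureReal_mem j
  have hp1 := h.le_integral_card hR hκ haR hci hexp3
  have hp2 := h.integral_card_le hR hκ (by positivity) haR' hci
  rw [hce] at hp1 hp2
  set p := (slotLaw n).real {w | j ∈ act w} with hp
  have hpl : c₁ / (n * R ^ 2) ≤ p := by
    rw [div_le_iff₀ (by positivity)]
    calc c₁ ≤ 1 / (8 * (κ + 1) ^ 2) := hc₁'.1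
      _ = 1 / (8 * ((κ + 1) * R) ^ 2) * R ^ 2 := by field_simp
      _ ≤ n * p * R ^ 2 := by gcongr
      _ = _ := by ring
  have hpu : p ≤ 4 * B ^ 2 / (n * R ^ 2) := by
    rw [le_div_iff₀ (by positivity)]
    calc p * (n * R ^ 2) = n * p * R ^ 2 := by ring
      _ ≤ 1 / (1 / (4 * B ^ 2) * R ^ 2) * R ^ 2 := by gcongr
      _ = _ := by field_simp
  refine ⟨⟨hpl, hpu.trans (by gcongr; linarith)⟩, fun V hj => ?_⟩
  rcases V.eq_empty_or_nonempty with rfl | ⟨s, hs⟩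
  · simp [hit]
  have hjs : j ≠ s := fun e => hj (e ▸ hs)
  obtain ⟨hdi, hde⟩ := hsym.integral_sum_degree (R := R) hjs
  have hg1 := h.le_integral_sum_degree hR hκ ha0 haR hdi hexp1 hexp2
  have hg2 : ∫ w, ∑ j ∈ act w, (degree R (fun i => (w i).1) j : ℝ) ∂(slotLaw n) ≤ n := by
    calc _ ≤ ∫ w, (n : ℝ) ∂(slotLaw n) :=
          integral_mono_ae hdi (integrable_const _) (h.sum_degree_le hR hκ)
      _ = n := by simp
  rw [hde] at hg1 hg2
  set g := (slotLaw n).real (hit R act j {s}) with hg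
  have hgs : ∀ t ∈ V, (slotLaw n).real (hit R act j {t}) = g := fun t ht =>
    hsym.measureReal_hit_congr (by simpa using (ne_of_mem_of_not_mem ht hj).symm) (by simpa using hjs) (by simp)
  have hg0 : 0 ≤ g := measureReal_nonneg
  have hgl : d / n ≤ g := by
    have e : n * a / (64 * ((κ + 1) * R) ^ 2) = n * d := by rw [ha, hd]; field_simp
    rw [e, mul_assoc] at hg1
    have h1 := le_of_mul_le_mul_left hg1 hn0
    rw [div_le_iff₀ hn0]
    linarith
  have hgu : g ≤ 2 / n := by
    rw [mul_assoc] at hg2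
    have h1 : (n - 1) * g ≤ 1 := le_of_mul_le_mul_left (hg2.trans_eq (mul_one _).symm) hn0
    rw [le_div_iff₀ hn0]
    have h2 : (3 : ℝ) * g ≤ n * g := mul_le_mul_of_nonneg_right hn' hg0
    linarith
  set u : ℝ := (V.card : ℝ) with hu
  have hu1 : 0 < u := by rw [hu]; exact_mod_cast Finset.card_pos.2 ⟨s, hs⟩
  constructor
  · have hgp : 0 < g := lt_of_lt_of_le (by positivity) hgl
    have h2 := hsym.le_measureReal_hit (R := R) (V := V) (j := j) hgp
      (show 0 ≤ 48 * R ^ 2 / n by positivity) hgs (fun t ht t' ht' htt =>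
        h.measureReal_hitAll_pair_le hR hκ hn (fun e => hj (e ▸ ht)) (fun e => hj (e ▸ ht')) htt)
    refine le_trans ?_ h2
    rw [← hu, le_div_iff₀ (by positivity)]
    have hm1 : min 1 (u * R ^ 2) ≤ 1 := min_le_left _ _
    have hm2 : min 1 (u * R ^ 2) ≤ u * R ^ 2 := min_le_right _ _
    have hm0 : 0 < min 1 (u * R ^ 2) := lt_min one_pos (by positivity)
    set m := min 1 (u * R ^ 2)
    have h48 : 48 * R ^ 2 / n ≤ 48 * R ^ 2 / d * g := by
      calc 48 * R ^ 2 / n = 48 * R ^ 2 / d * (d / n) := by field_simp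
        _ ≤ _ := by gcongr
    -- Of the minimum `m = min 1 (u R²)`, one term uses `m ≤ u R²` and the other `m ≤ 1`.
    calc c₁ / (n * R ^ 2) * m * (g + u * (48 * R ^ 2 / n))
        ≤ (d ^ 2 / (d + 48)) / (n * R ^ 2) * m * (g + u * (48 * R ^ 2 / d * g)) := by
          gcongr; exact hc₁'.2
      _ = (d / n) * g * ((m * d + 48 * m * (u * R ^ 2)) / (R ^ 2 * (d + 48))) := by
          field_simp
      _ ≤ (d / n) * g * ((u * R ^ 2 * d + 48 * 1 * (u * R ^ 2)) / (R ^ 2 * (d + 48))) := by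
          gcongr
      _ = u * ((d / n) * g) := by field_simp
      _ ≤ u * (g * g) := by gcongr
      _ = _ := by ring
  · rw [mul_min_of_nonneg _ _ (by positivity), mul_one]
    refine le_min ?_ ?_
    · calc _ ≤ p := measureReal_mono (fun w hw => hw.1) (measure_ne_top _ _)
        _ ≤ _ := hpu.trans (by gcongr; linarith)
    · have h3 : hit R act j V ⊆ ⋃ t ∈ V, hit R act j {t} := by
        rintro w ⟨hw, t, ht, hd⟩
        simp only [Set.mem_iUnion]
        exact ⟨t, ht, hw, t, by simp, hd⟩
      calc _ ≤ (slotLaw n).real (⋃ t ∈ V, hit R act j {t}) :=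
            measureReal_mono h3 (measure_ne_top _ _)
        _ ≤ ∑ t ∈ V, (slotLaw n).real (hit R act j {t}) := measureReal_biUnion_finset_le _ _
        _ = u * g := by rw [Finset.sum_congr rfl hgs]; simp [hu]
        _ ≤ u * (2 / n) := by gcongr
        _ = 2 / (n * R ^ 2) * (u * R ^ 2) := by field_simp
        _ ≤ _ := by gcongr; nlinarith

/-! ### A law of large numbers for controlled chains -/

section chain

variable {Ω S : Type*}

/-- The chain with transition map `F`, driven by the noise `w`. -/
def chain (F : Ω → S → S) (σ₀ : S) (w : ℕ → Ω) : ℕ → S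
  | 0 => σ₀
  | t + 1 => F (w t) (chain F σ₀ w t)

lemma chain_congr (F : Ω → S → S) (σ₀ : S) {w w' : ℕ → Ω} {t : ℕ} (h : ∀ s < t, w s = w' s) :
    chain F σ₀ w t = chain F σ₀ w' t := by
  induction t with
  | zero => rfl
  | succ t ih => rw [chain, chain, ih fun s hs => h s (by omega), h t (by omega)]

/-- Partial sums of a reward along the chain. -/
def reward (F : Ω → S → S) (σ₀ : S) (h : S → Ω → ℝ) (w : ℕ → Ω) (t : ℕ) : ℝ :=
  ∑ s ∈ Finset.range t, h (chain F σ₀ w s) (w s)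

lemma reward_congr (F : Ω → S → S) (σ₀ : S) (h : S → Ω → ℝ) {w w' : ℕ → Ω} {t : ℕ}
    (hw : ∀ s < t, w s = w' s) : reward F σ₀ h w t = reward F σ₀ h w' t := by
  refine Finset.sum_congr rfl fun s hs => ?_
  rw [Finset.mem_range] at hs
  rw [chain_congr F σ₀ fun r hr => hw r (hr.trans hs), hw s hs]

lemma abs_reward_le (F : Ω → S → S) (σ₀ : S) {h : S → Ω → ℝ} {B : ℝ} (hB : ∀ σ ω, |h σ ω| ≤ B)
    (w : ℕ → Ω) (t : ℕ) : |reward F σ₀ h w t| ≤ t * B := by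
  calc |reward F σ₀ h w t| ≤ ∑ s ∈ Finset.range t, |h (chain F σ₀ w s) (w s)| :=
        Finset.abs_sum_le_sum_abs _ _
    _ ≤ ∑ s ∈ Finset.range t, B := Finset.sum_le_sum fun s _ => hB _ _
    _ = t * B := by simp

variable [MeasurableSpace Ω] [MeasurableSpace S] [Countable S] [MeasurableSingletonClass S]

lemma measurable_chain {F : Ω → S → S} (hF : ∀ σ, Measurable fun ω => F ω σ) (σ₀ : S) (t : ℕ) :
    Measurable fun w : ℕ → Ω => chain F σ₀ w t := by
  induction t with
  | zero => exact measurable_const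
  | succ t ih =>
    have h : Measurable fun p : S × Ω => F p.2 p.1 := measurable_from_prod_countable_right hF
    exact h.comp (ih.prodMk (measurable_pi_apply t))

lemma measurable_reward {F : Ω → S → S} (hF : ∀ σ, Measurable fun ω => F ω σ) (σ₀ : S)
    {h : S → Ω → ℝ} (hh : ∀ σ, Measurable (h σ)) (t : ℕ) :
    Measurable fun w : ℕ → Ω => reward F σ₀ h w t := by
  refine Finset.measurable_fun_sum _ fun s _ => ?_
  have h : Measurable fun p : S × Ω => h p.1 p.2 := measurable_from_prod_countable_right hh
  exact h.comp ((measurable_chain hF σ₀ s).prodMk (measurable_pi_apply s))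

/-- The past of the noise is independent of the present. -/
lemma indepFun_past {β : Type*} [MeasurableSpace β] (μ : Measure Ω) [IsProbabilityMeasure μ]
    {t : ℕ} {f : (ℕ → Ω) → β} (hf : Measurable f)
    (hft : ∀ w w' : ℕ → Ω, (∀ s < t, w s = w' s) → f w = f w') :
    ProbabilityTheory.IndepFun f (fun w => w t) (Measure.infinitePi fun _ : ℕ => μ) := by
  classical
  have hne : Nonempty Ω := nonempty_of_isProbabilityMeasure μ
  obtain ⟨o⟩ := hne
  have hI := ProbabilityTheory.iIndepFun_infinitePi (P := fun _ : ℕ => μ)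
    (X := fun _ ω => ω) (fun _ => measurable_id)
  have h1 := hI.indepFun_finset (Finset.range t) {t} (by simp) (fun i => measurable_pi_apply i)
  -- A function that ignores the coordinates from `t` on factors through the first `t` ones: prolong
  -- them by a constant.
  let ext : (Finset.range t → Ω) → ℕ → Ω := fun v i =>
    if hi : i ∈ Finset.range t then v ⟨i, hi⟩ else o
  have hext : Measurable ext := by
    refine measurable_pi_lambda _ fun i => ?_
    by_cases hi : i ∈ Finset.range t
    · simp only [ext, hi, dif_pos]; exact measurable_pi_apply _
    · simp only [ext, hi, dif_neg, not_false_eq_true]; exact measurable_const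
  have h2 := h1.comp (hf.comp hext)
    (measurable_pi_apply (⟨t, Finset.mem_singleton_self t⟩ : ({t} : Finset ℕ)))
  convert h2 using 1
  · funext w
    refine hft _ _ fun s hs => ?_
    simp [ext, hs]
  · rfl

/-- The present reward is uncorrelated with the past rewards. -/
lemma integral_reward_mul (μ : Measure Ω) [IsProbabilityMeasure μ] {F : Ω → S → S}
    (hF : ∀ σ, Measurable fun ω => F ω σ) (σ₀ : S) {h : S → Ω → ℝ} (hh : ∀ σ, Measurable (h σ))
    {B : ℝ} (hB : ∀ σ ω, |h σ ω| ≤ B) (h0 : ∀ σ, ∫ ω, h σ ω ∂μ = 0) (t : ℕ) :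
    ∫ w, reward F σ₀ h w t * h (chain F σ₀ w t) (w t) ∂(Measure.infinitePi fun _ : ℕ => μ) = 0 := by
  set P := Measure.infinitePi fun _ : ℕ => μ with hP
  let Z : (ℕ → Ω) → S × ℝ := fun w => (chain F σ₀ w t, reward F σ₀ h w t)
  have hZ : Measurable Z := (measurable_chain hF σ₀ t).prodMk (measurable_reward hF σ₀ hh t)
  have hind : ProbabilityTheory.IndepFun Z (fun w => w t) P := by
    refine indepFun_past μ hZ fun w w' hw => ?_
    simp only [Z, chain_congr F σ₀ hw, reward_congr F σ₀ h hw]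
  have hm : Measurable fun p : S × Ω => h p.1 p.2 := measurable_from_prod_countable_right hh
  let G : (S × ℝ) × Ω → ℝ := fun p => p.1.2 * h p.1.1 p.2
  have hG : Measurable G :=
    measurable_fst.snd.mul (hm.comp (measurable_fst.fst.prodMk measurable_snd))
  have hmap := (ProbabilityTheory.indepFun_iff_map_prod_eq_prod_map_map hZ.aemeasurable
    (measurable_pi_apply t).aemeasurable).1 hind
  have het : P.map (fun w => w t) = μ := Measure.infinitePi_map_eval (fun _ => μ) t
  rw [het] at hmap
  have hpair : Measurable fun w : ℕ → Ω => (Z w, w t) := hZ.prodMk (measurable_pi_apply t)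
  have hint : Integrable G ((P.map Z).prod μ) := by
    rw [← hmap, integrable_map_measure hG.aestronglyMeasurable hpair.aemeasurable]
    refine integrable_of_bounded (hG.comp hpair) (t * B * B) fun w => ?_
    simp only [Function.comp, G, Z, abs_mul]
    exact mul_le_mul (abs_reward_le F σ₀ hB w t) (hB _ _) (abs_nonneg _)
      ((abs_nonneg _).trans (abs_reward_le F σ₀ hB w t))
  calc ∫ w, reward F σ₀ h w t * h (chain F σ₀ w t) (w t) ∂P = ∫ w, G (Z w, w t) ∂P := rfl
    _ = ∫ p, G p ∂(P.map fun w => (Z w, w t)) :=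
        (integral_map hpair.aemeasurable hG.aestronglyMeasurable).symm
    _ = ∫ z, ∫ ω, G (z, ω) ∂μ ∂(P.map Z) := by rw [hmap, integral_prod _ hint]
    _ = 0 := by simp [G, integral_const_mul, h0]

/-- The increments are orthogonal by `integral_reward_mul`, so their second moments add up. -/
lemma integral_reward_sq_le (μ : Measure Ω) [IsProbabilityMeasure μ] {F : Ω → S → S}
    (hF : ∀ σ, Measurable fun ω => F ω σ) (σ₀ : S) {h : S → Ω → ℝ} (hh : ∀ σ, Measurable (h σ))
    {B : ℝ} (hB : ∀ σ ω, |h σ ω| ≤ B) (h0 : ∀ σ, ∫ ω, h σ ω ∂μ = 0) (t : ℕ) :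
    ∫ w, reward F σ₀ h w t ^ 2 ∂(Measure.infinitePi fun _ : ℕ => μ) ≤ t * B ^ 2 := by
  induction t with
  | zero => simp [reward]
  | succ t ih =>
    set P := Measure.infinitePi fun _ : ℕ => μ with hP
    have hm : Measurable fun p : S × Ω => h p.1 p.2 := measurable_from_prod_countable_right hh
    have hd : Measurable fun w : ℕ → Ω => h (chain F σ₀ w t) (w t) :=
      hm.comp ((measurable_chain hF σ₀ t).prodMk (measurable_pi_apply t))
    have hr := measurable_reward hF σ₀ hh t
    have hb := fun w => abs_reward_le F σ₀ hB w t
    have i1 : Integrable (fun w => reward F σ₀ h w t ^ 2) P :=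
      integrable_of_bounded (hr.pow_const 2) ((t * B) ^ 2) fun w => by
        rw [abs_pow]; exact pow_le_pow_left₀ (abs_nonneg _) (hb w) 2
    have i2 : Integrable (fun w => reward F σ₀ h w t * h (chain F σ₀ w t) (w t)) P :=
      integrable_of_bounded (hr.mul hd) (t * B * B) fun w => by
        rw [abs_mul]
        exact mul_le_mul (hb w) (hB _ _) (abs_nonneg _) ((abs_nonneg _).trans (hb w))
    have i3 : Integrable (fun w => h (chain F σ₀ w t) (w t) ^ 2) P :=
      integrable_of_bounded (hd.pow_const 2) (B ^ 2) fun w => by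
        rw [abs_pow]; exact pow_le_pow_left₀ (abs_nonneg _) (hB _ _) 2
    have e : ∀ w, reward F σ₀ h w (t + 1) ^ 2 = reward F σ₀ h w t ^ 2 +
        2 * (reward F σ₀ h w t * h (chain F σ₀ w t) (w t)) + h (chain F σ₀ w t) (w t) ^ 2 := by
      intro w
      rw [reward, Finset.sum_range_succ, ← reward]; ring
    simp_rw [e]
    have i12 : Integrable (fun w => reward F σ₀ h w t ^ 2 +
      2 * (reward F σ₀ h w t * h (chain F σ₀ w t) (w t))) P := i1.add (i2.const_mul 2)
    rw [integral_add i12 i3, integral_add i1 (i2.const_mul 2),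
      integral_const_mul, integral_reward_mul μ hF σ₀ hh hB h0 t]
    have h3 : ∫ w, h (chain F σ₀ w t) (w t) ^ 2 ∂P ≤ B ^ 2 := by
      calc _ ≤ ∫ w, B ^ 2 ∂P := integral_mono i3 (integrable_const _) fun w => by
            rw [← sq_abs]; exact pow_le_pow_left₀ (abs_nonneg _) (hB _ _) 2
        _ = B ^ 2 := by simp
    push_cast
    linarith

/-- A sequence with bounded increments that is `o(t)` along the squares is `o(t)`. -/
lemma tendsto_div_of_tendsto_sq {s : ℕ → ℝ} {B : ℝ} (hs : ∀ t, |s (t + 1) - s t| ≤ B)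
    (hsq : Tendsto (fun k : ℕ => s (k ^ 2) / (k : ℝ) ^ 2) atTop (𝓝 0)) :
    Tendsto (fun t : ℕ => s t / t) atTop (𝓝 0) := by
  have hB : 0 ≤ B := (abs_nonneg _).trans (hs 0)
  have hinc : ∀ t d, |s (t + d) - s t| ≤ d * B := by
    intro t d
    induction d with
    | zero => simp
    | succ d ih =>
      calc |s (t + (d + 1)) - s t| = |(s (t + d + 1) - s (t + d)) + (s (t + d) - s t)| := by
            rw [← add_assoc]; ring_nf
        _ ≤ B + d * B := (abs_add_le _ _).trans (add_le_add (hs _) ih)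
        _ = _ := by push_cast; ring
  have hsqrt : Tendsto Nat.sqrt atTop atTop :=
    tendsto_atTop_mono (f := fun t => t.sqrt) (fun _ => le_rfl) <|
      tendsto_atTop_atTop.2 fun b => ⟨b * b, fun a ha => Nat.le_sqrt.2 ha⟩
  have hlim : Tendsto (fun k : ℕ => |s (k ^ 2) / (k : ℝ) ^ 2| + 2 * B / k) atTop (𝓝 0) := by
    have h1 := hsq.abs
    have h2 := tendsto_const_div_atTop_nhds_zero_nat (2 * B)
    simpa using h1.add h2
  refine squeeze_zero_norm' ?_ (hlim.comp hsqrt)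
  filter_upwards [eventually_ge_atTop 1] with t ht
  have hk1 : 1 ≤ t.sqrt := Nat.le_sqrt.2 (by simpa using ht)
  have hk2 : t.sqrt ^ 2 ≤ t := Nat.sqrt_le' t
  -- The preceding square is at most `2 k` steps back, where `k = √t` rounded down, which costs at
  -- most `2 B / k` after division.
  have hk3 : t ≤ t.sqrt ^ 2 + 2 * t.sqrt := by
    have := Nat.sqrt_le_add t
    nlinarith
  set k := t.sqrt
  obtain ⟨d, hd⟩ := Nat.exists_eq_add_of_le hk2
  have hd2 : d ≤ 2 * k := by omega
  have hk0 : (0 : ℝ) < k := by exact_mod_cast hk1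
  have hkt : (k : ℝ) ^ 2 ≤ t := by exact_mod_cast hk2
  simp only [Function.comp]
  rw [Real.norm_eq_abs, abs_div, abs_div, Nat.abs_cast, abs_of_pos (show (0 : ℝ) < (k : ℝ) ^ 2 by positivity)]
  have h1 : |s t| ≤ |s (k ^ 2)| + 2 * k * B := by
    have h2 := hinc (k ^ 2) d
    rw [← hd] at h2
    have h3 : (d : ℝ) * B ≤ 2 * k * B := mul_le_mul_of_nonneg_right (by exact_mod_cast hd2) hB
    have h4 := abs_sub_abs_le_abs_sub (s t) (s (k ^ 2))
    linarith
  calc |s t| / t ≤ (|s (k ^ 2)| + 2 * k * B) / (k : ℝ) ^ 2 := by gcongr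
    _ = |s (k ^ 2)| / (k : ℝ) ^ 2 + 2 * B / k := by field_simp

/-- Law of large numbers: rewards with conditional mean zero average to zero. -/
theorem ae_tendsto_reward_div (μ : Measure Ω) [IsProbabilityMeasure μ] {F : Ω → S → S}
    (hF : ∀ σ, Measurable fun ω => F ω σ) (σ₀ : S) {h : S → Ω → ℝ} (hh : ∀ σ, Measurable (h σ))
    {B : ℝ} (hB : ∀ σ ω, |h σ ω| ≤ B) (h0 : ∀ σ, ∫ ω, h σ ω ∂μ = 0) :
    ∀ᵐ w ∂(Measure.infinitePi fun _ : ℕ => μ),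
      Tendsto (fun t : ℕ => reward F σ₀ h w t / t) atTop (𝓝 0) := by
  set P := Measure.infinitePi fun _ : ℕ => μ with hP
  have hm := fun t => measurable_reward hF σ₀ hh t
  -- Along the squares the normalised second moments are at most `B² / k²`, hence summable, so
  -- almost surely the `f k w` have a finite sum and tend to zero.
  let f : ℕ → (ℕ → Ω) → ℝ≥0∞ := fun k w =>
    ENNReal.ofReal ((reward F σ₀ h w (k ^ 2) / (k : ℝ) ^ 2) ^ 2)
  have hf : ∀ k, Measurable (f k) := fun k => (((hm _).div_const _).pow_const 2).ennreal_ofReal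
  have hfi : ∀ k, ∫⁻ w, f k w ∂P ≤ ENNReal.ofReal (B ^ 2 * (1 / (k : ℝ) ^ 2)) := by
    intro k
    have hi : Integrable (fun w => (reward F σ₀ h w (k ^ 2) / (k : ℝ) ^ 2) ^ 2) P := by
      refine integrable_of_bounded (((hm _).div_const _).pow_const 2)
        (((k ^ 2 : ℕ) * B / (k : ℝ) ^ 2) ^ 2) fun w => ?_
      rw [abs_pow, abs_div, abs_of_nonneg (show (0 : ℝ) ≤ (k : ℝ) ^ 2 by positivity)]
      have := abs_reward_le F σ₀ hB w (k ^ 2)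
      gcongr
    rw [← ofReal_integral_eq_lintegral_ofReal hi (Eventually.of_forall fun w => sq_nonneg _)]
    refine ENNReal.ofReal_le_ofReal ?_
    simp_rw [div_pow]
    rw [integral_div]
    rcases Nat.eq_zero_or_pos k with rfl | hk
    · simp
    have hk0 : (0 : ℝ) < k := by exact_mod_cast hk
    rw [div_le_iff₀ (by positivity)]
    refine (integral_reward_sq_le μ hF σ₀ hh hB h0 (k ^ 2)).trans (le_of_eq ?_)
    push_cast; field_simp
  have hsum : ∫⁻ w, ∑' k, f k w ∂P ≠ ∞ := by
    rw [lintegral_tsum fun k => (hf k).aemeasurable]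
    refine ne_top_of_le_ne_top ?_ (ENNReal.tsum_le_tsum hfi)
    rw [← ENNReal.ofReal_tsum_of_nonneg (fun k => by positivity)
      ((Real.summable_one_div_nat_pow.2 one_lt_two).mul_left _)]
    exact ENNReal.ofReal_ne_top
  have hae := ae_lt_top (Measurable.tsum hf) hsum
  filter_upwards [hae] with w hw
  refine tendsto_div_of_tendsto_sq (B := B) (fun t => ?_) ?_
  · rw [reward, reward, Finset.sum_range_succ, add_sub_cancel_left]; exact hB _ _
  · have h1 := ENNReal.tendsto_atTop_zero_of_tsum_ne_top hw.ne
    have h2 := (ENNReal.tendsto_toReal ENNReal.zero_ne_top).comp h1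
    have h3 : Tendsto (fun k : ℕ => (reward F σ₀ h w (k ^ 2) / (k : ℝ) ^ 2) ^ 2) atTop (𝓝 0) := by
      refine h2.congr fun k => ?_
      simp only [Function.comp, f]
      rw [ENNReal.toReal_ofReal (sq_nonneg _)]
    have h4 := (Real.continuous_sqrt.tendsto _).comp h3
    rw [Real.sqrt_zero] at h4
    refine (tendsto_zero_iff_abs_tendsto_zero _).2 (h4.congr fun k => ?_)
    simp only [Function.comp]
    rw [Real.sqrt_sq_eq_abs]

end chain

/-! ### Measurability of the delivery process -/

instance : MeasurableSpace NodeState := ⊤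

instance : DiscreteMeasurableSpace NodeState := ⟨fun _ => trivial⟩

instance : Countable NodeState := by
  have : Function.Injective fun σ : NodeState => (σ.done, σ.got) := by
    rintro ⟨a, b⟩ ⟨c, d⟩ h
    simpa using h
  exact this.countable

/-- Every subset of a discrete space is measurable, so any map through finite slot data and discrete
states is measurable, whatever its definition. -/
lemma measurable_of_factors {Ω β D : Type*} [MeasurableSpace Ω] [MeasurableSpace β]
    [MeasurableSpace D] [DiscreteMeasurableSpace D] {f : Ω → β} {b : Ω → D} (hb : Measurable b)
    (hf : ∀ ω ω', b ω = b ω' → f ω = f ω') : Measurable f := by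
  intro T _
  have : f ⁻¹' T = b ⁻¹' (b '' (f ⁻¹' T)) := by
    refine Set.Subset.antisymm (Set.subset_preimage_image _ _) ?_
    rintro ω ⟨ω', h', e⟩
    rw [Set.mem_preimage, ← hf _ _ e]; exact h'
  rw [this]
  exact hb (MeasurableSet.of_discrete)

namespace System

variable {n M : ℕ} (N : System n M)

/-- The finite information about a slot on which deliveries depend. -/
abbrev SlotData (n : ℕ) : Type :=
  (Fin n → Prop) × (Fin n → Fin n → Prop) × (Fin n → Fin n → Fin n → Prop) × (Fin n → Fin n → Prop)

/-- The information about a slot on which deliveries depend: active requesters, nodes within range,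
order of distances, guard zones. -/
def slotData (A : Finset (Fin n)) (x : Fin n → Point) : SlotData n :=
  (fun j => j ∈ A, fun s j => eucl (x s) (x j) ≤ N.R,
    fun s s' j => eucl (x s) (x j) ≤ eucl (x s') (x j),
    fun b j => (1 + N.Δ) * N.R ≤ eucl (x b) (x j))

lemma measurable_slotData {act : Slot n → Finset (Fin n)}
    (hact : ∀ j, MeasurableSet {w | j ∈ act w}) :
    Measurable fun w : Slot n => N.slotData (act w) fun j => (w j).1 := by
  have h1 : ∀ (r : ℝ) (s j : Fin n), Measurable fun w : Slot n => eucl (w s).1 (w j).1 ≤ r :=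
    fun r s j => measurableSet_setOfPred.1 (measurableSet_near r s j)
  refine Measurable.prodMk ?_ (Measurable.prodMk ?_ (Measurable.prodMk ?_ ?_))
  · exact measurable_pi_lambda _ fun j => measurableSet_setOfPred.1 (hact j)
  · exact measurable_pi_lambda _ fun s => measurable_pi_lambda _ fun j => h1 _ s j
  · exact measurable_pi_lambda _ fun s => measurable_pi_lambda _ fun s' =>
      measurable_pi_lambda _ fun j => measurableSet_setOfPred.1
        (measurableSet_le (by fun_prop) (by fun_prop))
  · exact measurable_pi_lambda _ fun s => measurable_pi_lambda _ fun j =>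
      measurableSet_setOfPred.1 (measurableSet_le (by fun_prop) (by fun_prop))

lemma source_congr {A A' : Finset (Fin n)} {x x' : Fin n → Point}
    (h : N.slotData A x = N.slotData A' x') (j : Fin n) (m : Fin M) (Y : Finset ℕ) :
    N.source x j m Y = N.source x' j m Y := by
  simp only [slotData, Prod.mk.injEq] at h
  have h2 : ∀ s j, (eucl (x s) (x j) ≤ N.R) = (eucl (x' s) (x' j) ≤ N.R) := fun s j =>
    congrFun (congrFun h.2.1 s) j
  have h3 : ∀ s s' j, (eucl (x s) (x j) ≤ eucl (x s') (x j)) =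
      (eucl (x' s) (x' j) ≤ eucl (x' s') (x' j)) := fun s s' j =>
    congrFun (congrFun (congrFun h.2.2.1 s) s') j
  have hs : N.sources x j m Y = N.sources x' j m Y := by
    unfold sources
    ext s
    simp only [Finset.mem_filter, h2]
  unfold source
  congr 1
  ext s
  simp only [Finset.mem_filter, hs, h3]

/-- Besides the slot data, only the contents currently requested matter, so one step reads finitely
many discrete coordinates of a realization. -/
lemma delivered_congr {A A' : Finset (Fin n)} {x x' : Fin n → Point}
    {req req' : ℕ → Fin n → Fin M} (σ : Fin n → NodeState) (h : N.slotData A x = N.slotData A' x')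
    (hreq : ∀ i, req (σ i).done i = req' (σ i).done i) (j : Fin n) :
    N.delivered req A x σ j = N.delivered req' A' x' σ j := by
  have h1 : ∀ j, (j ∈ A) = (j ∈ A') := fun j => congrFun (congrArg Prod.fst h) j
  have h4 : ∀ b j, ((1 + N.Δ) * N.R ≤ eucl (x b) (x j)) = ((1 + N.Δ) * N.R ≤ eucl (x' b) (x' j)) :=
    fun b j => congrFun (congrFun (congrArg (fun d => d.2.2.2) h) b) j
  have hNI : ∀ j, N.NoInterference req A x σ j ↔ N.NoInterference req' A' x' σ j := by
    intro j
    simp only [NoInterference, h1, h4, hreq, N.source_congr h]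
  unfold delivered
  ext l
  simp only [Finset.mem_filter, hNI, h1, hreq, N.source_congr h]

lemma step_congr {A A' : Finset (Fin n)} {x x' : Fin n → Point} {req req' : ℕ → Fin n → Fin M}
    (σ : Fin n → NodeState) (h : N.slotData A x = N.slotData A' x')
    (hreq : ∀ i, req (σ i).done i = req' (σ i).done i) :
    N.step req A x σ = N.step req' A' x' σ := by
  funext j
  simp only [step, N.delivered_congr σ h hreq]

lemma measurable_step {act : Slot n → Finset (Fin n)} (hact : ∀ j, MeasurableSet {w | j ∈ act w})
    (σ : Fin n → NodeState) (t : ℕ) : Measurable fun ω : Realization n M =>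
      N.step ω.2 (act (ω.1 t)) (fun j => (ω.1 t j).1) σ := by
  have hb : Measurable fun ω : Realization n M =>
      (N.slotData (act (ω.1 t)) (fun j => (ω.1 t j).1), fun i => ω.2 (σ i).done i) := by
    refine Measurable.prodMk ((N.measurable_slotData hact).comp
      ((measurable_pi_apply t).comp measurable_fst)) ?_
    exact measurable_pi_lambda _ fun i => (measurable_pi_apply i).comp
      ((measurable_pi_apply (σ i).done).comp measurable_snd)
  refine measurable_of_factors hb fun ω ω' h => ?_
  rw [Prod.mk.injEq] at h
  exact N.step_congr σ h.1 fun i => congrFun h.2 i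

lemma measurable_step_slot {act : Slot n → Finset (Fin n)}
    (hact : ∀ j, MeasurableSet {w | j ∈ act w}) (req : ℕ → Fin n → Fin M)
    (σ : Fin n → NodeState) : Measurable fun w : Slot n =>
      N.step req (act w) (fun j => (w j).1) σ :=
  measurable_of_factors (N.measurable_slotData hact) fun _ _ h =>
    N.step_congr σ h fun _ => rfl

lemma measurable_run {act : Slot n → Finset (Fin n)} (hact : ∀ j, MeasurableSet {w | j ∈ act w})
    (t : ℕ) : Measurable fun ω : Realization n M => N.run act ω t := by
  induction t with
  | zero => exact measurable_const
  | succ t ih =>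
    let f : (Fin n → NodeState) × Realization n M → Fin n → NodeState := fun p =>
      N.step p.2.2 (act (p.2.1 t)) (fun j => (p.2.1 t j).1) p.1
    have h : Measurable f :=
      measurable_from_prod_countable_right fun σ => N.measurable_step hact σ t
    have hp : Measurable fun ω : Realization n M => (N.run act ω t, ω) :=
      Measurable.prodMk ih measurable_id
    have := h.comp hp
    exact this

/-- With the requests frozen, the joint state is a chain driven by i.i.d. slots. All nodes are kept
in the state because interference couples them. -/
lemma run_eq_chain (act : Slot n → Finset (Fin n)) (ω : Realization n M) (t : ℕ) :
    N.run act ω t = chain (fun w σ => N.step ω.2 (act w) (fun j => (w j).1) σ)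
      (fun _ => ⟨0, ∅⟩) ω.1 t := by
  induction t with
  | zero => rfl
  | succ t ih => rw [run, ih]; rfl

/-! ### Deliveries to one node -/

lemma source_eq_coe {x : Fin n → Point} {j s : Fin n} {m : Fin M} {Y : Finset ℕ}
    (h : N.source x j m Y = s) : eucl (x s) (x j) ≤ N.R ∧ (N.useful s m Y).Nonempty ∧
      ∀ s', eucl (x s') (x j) ≤ N.R → (N.useful s' m Y).Nonempty →
        eucl (x s) (x j) ≤ eucl (x s') (x j) := by
  classical
  have h1 := Finset.mem_of_min h
  rw [Finset.mem_filter] at h1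
  obtain ⟨h2, h3⟩ := h1
  simp only [sources, Finset.mem_filter, Finset.mem_univ, true_and] at h2 h3
  exact ⟨h2.1, h2.2, fun s' h4 h5 => h3 s' ⟨h4, h5⟩⟩

lemma exists_source {x : Fin n → Point} {j : Fin n} {m : Fin M} {Y : Finset ℕ}
    (h : ∃ s, eucl (x s) (x j) ≤ N.R ∧ (N.useful s m Y).Nonempty) :
    ∃ s : Fin n, N.source x j m Y = s := by
  classical
  have h1 : (N.sources x j m Y).Nonempty := by
    obtain ⟨s, hs⟩ := h
    exact ⟨s, by simpa [sources] using hs⟩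
  obtain ⟨s, hs, hmin⟩ := Finset.exists_min_image _ (fun s => eucl (x s) (x j)) h1
  unfold source
  exact Finset.min_of_nonempty ⟨s, Finset.mem_filter.2 ⟨hs, hmin⟩⟩

variable {req : ℕ → Fin n → Fin M} {A : Finset (Fin n)} {x : Fin n → Point} {σ : Fin n → NodeState}
  {j : Fin n}

/-- A delivery takes place exactly if the node is active, there is no interference and a useful
node is within range. -/
lemma delivered_nonempty_iff : (N.delivered req A x σ j).Nonempty ↔
    j ∈ A ∧ N.NoInterference req A x σ j ∧
      ∃ s, (N.useful s (req (σ j).done j) (σ j).got).Nonempty ∧ eucl (x s) (x j) ≤ N.R := by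
  classical
  constructor
  · rintro ⟨l, hl⟩
    simp only [delivered, Finset.mem_filter] at hl
    obtain ⟨-, hA, hNI, s, hs, -⟩ := hl
    obtain ⟨h1, h2, -⟩ := N.source_eq_coe hs
    exact ⟨hA, hNI, s, h2, h1⟩
  · rintro ⟨hA, hNI, s, h1, h2⟩
    obtain ⟨s', hs'⟩ := N.exists_source ⟨s, h2, h1⟩
    obtain ⟨l, hl⟩ := Finset.min_of_nonempty (N.source_eq_coe hs').2.1
    refine ⟨l, ?_⟩
    simp only [delivered, Finset.mem_filter]
    exact ⟨(Finset.mem_inter.1 (Finset.mem_of_min hl)).2, hA, hNI, s', hs', hl⟩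

lemma delivered_eq_singleton (h : (N.delivered req A x σ j).Nonempty) :
    ∃ (l : ℕ) (s : Fin n), N.delivered req A x σ j = {l} ∧
      N.source x j (req (σ j).done j) (σ j).got = s ∧
      (N.useful s (req (σ j).done j) (σ j).got).min = l := by
  classical
  obtain ⟨l, hl⟩ := h
  have hl' := hl
  simp only [delivered, Finset.mem_filter] at hl'
  obtain ⟨-, hA, hNI, s, hs, hmin⟩ := hl'
  refine ⟨l, s, Finset.eq_singleton_iff_unique_mem.2 ⟨hl, fun k hk => ?_⟩, hs, hmin⟩
  simp only [delivered, Finset.mem_filter] at hk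
  obtain ⟨-, -, -, s', hs', hmin'⟩ := hk
  rw [hs, WithTop.coe_inj] at hs'
  rw [← hs', hmin] at hmin'
  exact (WithTop.coe_inj.1 hmin').symm

end System

/-! ### Regular states and progress of one node -/

/-- Description of the reception at node `j`: as long as the set `Y` of received subpackets of
content `m` is regular, whether `j` has a useful subpacket itself (`own`), and the number of useful
nodes otherwise (`holders`), depend only on `m` and on the number of subpackets received. -/
structure NodeProfile {n M : ℕ} (N : System n M) (j : Fin n) (own : Fin M → ℕ → Prop)
    (holders : Fin M → ℕ → ℕ) (Regular : Fin M → Finset ℕ → Prop) : Prop where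
  empty : ∀ m, Regular m ∅
  disjoint : ∀ m Y, Regular m Y → Y.card < N.K → Disjoint (N.wanted m Y) Y
  own_iff : ∀ m Y, Regular m Y → Y.card < N.K → ((N.useful j m Y).Nonempty ↔ own m Y.card)
  card_eq : ∀ m Y, Regular m Y → Y.card < N.K → ¬ own m Y.card →
    (Finset.univ.filter fun s => (N.useful s m Y).Nonempty).card = holders m Y.card
  next : ∀ m Y, Regular m Y → Y.card < N.K → ∀ (s : Fin n) (l : ℕ), (N.useful s m Y).min = l →
    (own m Y.card → s = j) → Regular m (insert l Y)

/-- The state of node `j` is regular and its current content incomplete. -/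
def RegularState {n M : ℕ} (N : System n M) (j : Fin n) (Regular : Fin M → Finset ℕ → Prop)
    (req : ℕ → Fin n → Fin M) (σ : Fin n → NodeState) : Prop :=
  Regular (req (σ j).done j) (σ j).got ∧ (σ j).got.card < N.K

/-- Expected number of slots for a content whose subpackets arrive at rates `g`. -/
def contentTime (K : ℕ) (g : ℕ → ℝ) : ℝ := ∑ y ∈ Finset.range K, 1 / g y

/-- Expected number of slots for what node `j` has received. -/
def progress {n M : ℕ} (K : ℕ) (j : Fin n) (g : Fin M → ℕ → ℝ) (req : ℕ → Fin n → Fin M)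
    (σ : Fin n → NodeState) : ℝ :=
  ∑ i ∈ Finset.range (σ j).done, contentTime K (g (req i j)) +
    contentTime (σ j).got.card (g (req (σ j).done j))

namespace NodeProfile

variable {n M : ℕ} {N : System n M} {j : Fin n} {own : Fin M → ℕ → Prop}
    {holders : Fin M → ℕ → ℕ} {Regular : Fin M → Finset ℕ → Prop}

open Classical in
/-- One slot at a node in a regular state. -/
lemma step (h : NodeProfile N j own holders Regular) (hR : 0 ≤ N.R) (hK : 0 < N.K)
    {req : ℕ → Fin n → Fin M} {A : Finset (Fin n)} {x : Fin n → Point} {σ : Fin n → NodeState}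
    (hσ : RegularState N j Regular req σ) (hx : ∀ s, s ≠ j → eucl (x s) (x j) ≠ 0)
    (g : Fin M → ℕ → ℝ) :
    RegularState N j Regular req (N.step req A x σ) ∧
    (N.step req A x σ j).done ≤ (σ j).done + 1 ∧ (σ j).done ≤ (N.step req A x σ j).done ∧
    progress N.K j g req (N.step req A x σ) = progress N.K j g req σ +
      if (N.delivered req A x σ j).Nonempty then
        1 / g (req (σ j).done j) (σ j).got.card else 0 := by
  obtain ⟨hreg, hcard⟩ := hσ
  by_cases hd : (N.delivered req A x σ j).Nonempty
  · obtain ⟨l, s, hl, hs, hmin⟩ := N.delivered_eq_singleton hd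
    have hlw : l ∈ N.wanted (req (σ j).done j) (σ j).got :=
      (Finset.mem_inter.1 (Finset.mem_of_min hmin)).2
    have hlY : l ∉ (σ j).got := Finset.disjoint_left.1 (h.disjoint _ _ hreg hcard) hlw
    -- A node is at distance zero from itself and, by `hx`, at positive distance from all others, so
    -- its own useful subpacket wins.
    have hsj : own (req (σ j).done j) (σ j).got.card → s = j := by
      intro hown
      by_contra hne
      have h1 := (N.source_eq_coe hs).2.2 j (by simpa using hR)
        ((h.own_iff _ _ hreg hcard).2 hown)
      rw [eucl_self] at h1
      exact hx s hne (le_antisymm h1 (eucl_nonneg _ _))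
    have hnext := h.next _ _ hreg hcard s l hmin hsj
    have hY : (σ j).got ∪ N.delivered req A x σ j = insert l (σ j).got := by
      rw [hl, Finset.union_comm, Finset.insert_eq]
    have hc : (insert l (σ j).got).card = (σ j).got.card + 1 := Finset.card_insert_of_notMem hlY
    by_cases hfull : N.K ≤ (insert l (σ j).got).card
    · have hst : N.step req A x σ j = ⟨(σ j).done + 1, ∅⟩ := by
        simp only [System.step, hY, if_pos hfull]
      have hKc : N.K = (σ j).got.card + 1 := by omega
      refine ⟨?_, by rw [hst], by rw [hst]; exact Nat.le_succ _, ?_⟩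
      · simp only [RegularState, hst]
        exact ⟨h.empty _, by simpa using hK⟩
      · simp only [progress, hst, if_pos hd, Finset.sum_range_succ, Finset.card_empty]
        have e : contentTime N.K (g (req (σ j).done j)) =
            contentTime (σ j).got.card (g (req (σ j).done j)) +
              1 / g (req (σ j).done j) (σ j).got.card := by
          rw [contentTime, hKc, Finset.sum_range_succ]; rfl
        rw [e]
        simp [contentTime]
        ring
    · have hst : N.step req A x σ j = ⟨(σ j).done, insert l (σ j).got⟩ := by
        simp only [System.step, hY, if_neg hfull]
      refine ⟨?_, by rw [hst]; exact Nat.le_succ _, by rw [hst], ?_⟩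
      · simp only [RegularState, hst]
        exact ⟨hnext, not_le.1 hfull⟩
      · simp only [progress, hst, if_pos hd, hc]
        rw [contentTime, Finset.sum_range_succ, contentTime]
        ring
  · have hY : (σ j).got ∪ N.delivered req A x σ j = (σ j).got := by
      rw [Finset.not_nonempty_iff_eq_empty.1 hd, Finset.union_empty]
    have hst : N.step req A x σ j = σ j := by
      simp only [System.step, hY, if_neg (not_le.2 hcard)]
    refine ⟨?_, by rw [hst]; exact Nat.le_succ _, by rw [hst], ?_⟩
    · simp only [RegularState, hst]
      exact ⟨hreg, hcard⟩
    · simp only [progress, hst, if_neg hd, add_zero]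

end NodeProfile

/-! ### Long-run behaviour of one node -/

lemma contentTime_nonneg {K : ℕ} {g : ℕ → ℝ} (hg : ∀ y < K, 0 < g y) : 0 ≤ contentTime K g :=
  Finset.sum_nonneg fun y hy => by have := hg y (Finset.mem_range.1 hy); positivity

lemma contentTime_pos {K : ℕ} {g : ℕ → ℝ} (hK : 0 < K) (hg : ∀ y < K, 0 < g y) :
    0 < contentTime K g :=
  Finset.sum_pos (fun y hy => by have := hg y (Finset.mem_range.1 hy); positivity)
    ⟨0, Finset.mem_range.2 hK⟩

lemma contentTime_mono {K y : ℕ} {g : ℕ → ℝ} (hg : ∀ y < K, 0 < g y) (hy : y ≤ K) :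
    contentTime y g ≤ contentTime K g :=
  Finset.sum_le_sum_of_subset_of_nonneg (Finset.range_subset_range.2 hy) fun i hi _ => by
    have := hg i (Finset.mem_range.1 hi); positivity

/-- The node `j` receives at rate `g m y` if it already has `y` subpackets of content `m`. -/
structure HasRate {n M : ℕ} (N : System n M) (act : Slot n → Finset (Fin n)) (j : Fin n)
    (Regular : Fin M → Finset ℕ → Prop) (g : Fin M → ℕ → ℝ) : Prop where
  pos : ∀ m, ∀ y < N.K, 0 < g m y
  rate : ∀ m Y, Regular m Y → Y.card < N.K → (slotLaw n).real {w | j ∈ act w ∧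
    ∃ s, (N.useful s m Y).Nonempty ∧ eucl (w s).1 (w j).1 ≤ N.R} = g m Y.card
  noInterference : ∀ᵐ w ∂(slotLaw n), j ∈ act w → ∀ req σ,
    N.NoInterference req (act w) (fun i => (w i).1) σ j

section node

variable {n M : ℕ} {N : System n M} {j : Fin n} {own : Fin M → ℕ → Prop}
    {holders : Fin M → ℕ → ℕ} {Regular : Fin M → Finset ℕ → Prop} {act : Slot n → Finset (Fin n)}
    {g : Fin M → ℕ → ℝ}

/-- Along almost every sequence of slots, the state of a node stays regular and its progress is
asymptotically equal to the time. -/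
lemma NodeProfile.ae_tendsto_progress (h : NodeProfile N j own holders Regular) (hR : 0 ≤ N.R)
    (hK : 0 < N.K) (hact : ∀ j, MeasurableSet {w | j ∈ act w}) (hg : HasRate N act j Regular g)
    (req : ℕ → Fin n → Fin M) :
    ∀ᵐ w ∂(Measure.infinitePi fun _ : ℕ => slotLaw n),
      (∀ t, RegularState N j Regular req (N.run act (w, req) t)) ∧
      (∀ t, (N.run act (w, req) (t + 1) j).done ≤ (N.run act (w, req) t j).done + 1) ∧
      (∀ t, (N.run act (w, req) t j).done ≤ (N.run act (w, req) (t + 1) j).done) ∧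
      Tendsto (fun t : ℕ => progress N.K j g req (N.run act (w, req) t) / t) atTop (𝓝 1) := by
  classical
  let F : Slot n → (Fin n → NodeState) → Fin n → NodeState := fun w σ =>
    N.step req (act w) (fun j => (w j).1) σ
  let hit' : (Fin n → NodeState) → Set (Slot n) := fun σ =>
    {w | (N.delivered req (act w) (fun j => (w j).1) σ j).Nonempty}
  have hmhit : ∀ σ, MeasurableSet (hit' σ) := fun σ => by
    refine measurableSet_setOfPred.2 (measurable_of_factors (N.measurable_slotData hact)
      fun w w' e => ?_)
    rw [N.delivered_congr σ e (fun _ => rfl)]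
  -- Elapsed time minus credit: mean zero because a delivery worth `1 / g` has probability `g`. The
  -- value `0` off the regular states makes this hold for every state.
  let r : (Fin n → NodeState) → Slot n → ℝ := fun σ w =>
    if RegularState N j Regular req σ then
      1 - 1 / g (req (σ j).done j) (σ j).got.card * (hit' σ).indicator (fun _ => (1 : ℝ)) w else 0
  set B : ℝ := 1 + ∑ m, contentTime N.K (g m) with hB
  have hrm : ∀ σ, Measurable (r σ) := by
    intro σ
    by_cases hσ : RegularState N j Regular req σ
    · simp only [r, if_pos hσ]
      exact measurable_const.sub (measurable_const.mul (measurable_const.indicator (hmhit σ)))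
    · simp only [r, if_neg hσ]; exact measurable_const
  have hB0 : ∀ m, 0 ≤ contentTime N.K (g m) := fun m => contentTime_nonneg (hg.pos m)
  have hrB : ∀ σ w, |r σ w| ≤ B := by
    intro σ w
    by_cases hσ : RegularState N j Regular req σ
    · simp only [r, if_pos hσ]
      have h1 : 1 / g (req (σ j).done j) (σ j).got.card ≤ ∑ m, contentTime N.K (g m) := by
        calc _ ≤ contentTime N.K (g (req (σ j).done j)) :=
              Finset.single_le_sum (f := fun y => 1 / g (req (σ j).done j) y)
                (fun y hy => (one_div_pos.2 (hg.pos _ y (Finset.mem_range.1 hy))).le)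
                (Finset.mem_range.2 hσ.2)
          _ ≤ _ := Finset.single_le_sum (f := fun m => contentTime N.K (g m)) (fun m _ => hB0 m)
              (Finset.mem_univ _)
      have h2 := one_div_pos.2 (hg.pos (req (σ j).done j) _ hσ.2)
      by_cases hw : w ∈ hit' σ
      · rw [Set.indicator_of_mem hw, abs_le]; constructor <;> linarith
      · rw [Set.indicator_of_notMem hw, abs_le]; constructor <;> linarith
    · simp only [r, if_neg hσ, abs_zero]
      have := Finset.sum_nonneg fun m (_ : m ∈ Finset.univ) => hB0 m
      linarith
  have hr0 : ∀ σ, ∫ w, r σ w ∂(slotLaw n) = 0 := by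
    intro σ
    by_cases hσ : RegularState N j Regular req σ
    · simp only [r, if_pos hσ]
      have h1 : (slotLaw n).real (hit' σ) = g (req (σ j).done j) (σ j).got.card := by
        rw [← hg.rate _ _ hσ.1 hσ.2]
        refine measureReal_congr ?_
        filter_upwards [hg.noInterference] with w hw
        refine propext (N.delivered_nonempty_iff.trans ?_)
        exact ⟨fun h => ⟨h.1, h.2.2⟩, fun h => ⟨h.1, hw h.1 _ _, h.2⟩⟩
      have hne : g (req (σ j).done j) (σ j).got.card ≠ 0 := (hg.pos _ _ hσ.2).ne'
      rw [integral_sub (integrable_const _)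
        (((integrable_const (1 : ℝ)).indicator (hmhit σ)).const_mul _), integral_const_mul,
        integral_indicator (hmhit σ)]
      simp [h1, hne]
    · simp [r, if_neg hσ]
  have hFm : ∀ σ, Measurable fun w => F w σ := N.measurable_step_slot hact req
  have hlln := ae_tendsto_reward_div (slotLaw n) hFm (fun _ => ⟨0, ∅⟩) hrm hrB hr0
  have hties : ∀ᵐ w ∂(Measure.infinitePi fun _ : ℕ => slotLaw n), ∀ t, ∀ s i : Fin n, s ≠ i →
      eucl (w t s).1 (w t i).1 ≠ 0 := by
    rw [ae_all_iff]
    intro t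
    exact (measurePreserving_eval_infinitePi (fun _ : ℕ => slotLaw n) t).quasiMeasurePreserving.ae
      (ae_eucl_ne_zero n)
  filter_upwards [hlln, hties] with w hw hwt
  have hrun : ∀ t, N.run act (w, req) t = chain F (fun _ => ⟨0, ∅⟩) w t :=
    fun t => N.run_eq_chain act (w, req) t
  have hreg : ∀ t, RegularState N j Regular req (N.run act (w, req) t) := by
    intro t
    induction t with
    | zero => exact ⟨h.empty _, by simpa [System.run] using hK⟩
    | succ t ih => exact (h.step hR hK ih (fun s hs => hwt t s j hs) g).1
  have hst := fun t => h.step (A := act (w t)) (x := fun i => (w t i).1) hR hK (hreg t)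
    (fun s hs => hwt t s j hs) g
  refine ⟨hreg, fun t => (hst t).2.1, fun t => (hst t).2.2.1, ?_⟩
  have hprog : ∀ t : ℕ, progress N.K j g req (N.run act (w, req) t) =
      t - reward F (fun _ => ⟨0, ∅⟩) r w t := by
    intro t
    induction t with
    | zero => simp [progress, System.run, reward, contentTime]
    | succ t ih =>
      have e : reward F (fun _ => ⟨0, ∅⟩) r w (t + 1) = reward F (fun _ => ⟨0, ∅⟩) r w t +
          r (N.run act (w, req) t) (w t) := by
        rw [hrun, reward, Finset.sum_range_succ]; rfl
      have e2 := (hst t).2.2.2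
      rw [show N.run act (w, req) (t + 1) = N.step req (act (w t)) (fun i => (w t i).1)
        (N.run act (w, req) t) from rfl, e2, ih, e]
      simp only [r, if_pos (hreg t), hit', Set.indicator_apply, Set.mem_ofPred_eq]
      push_cast
      split_ifs <;> ring
  have hlim : Tendsto (fun t : ℕ => 1 - reward F (fun _ => ⟨0, ∅⟩) r w t / t) atTop (𝓝 (1 - 0)) :=
    hw.const_sub 1
  rw [sub_zero] at hlim
  refine hlim.congr' ?_
  filter_upwards [eventually_gt_atTop 0] with t ht
  have : (t : ℝ) ≠ 0 := by exact_mod_cast ht.ne'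
  rw [hprog, sub_div, div_self this]

end node

/-! ### Renewal limits -/

/-- If the counting sequence `d` finishes the jobs in order, the durations being `c` up to a bounded
error and an asymptotically negligible error, then its speed is the inverse of the mean duration. -/
lemma tendsto_counting_div {d : ℕ → ℕ} {c : ℕ → ℝ} {φ : ℕ → ℝ} {B cbar : ℝ}
    (hc : ∀ i, c i ≤ B) (hcbar : 0 < cbar)
    (hC : Tendsto (fun z : ℕ => (∑ i ∈ Finset.range z, c i) / z) atTop (𝓝 cbar))
    (hφ : ∀ t, |φ t - ∑ i ∈ Finset.range (d t), c i| ≤ B)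
    (hlim : Tendsto (fun t : ℕ => φ t / t) atTop (𝓝 1)) :
    Tendsto d atTop atTop ∧ Tendsto (fun t : ℕ => (d t : ℝ) / t) atTop (𝓝 (1 / cbar)) := by
  have hCd : Tendsto (fun t : ℕ => (∑ i ∈ Finset.range (d t), c i) / t) atTop (𝓝 1) := by
    have h1 : Tendsto (fun t : ℕ => (φ t - ∑ i ∈ Finset.range (d t), c i) / t) atTop (𝓝 0) := by
      refine squeeze_zero_norm (fun t => ?_) (tendsto_const_div_atTop_nhds_zero_nat B)
      rw [Real.norm_eq_abs, abs_div, Nat.abs_cast]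
      gcongr
      exact hφ t
    have h2 := hlim.sub h1
    rw [sub_zero] at h2
    refine h2.congr fun t => ?_
    ring
  have hB0 : 0 ≤ B := (abs_nonneg _).trans (hφ 0)
  have hd : Tendsto d atTop atTop := by
    rw [← tendsto_natCast_atTop_iff (R := ℝ)]
    -- Durations are at most `B`, so time cannot advance unless the count grows linearly; `B + 1`
    -- avoids a division by zero.
    have h1 : ∀ᶠ t : ℕ in atTop, (t : ℝ) / 2 / (B + 1) ≤ d t := by
      filter_upwards [hCd.eventually (lt_mem_nhds (show (1 / 2 : ℝ) < 1 by norm_num)),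
        eventually_gt_atTop 0] with t ht ht0
      have ht0' : (0 : ℝ) < t := by exact_mod_cast ht0
      rw [lt_div_iff₀ ht0'] at ht
      have h2 : ∑ i ∈ Finset.range (d t), c i ≤ d t * B := by
        calc _ ≤ ∑ i ∈ Finset.range (d t), B := Finset.sum_le_sum fun i _ => hc i
          _ = _ := by simp
      rw [div_le_iff₀ (by linarith)]
      have : (0 : ℝ) ≤ d t := by positivity
      nlinarith
    refine tendsto_atTop_mono' _ h1 ?_
    exact (tendsto_natCast_atTop_atTop.atTop_div_const (by norm_num)).atTop_div_const (by linarith)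
  refine ⟨hd, ?_⟩
  have h1 := hCd.div (hC.comp hd) hcbar.ne'
  refine h1.congr' ?_
  filter_upwards [hd.eventually_gt_atTop 0, (hC.comp hd).eventually_ne hcbar.ne'] with t ht hne
  have ht' : (d t : ℝ) ≠ 0 := by exact_mod_cast ht.ne'
  simp only [Function.comp, Pi.div_apply] at hne ⊢
  have hs : ∑ i ∈ Finset.range (d t), c i ≠ 0 := fun e => hne (by rw [e, zero_div])
  field_simp

/-- The average time spent per job is the inverse of the speed. -/
lemma tendsto_sum_delay_div {d : ℕ → ℕ} {cbar : ℝ} (hcbar : 0 < cbar) (hd0 : d 0 = 0)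
    (hd1 : ∀ t, d (t + 1) ≤ d t + 1) (hd2 : ∀ t, d t ≤ d (t + 1)) (hd : Tendsto d atTop atTop)
    (hlim : Tendsto (fun t : ℕ => (d t : ℝ) / t) atTop (𝓝 (1 / cbar))) :
    Tendsto (fun z : ℕ => (∑ i ∈ Finset.range z, ∑' t : ℕ, if d t = i then (1 : ℝ≥0∞) else 0) / z)
      atTop (𝓝 (ENNReal.ofReal cbar)) := by
  classical
  have hmono : Monotone d := monotone_nat_of_le_succ hd2
  have hex : ∀ z, ∃ t, z ≤ d t := fun z => (hd.eventually_ge_atTop z).exists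
  let T : ℕ → ℕ := fun z => Nat.find (hex z)
  have hT1 : ∀ z, z ≤ d (T z) := fun z => Nat.find_spec (hex z)
  have hT2 : ∀ z t, d t < z ↔ t < T z := fun z t =>
    ⟨fun h => lt_of_not_ge fun h' => absurd (hT1 z) (not_le.2 ((hmono h').trans_lt h)),
      fun h => not_le.1 (Nat.find_min (hex z) h)⟩
  -- The count starts at `0` and rises by at most one per slot, so it cannot jump over `z`.
  have hT3 : ∀ z, d (T z) = z := by
    intro z
    refine le_antisymm ?_ (hT1 z)
    rcases hTz : T z with _ | t
    · rw [hd0]; exact Nat.zero_le _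
    · have := (hT2 z t).2 (by omega)
      have := hd1 t
      omega
  have hdle : ∀ t, d t ≤ t := by
    intro t
    induction t with
    | zero => exact hd0.le
    | succ t ih => exact (hd1 t).trans (by omega)
  have hTtop : Tendsto T atTop atTop := tendsto_atTop_mono (fun z => (hT3 z).ge.trans (hdle _))
    tendsto_id
  -- The first `z` delays together count the slots with `d t < z`, that is `t < T z`.
  have hsum : ∀ z, ∑ i ∈ Finset.range z, ∑' t : ℕ, (if d t = i then (1 : ℝ≥0∞) else 0) = T z := by
    intro z
    rw [← Summable.tsum_finsetSum fun i _ => ENNReal.summable]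
    have h1 : ∀ t, ∑ i ∈ Finset.range z, (if d t = i then (1 : ℝ≥0∞) else 0) =
        if t < T z then 1 else 0 := by
      intro t
      rw [Finset.sum_ite_eq]
      simp only [Finset.mem_range, hT2]
    simp_rw [h1]
    rw [tsum_eq_sum (s := Finset.range (T z)) fun t ht => if_neg (by simpa using ht)]
    rw [Finset.sum_congr rfl fun t ht => if_pos (Finset.mem_range.1 ht)]
    simp
  have hreal : Tendsto (fun z : ℕ => (T z : ℝ) / z) atTop (𝓝 cbar) := by
    have h1 := (hlim.comp hTtop).inv₀ (by positivity)
    rw [one_div, inv_inv] at h1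
    refine h1.congr fun z => ?_
    simp only [Function.comp, hT3, inv_div]
  refine (ENNReal.tendsto_ofReal hreal).congr' ?_
  filter_upwards [eventually_gt_atTop 0] with z hz
  rw [hsum, ENNReal.ofReal_div_of_pos (by exact_mod_cast hz), ENNReal.ofReal_natCast,
    ENNReal.ofReal_natCast]

/-! ### The metrics of a network -/

/-- Law of large numbers for the requests of a node. -/
lemma ae_tendsto_requests (α : ℝ) (n M : ℕ) [NeZero M] (j : Fin n) (c : Fin M → ℝ) :
    ∀ᵐ req ∂(Measure.infinitePi fun _ : ℕ => Measure.pi fun _ : Fin n => (zipf α M).toMeasure),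
      Tendsto (fun z : ℕ => (∑ i ∈ Finset.range z, c (req i j)) / z) atTop
        (𝓝 (∑ m, (zipf α M m).toReal * c m)) := by
  set ν := Measure.pi fun _ : Fin n => (zipf α M).toMeasure with hν
  set P := Measure.infinitePi fun _ : ℕ => ν with hP
  have hcm : Measurable fun x : Fin n → Fin M => c (x j) :=
    (measurable_of_countable c).comp (measurable_pi_apply j)
  have hm : ∀ i : ℕ, Measurable fun req : ℕ → Fin n → Fin M => c (req i j) := fun i =>
    hcm.comp (measurable_pi_apply i)
  have hmap : ∀ i : ℕ, P.map (fun req => c (req i j)) = ν.map fun x => c (x j) := by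
    intro i
    rw [← Measure.infinitePi_map_eval (fun _ : ℕ => ν) i, Measure.map_map hcm (measurable_pi_apply i)]
    rfl
  have hint : Integrable (fun req : ℕ → Fin n → Fin M => c (req 0 j)) P :=
    integrable_of_bounded (hm 0) (∑ m, |c m|) fun req =>
      Finset.single_le_sum (f := fun m => |c m|) (fun _ _ => abs_nonneg _) (Finset.mem_univ _)
  have hind := ProbabilityTheory.iIndepFun_infinitePi (P := fun _ : ℕ => ν)
    (X := fun _ (x : Fin n → Fin M) => c (x j)) (fun _ => hcm)
  have h := ProbabilityTheory.strong_law_ae_real (fun i (req : ℕ → Fin n → Fin M) => c (req i j))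
    hint (fun i k hik => hind.indepFun hik)
    (fun i => ⟨(hm i).aemeasurable, (hm 0).aemeasurable, by rw [hmap i, hmap 0]⟩)
  have hE : ∫ req, c (req 0 j) ∂P = ∑ m, (zipf α M m).toReal * c m := by
    have h1 : ∫ req, c (req 0 j) ∂P = ∫ m, c m ∂((zipf α M).toMeasure) := by
      have e1 := (measurePreserving_eval_infinitePi (fun _ : ℕ => ν) 0)
      have e2 := measurePreserving_eval (fun _ : Fin n => (zipf α M).toMeasure) j
      have e3 := (e2.comp e1).map_eq
      rw [← e3, integral_map (e2.comp e1).measurable.aemeasurable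
        (measurable_of_countable c).aestronglyMeasurable]
      rfl
    rw [h1, PMF.integral_eq_sum]
    simp
  rw [hE] at h
  exact h

section limits

variable {n M : ℕ} {N : System n M} {j : Fin n} {own : Fin M → ℕ → Prop}
    {holders : Fin M → ℕ → ℕ} {Regular : Fin M → Finset ℕ → Prop} {act : Slot n → Finset (Fin n)}
    {g : Fin M → ℕ → ℝ}

/-- Mean number of slots per content. -/
def meanTime (α : ℝ) {M : ℕ} [NeZero M] (K : ℕ) (g : Fin M → ℕ → ℝ) : ℝ :=
  ∑ m, (zipf α M m).toReal * contentTime K (g m)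

lemma zipf_toReal_pos (α : ℝ) {M : ℕ} [NeZero M] (m : Fin M) : 0 < (zipf α M m).toReal := by
  have h : 0 < ((m : ℝ) + 1) ^ (-α) / zipfNorm α M := div_pos (by positivity) (zipfNorm_pos α M)
  rw [zipf, PMF.ofFintype_apply, ENNReal.toReal_ofReal h.le]
  exact h

lemma meanTime_pos (α : ℝ) {M : ℕ} [NeZero M] {K : ℕ} (hK : 0 < K) {g : Fin M → ℕ → ℝ}
    (hg : ∀ m, ∀ y < K, 0 < g m y) : 0 < meanTime α K g :=
  Finset.sum_pos (fun m _ => mul_pos (zipf_toReal_pos α m) (contentTime_pos hK (hg m)))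
    ⟨0, Finset.mem_univ _⟩

lemma System.done_le (N : System n M) (act : Slot n → Finset (Fin n)) (ω : Realization n M) (t : ℕ)
    (j : Fin n) : (N.run act ω t j).done ≤ (N.run act ω (t + 1) j).done ∧
      (N.run act ω (t + 1) j).done ≤ (N.run act ω t j).done + 1 := by
  simp only [System.run, System.step]
  split_ifs <;> simp

/-- By Fubini the requests can be fixed first. Then progress is asymptotic to time, and it differs
from the total duration of the completed contents by at most one content time, so
`tendsto_counting_div` applies. -/
lemma NodeProfile.ae_tendsto_done [NeZero M] (α : ℝ) (h : NodeProfile N j own holders Regular)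
    (hR : 0 ≤ N.R) (hK : 0 < N.K) (hact : ∀ j, MeasurableSet {w | j ∈ act w})
    (hg : HasRate N act j Regular g) :
    ∀ᵐ ω ∂(networkLaw α n M), Tendsto (fun τ : ℕ => ((N.run act ω τ j).done : ℝ) / τ) atTop
      (𝓝 (1 / meanTime α N.K g)) := by
  have hdone : ∀ τ, Measurable fun ω : Realization n M => ((N.run act ω τ j).done : ℝ) / τ := by
    intro τ
    refine Measurable.div_const ?_ _
    have h1 : Measurable fun σ : Fin n → NodeState => ((σ j).done : ℝ) := Measurable.of_discrete
    exact h1.comp (N.measurable_run hact τ)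
  have hms : MeasurableSet {ω : Realization n M |
      Tendsto (fun τ : ℕ => ((N.run act ω τ j).done : ℝ) / τ) atTop
        (𝓝 (1 / meanTime α N.K g))} :=
    measurableSet_tendsto (𝓝 (1 / meanTime α N.K g)) hdone
  rw [networkLaw, Measure.ae_prod_iff_ae_ae hms,
    Measure.ae_ae_comm (p := fun w req => Tendsto (fun τ : ℕ =>
      ((N.run act (w, req) τ j).done : ℝ) / τ) atTop (𝓝 (1 / meanTime α N.K g))) hms]
  filter_upwards [ae_tendsto_requests α n M j fun m => contentTime N.K (g m)] with req hreq
  filter_upwards [h.ae_tendsto_progress hR hK hact hg req] with w hw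
  obtain ⟨h1, -, -, h2⟩ := hw
  have hc0 : ∀ m, 0 ≤ contentTime N.K (g m) := fun m => contentTime_nonneg (hg.pos m)
  have hcle : ∀ m, contentTime N.K (g m) ≤ ∑ m, contentTime N.K (g m) := fun m =>
    Finset.single_le_sum (f := fun m => contentTime N.K (g m)) (fun m _ => hc0 m) (Finset.mem_univ _)
  refine (tendsto_counting_div (B := ∑ m, contentTime N.K (g m)) (fun i => hcle (req i j))
    (meanTime_pos α hK hg.pos) hreq (fun t => ?_) h2).2
  rw [progress, add_sub_cancel_left]
  have hlt := (h1 t).2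
  rw [abs_of_nonneg (contentTime_nonneg fun y hy => hg.pos _ y (hy.trans hlt))]
  exact (contentTime_mono (hg.pos _) hlt.le).trans (hcle _)

lemma NodeProfile.ae_liminf_done [NeZero M] (α : ℝ) (h : NodeProfile N j own holders Regular)
    (hR : 0 ≤ N.R) (hK : 0 < N.K) (hact : ∀ j, MeasurableSet {w | j ∈ act w})
    (hg : HasRate N act j Regular g) :
    ∀ᵐ ω ∂(networkLaw α n M), liminf (fun τ : ℕ => ((N.run act ω τ j).done : ℝ≥0∞) / (τ : ℝ≥0∞))
      atTop = ENNReal.ofReal (1 / meanTime α N.K g) := by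
  filter_upwards [h.ae_tendsto_done α hR hK hact hg] with ω hω
  refine Tendsto.liminf_eq ((ENNReal.tendsto_ofReal hω).congr' ?_)
  filter_upwards [eventually_gt_atTop 0] with z hz
  rw [ENNReal.ofReal_div_of_pos (by exact_mod_cast hz), ENNReal.ofReal_natCast,
    ENNReal.ofReal_natCast]

/-- If `j` is active in every slot, the delays of its first requests add up to the time needed to
complete them, so the mean delay is the inverse of the completion rate. -/
lemma NodeProfile.ae_limsup_delay [NeZero M] (α : ℝ) (h : NodeProfile N j own holders Regular)
    (hR : 0 ≤ N.R) (hK : 0 < N.K) (hg : HasRate N (fun _ => {j}) j Regular g) :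
    ∀ᵐ ω ∂(networkLaw α n M), limsup (fun z : ℕ => (∑ i ∈ Finset.range z, N.delay ω j i) /
      (z : ℝ≥0∞)) atTop = ENNReal.ofReal (meanTime α N.K g) := by
  have hact : ∀ i, MeasurableSet {w : Slot n | i ∈ ((fun _ => {j}) : Slot n → Finset (Fin n)) w} :=
    fun i => MeasurableSet.const _
  have hpos := meanTime_pos α hK hg.pos
  filter_upwards [h.ae_tendsto_done α hR hK hact hg] with ω hω
  refine Tendsto.limsup_eq (tendsto_sum_delay_div hpos rfl (fun t => (N.done_le _ ω t j).2)
    (fun t => (N.done_le _ ω t j).1) ?_ hω)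
  rw [← tendsto_natCast_atTop_iff (R := ℝ)]
  have h1 := hω.pos_mul_atTop (by positivity) (tendsto_natCast_atTop_atTop (R := ℝ))
  refine h1.congr' ?_
  filter_upwards [eventually_gt_atTop 0] with t ht
  have : (t : ℝ) ≠ 0 := by exact_mod_cast ht.ne'
  field_simp

end limits

instance (α : ℝ) (n M : ℕ) [NeZero M] : IsProbabilityMeasure (networkLaw α n M) := by
  unfold networkLaw; infer_instance

/-- Throughput in terms of the mean times per content. -/
theorem System.throughput_eq {n M : ℕ} [NeZero M] (N : System n M) (α : ℝ)
    {act : Slot n → Finset (Fin n)} (hR : 0 ≤ N.R) (hK : 0 < N.K)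
    (hact : ∀ j, MeasurableSet {w | j ∈ act w}) {own : Fin n → Fin M → ℕ → Prop}
    {holders : Fin M → ℕ → ℕ} {Regular : Fin n → Fin M → Finset ℕ → Prop}
    {g : Fin n → Fin M → ℕ → ℝ} (h : ∀ j, NodeProfile N j (own j) holders (Regular j))
    (hg : ∀ j, HasRate N act j (Regular j) (g j)) :
    N.throughput α act = ENNReal.ofReal ((∑ j, 1 / meanTime α N.K (g j)) / n) := by
  have hae : ∀ᵐ ω ∂(networkLaw α n M), ∀ j, liminf (fun τ : ℕ =>
      ((N.run act ω τ j).done : ℝ≥0∞) / (τ : ℝ≥0∞)) atTop =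
        ENNReal.ofReal (1 / meanTime α N.K (g j)) :=
    ae_all_iff.2 fun j => (h j).ae_liminf_done α hR hK hact (hg j)
  have hpos := fun j => meanTime_pos α hK (hg j).pos
  rw [throughput]
  have : ∀ᵐ ω ∂(networkLaw α n M), (∑ j : Fin n, liminf (fun τ : ℕ =>
      ((N.run act ω τ j).done : ℝ≥0∞) / (τ : ℝ≥0∞)) atTop) / (n : ℝ≥0∞) =
        ENNReal.ofReal ((∑ j, 1 / meanTime α N.K (g j)) / n) := by
    filter_upwards [hae] with ω hω
    rcases Nat.eq_zero_or_pos n with rfl | hn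
    · simp
    rw [Finset.sum_congr rfl fun j _ => hω j, ENNReal.ofReal_div_of_pos (by exact_mod_cast hn),
      ENNReal.ofReal_sum_of_nonneg fun j _ => (one_div_pos.2 (hpos j)).le, ENNReal.ofReal_natCast]
  rw [lintegral_congr_ae this]
  simp

/-- Average delay in terms of the mean times per content. -/
theorem System.avgDelay_eq {n M : ℕ} [NeZero M] (N : System n M) (α : ℝ) (hR : 0 ≤ N.R)
    (hK : 0 < N.K) {own : Fin n → Fin M → ℕ → Prop}
    {holders : Fin M → ℕ → ℕ} {Regular : Fin n → Fin M → Finset ℕ → Prop}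
    {g : Fin n → Fin M → ℕ → ℝ} (h : ∀ j, NodeProfile N j (own j) holders (Regular j))
    (hg : ∀ j, HasRate N (fun _ => {j}) j (Regular j) (g j)) :
    N.avgDelay α = ENNReal.ofReal ((∑ j, meanTime α N.K (g j)) / n) := by
  have hae : ∀ᵐ ω ∂(networkLaw α n M), ∀ j, limsup (fun z : ℕ =>
      (∑ i ∈ Finset.range z, N.delay ω j i) / (z : ℝ≥0∞)) atTop =
        ENNReal.ofReal (meanTime α N.K (g j)) :=
    ae_all_iff.2 fun j => (h j).ae_limsup_delay α hR hK (hg j)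
  have hpos := fun j => meanTime_pos α hK (hg j).pos
  rw [avgDelay]
  have : ∀ᵐ ω ∂(networkLaw α n M), (∑ j : Fin n, limsup (fun z : ℕ =>
      (∑ i ∈ Finset.range z, N.delay ω j i) / (z : ℝ≥0∞)) atTop) / (n : ℝ≥0∞) =
        ENNReal.ofReal ((∑ j, meanTime α N.K (g j)) / n) := by
    filter_upwards [hae] with ω hω
    rcases Nat.eq_zero_or_pos n with rfl | hn
    · simp
    rw [Finset.sum_congr rfl fun j _ => hω j, ENNReal.ofReal_div_of_pos (by exact_mod_cast hn),
      ENNReal.ofReal_sum_of_nonneg fun j _ => (hpos j).le, ENNReal.ofReal_natCast]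
  rw [lintegral_congr_ae this]
  simp

/-! ### Rates of reception -/

open Classical in
/-- Probability that a node is active and finds one of `u` other nodes within its range. -/
def hitProb {n : ℕ} (R : ℝ) (act : Slot n → Finset (Fin n)) (u : ℕ) : ℝ :=
  if h : ∃ q : Fin n × Finset (Fin n), q.1 ∉ q.2 ∧ q.2.card = u then
    (slotLaw n).real (hit R act h.choose.1 h.choose.2) else 1

lemma IsSymmetricRule.hitProb_eq {n : ℕ} {R : ℝ} {act : Slot n → Finset (Fin n)}
    (h : IsSymmetricRule act) {j : Fin n} {V : Finset (Fin n)} (hj : j ∉ V) :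
    hitProb R act V.card = (slotLaw n).real (hit R act j V) := by
  have hex : ∃ q : Fin n × Finset (Fin n), q.1 ∉ q.2 ∧ q.2.card = V.card := ⟨(j, V), hj, rfl⟩
  rw [hitProb, dif_pos hex]
  exact h.measureReal_hit_congr hex.choose_spec.1 hj hex.choose_spec.2

lemma exists_finset_card_eq {n u : ℕ} (j : Fin n) (hu : u < n) :
    ∃ V : Finset (Fin n), j ∉ V ∧ V.card = u := by
  have h : u ≤ (Finset.univ.erase j).card := by
    rw [Finset.card_erase_of_mem (Finset.mem_univ j), Finset.card_univ, Fintype.card_fin]; omega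
  obtain ⟨V, hV, hc⟩ := Finset.exists_subset_card_eq h
  exact ⟨V, fun hj => Finset.notMem_erase j _ (hV hj), hc⟩

open Classical in
/-- Description of the reception in the whole network. -/
structure NetworkProfile {n M : ℕ} (N : System n M) (own : Fin n → Fin M → ℕ → Prop)
    (holders : Fin M → ℕ → ℕ) (Regular : Fin n → Fin M → Finset ℕ → Prop) : Prop where
  node : ∀ j, NodeProfile N j (own j) holders (Regular j)
  one_le : ∀ m, ∀ y < N.K, 1 ≤ holders m y
  le_nodes : ∀ m, ∀ y < N.K, holders m y ≤ n
  lt_nodes : ∀ j m, ∀ y < N.K, ¬ own j m y → holders m y < n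
  card_own : ∀ m, ∀ y < N.K, (Finset.univ.filter fun j => own j m y).card ≤ holders m y

open Classical in
/-- The rate of reception: `a` if the node has a useful subpacket itself, and otherwise `b u` where
`u` is the number of useful nodes. -/
def rate {n M : ℕ} (own : Fin n → Fin M → ℕ → Prop) (holders : Fin M → ℕ → ℕ) (a : ℝ) (b : ℕ → ℝ)
    (j : Fin n) (m : Fin M) (y : ℕ) : ℝ := if own j m y then a else b (holders m y)

lemma rate_bounds {n M : ℕ} {own : Fin n → Fin M → ℕ → Prop} {holders : Fin M → ℕ → ℕ}
    {a a' : ℝ} {b b' : ℕ → ℝ} {j : Fin n} {m : Fin M} {y : ℕ} {c : ℝ} (ha : c * a ≤ a')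
    (hb : ¬ own j m y → c * b (holders m y) ≤ b' (holders m y)) :
    c * rate own holders a b j m y ≤ rate own holders a' b' j m y := by
  unfold rate
  split_ifs with h
  · exact ha
  · exact hb h

lemma rate_bounds' {n M : ℕ} {own : Fin n → Fin M → ℕ → Prop} {holders : Fin M → ℕ → ℕ}
    {a a' : ℝ} {b b' : ℕ → ℝ} {j : Fin n} {m : Fin M} {y : ℕ} {c : ℝ} (ha : a' ≤ c * a)
    (hb : ¬ own j m y → b' (holders m y) ≤ c * b (holders m y)) :
    rate own holders a' b' j m y ≤ c * rate own holders a b j m y := by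
  unfold rate
  split_ifs with h
  · exact ha
  · exact hb h

section rates

variable {n M : ℕ} {N : System n M} {own : Fin n → Fin M → ℕ → Prop}
    {holders : Fin M → ℕ → ℕ} {Regular : Fin n → Fin M → Finset ℕ → Prop}

-- An own useful subpacket is at distance zero, so being active suffices. Otherwise the useful nodes
-- form a set of `holders` nodes that omits `j`, and exchangeability applies.
open Classical in
lemma NetworkProfile.measureReal_useful (h : NetworkProfile N own holders Regular)
    {act : Slot n → Finset (Fin n)} (hact : IsSymmetricRule act) (hR : 0 ≤ N.R) (j : Fin n)
    (m : Fin M) (Y : Finset ℕ) (hY : Regular j m Y) (hc : Y.card < N.K) :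
    (slotLaw n).real {w | j ∈ act w ∧
      ∃ s, (N.useful s m Y).Nonempty ∧ eucl (w s).1 (w j).1 ≤ N.R} =
    rate own holders ((slotLaw n).real {w | j ∈ act w}) (hitProb N.R act) j m Y.card := by
  unfold rate
  split_ifs with ho
  · congr 1
    ext w
    refine ⟨fun hw => hw.1, fun hw => ⟨hw, j, ((h.node j).own_iff m Y hY hc).2 ho, ?_⟩⟩
    simpa using hR
  · set V := Finset.univ.filter fun s => (N.useful s m Y).Nonempty with hV
    have hjV : j ∉ V := by
      rw [hV, Finset.mem_filter, (h.node j).own_iff m Y hY hc]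
      exact fun hj => ho hj.2
    rw [← (h.node j).card_eq m Y hY hc ho, hact.hitProb_eq hjV]
    congr 1
    ext w
    simp [hit, hV]

/-- A server within `R` of another active requester is at least `(κ - 1) R ≥ (1 + Δ) R` from `j`, so
interference is excluded in whatever state the nodes are. -/
lemma NetworkProfile.hasRate_act (h : NetworkProfile N own holders Regular)
    {act : Slot n → Finset (Fin n)} {κ : ℝ} (hact : IsFairAllocation (κ * N.R) act)
    (hR : 0 < N.R) (hκ : 2 + N.Δ ≤ κ) (j : Fin n)
    (hpos : ∀ m, ∀ y < N.K,
      0 < rate own holders ((slotLaw n).real {w | j ∈ act w}) (hitProb N.R act) j m y) :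
    HasRate N act j (Regular j)
      (rate own holders ((slotLaw n).real {w | j ∈ act w}) (hitProb N.R act) j) where
  pos := hpos
  rate := h.measureReal_useful hact.isSymmetricRule hR.le j
  noInterference := by
    filter_upwards [hact.exclusive] with w hw hj req σ i hi hij b hb
    have h1 := (N.source_eq_coe hb).1
    have h2 := hw i hi j hj hij
    have h3 := eucl_triangle (w i).1 (w b).1 (w j).1
    rw [eucl_comm (w i).1 (w b).1] at h3
    nlinarith

lemma NetworkProfile.hasRate_alone (h : NetworkProfile N own holders Regular) (hR : 0 < N.R)
    (j : Fin n) (hpos : ∀ m, ∀ y < N.K,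
      0 < rate own holders 1 (hitProb N.R fun _ : Slot n => Finset.univ) j m y) :
    HasRate N (fun _ => {j}) j (Regular j)
      (rate own holders 1 (hitProb N.R fun _ : Slot n => Finset.univ) j) where
  pos := hpos
  rate := by
    intro m Y hY hc
    have h1 := h.measureReal_useful (isSymmetricRule_univ n) hR.le j m Y hY hc
    have h2 : (slotLaw n).real {w | j ∈ (fun _ : Slot n => (Finset.univ : Finset (Fin n))) w} = 1 := by
      simp
    rw [h2] at h1
    rw [← h1]
    simp
  noInterference := by
    refine Eventually.of_forall fun w _ req σ i hi hij => ?_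
    exact absurd (Finset.mem_singleton.1 hi) hij

end rates

/-! ### Comparison of the harmonic and the arithmetic mean of the delays -/

/-- Cauchy-Schwarz: the arithmetic mean times the mean of the inverses is at least one. -/
lemma sq_card_le_sum_mul_sum_inv {ι : Type*} (s : Finset ι) {D : ι → ℝ} (hD : ∀ j ∈ s, 0 < D j) :
    (s.card : ℝ) ^ 2 ≤ (∑ j ∈ s, D j) * ∑ j ∈ s, 1 / D j := by
  have h := Finset.sum_sq_le_sum_mul_sum_of_sq_le_mul s (r := fun _ => (1 : ℝ)) (f := D)
    (g := fun j => 1 / D j) (fun j hj => (hD j hj).le) (fun j hj => (one_div_pos.2 (hD j hj)).le)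
    (fun j hj => by have := (hD j hj).ne'; exact le_of_eq (by field_simp))
  simpa using h

open Classical in
/-- If the terms of the sums `∑ i, a i / d i j` differ only in the places `own`, where they are
smaller but which are few, then the mean of the inverses of the sums is of the order of the inverse
of their mean. -/
lemma sum_mul_sum_inv_le {ι : Type*} (I : Finset ι) (hI : I.Nonempty) {n : ℕ} {a ψ : ι → ℝ}
    (own : Fin n → ι → Prop) (ha : ∀ i ∈ I, 0 < a i) (hψ : ∀ i ∈ I, 0 < ψ i)
    (hψ1 : ∀ i ∈ I, ψ i ≤ 1)
    (hown : ∀ i ∈ I, ((Finset.univ.filter fun j => own j i).card : ℝ) ≤ n * ψ i) :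
    (∑ j, ∑ i ∈ I, a i / (if own j i then 1 else ψ i)) *
      (∑ j, 1 / ∑ i ∈ I, a i / (if own j i then 1 else ψ i)) ≤ 2 * n ^ 2 := by
  set d : Fin n → ι → ℝ := fun j i => if own j i then 1 else ψ i with hd
  have hd0 : ∀ j, ∀ i ∈ I, 0 < d j i := fun j i hi => by
    simp only [hd]; split_ifs; exacts [one_pos, hψ i hi]
  have hdψ : ∀ j, ∀ i ∈ I, ψ i ≤ d j i := fun j i hi => by
    simp only [hd]; split_ifs; exacts [hψ1 i hi, le_rfl]
  set D : Fin n → ℝ := fun j => ∑ i ∈ I, a i / d j i with hD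
  set E : ℝ := ∑ i ∈ I, a i / ψ i with hE
  have hE0 : 0 < E := Finset.sum_pos (fun i hi => div_pos (ha i hi) (hψ i hi)) hI
  have hD0 : ∀ j, 0 < D j := fun j =>
    Finset.sum_pos (fun i hi => div_pos (ha i hi) (hd0 j i hi)) hI
  have h1 : ∑ j, D j ≤ n * E := by
    calc ∑ j, D j ≤ ∑ j : Fin n, E := Finset.sum_le_sum fun j _ => Finset.sum_le_sum fun i hi =>
          div_le_div_of_nonneg_left (ha i hi).le (hψ i hi) (hdψ j i hi)
      _ = _ := by simp
  -- The weighted Cauchy-Schwarz inequality `(∑ a/ψ)² ≤ (∑ a/d) (∑ a d/ψ²)` makes the bound linear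
  -- in `d`, so summing over `j` only involves `∑ j, d j i`.
  have h2 : ∀ j, 1 / D j ≤ (∑ i ∈ I, a i / ψ i ^ 2 * d j i) / E ^ 2 := by
    intro j
    have hcs := Finset.sum_sq_le_sum_mul_sum_of_sq_le_mul I (r := fun i => a i / ψ i)
      (f := fun i => a i / d j i) (g := fun i => a i / ψ i ^ 2 * d j i)
      (fun i hi => (div_pos (ha i hi) (hd0 j i hi)).le)
      (fun i hi => by have := ha i hi; have := hψ i hi; have := hd0 j i hi; positivity)
      (fun i hi => by have := (hψ i hi).ne'; have := (hd0 j i hi).ne'; exact le_of_eq (by field_simp))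
    rw [div_le_div_iff₀ (hD0 j) (by positivity), one_mul, mul_comm]
    exact hcs
  -- Half of this is the number of owners, bounded by `hown`; the other half is `ψ i` for each node.
  have h3 : ∀ i ∈ I, ∑ j, d j i ≤ 2 * (n * ψ i) := by
    intro i hi
    have e : ∑ j, d j i ≤ ∑ j : Fin n, ((if own j i then 1 else 0) + ψ i) := by
      refine Finset.sum_le_sum fun j _ => ?_
      have := hψ i hi
      simp only [hd]; split_ifs <;> linarith
    refine e.trans ?_
    rw [Finset.sum_add_distrib, Finset.sum_boole]
    have := hown i hi
    simp only [Finset.sum_const, Finset.card_univ, Fintype.card_fin, nsmul_eq_mul]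
    linarith
  have h4 : ∑ j, 1 / D j ≤ 2 * n / E := by
    calc ∑ j, 1 / D j ≤ ∑ j, (∑ i ∈ I, a i / ψ i ^ 2 * d j i) / E ^ 2 :=
          Finset.sum_le_sum fun j _ => h2 j
      _ = (∑ i ∈ I, a i / ψ i ^ 2 * ∑ j, d j i) / E ^ 2 := by
          rw [← Finset.sum_div, Finset.sum_comm]
          simp_rw [Finset.mul_sum]
      _ ≤ (∑ i ∈ I, a i / ψ i ^ 2 * (2 * (n * ψ i))) / E ^ 2 := by
          gcongr with i hi
          · have := ha i hi; positivity
          · exact h3 i hi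
      _ = (2 * n * E) / E ^ 2 := by
          congr 1
          rw [hE, Finset.mul_sum]
          refine Finset.sum_congr rfl fun i hi => ?_
          have := (hψ i hi).ne'
          field_simp
      _ = _ := by field_simp
  calc (∑ j, D j) * ∑ j, 1 / D j ≤ (n * E) * (2 * n / E) :=
        mul_le_mul h1 h4 (Finset.sum_nonneg fun j _ => (one_div_pos.2 (hD0 j)).le) (by positivity)
    _ = 2 * n ^ 2 := by field_simp

lemma meanTime_le_of_rate_le {α : ℝ} {M : ℕ} [NeZero M] {K : ℕ} {g d : Fin M → ℕ → ℝ} {c : ℝ}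
    (hc : 0 < c) (hd : ∀ m, ∀ y < K, 0 < d m y) (h : ∀ m, ∀ y < K, c * d m y ≤ g m y) :
    c * meanTime α K g ≤ meanTime α K d := by
  rw [meanTime, meanTime, Finset.mul_sum]
  refine Finset.sum_le_sum fun m _ => ?_
  rw [mul_left_comm]
  refine mul_le_mul_of_nonneg_left ?_ (zipf_toReal_pos α m).le
  rw [contentTime, contentTime, Finset.mul_sum]
  refine Finset.sum_le_sum fun y hy => ?_
  rw [Finset.mem_range] at hy
  have h1 := hd m y hy
  have h2 := h m y hy
  have h3 : 0 < g m y := lt_of_lt_of_le (by positivity) h2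
  rw [mul_one_div, div_le_div_iff₀ h3 h1]
  linarith

lemma meanTime_le_of_le_rate {α : ℝ} {M : ℕ} [NeZero M] {K : ℕ} {g d : Fin M → ℕ → ℝ} {c : ℝ}
    (hg : ∀ m, ∀ y < K, 0 < g m y) (hd : ∀ m, ∀ y < K, 0 < d m y)
    (h : ∀ m, ∀ y < K, g m y ≤ c * d m y) :
    meanTime α K d ≤ c * meanTime α K g := by
  rw [meanTime, meanTime, Finset.mul_sum]
  refine Finset.sum_le_sum fun m _ => ?_
  rw [mul_left_comm]
  refine mul_le_mul_of_nonneg_left ?_ (zipf_toReal_pos α m).le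
  rw [contentTime, contentTime, Finset.mul_sum]
  refine Finset.sum_le_sum fun y hy => ?_
  rw [Finset.mem_range] at hy
  have h1 := hd m y hy
  have h2 := h m y hy
  have h3 := hg m y hy
  rw [mul_one_div, div_le_div_iff₀ h1 h3]
  linarith

open Classical in
lemma meanTime_eq_sum {α : ℝ} {M : ℕ} [NeZero M] {K n : ℕ} (own : Fin n → Fin M → ℕ → Prop)
    (holders : Fin M → ℕ → ℕ) (b : ℕ → ℝ) (j : Fin n) :
    meanTime α K (rate own holders 1 b j) =
      ∑ i ∈ (Finset.univ : Finset (Fin M)) ×ˢ Finset.range K,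
        (zipf α M i.1).toReal / (if own j i.1 i.2 then 1 else b (holders i.1 i.2)) := by
  rw [Finset.sum_product, meanTime]
  refine Finset.sum_congr rfl fun m _ => ?_
  rw [contentTime, Finset.mul_sum]
  refine Finset.sum_congr rfl fun y _ => ?_
  rw [rate, mul_one_div]

/-- Here `S` and `S'` sum the reference times and their inverses, `T'` sums the inverse times under
the allocation, `T` the times of lone requesters, and `q = n R²`. -/
lemma product_bounds {c C b q n S S' T T' : ℝ} (hc : 0 < c) (hC : 0 < C) (hb : 0 < b) (hq : 0 < q)
    (hn : 0 < n) (hS : 0 < S) (hS' : 0 < S') (hT' : 0 < T') (hT : 0 < T) (hlow : n ^ 2 ≤ S * S')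
    (hupp : S * S' ≤ 2 * n ^ 2) (h1 : c / q * S' ≤ T') (h2 : T' ≤ C / q * S') (h3 : S ≤ 4 * T)
    (h4 : b * T ≤ S) :
    c / 4 ≤ T' / n * (q * (T / n)) ∧ T' / n * (q * (T / n)) ≤ C / b * 2 := by
  constructor
  · calc c / 4 = c / q * (q / (4 * n ^ 2)) * n ^ 2 := by field_simp
      _ ≤ c / q * (q / (4 * n ^ 2)) * (S * S') := by gcongr
      _ = (c / q * S') * S * (q / (4 * n ^ 2)) := by ring
      _ ≤ T' * (4 * T) * (q / (4 * n ^ 2)) := by gcongr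
      _ = _ := by field_simp
  · have h5 : T ≤ S / b := by rw [le_div_iff₀ hb]; linarith
    calc T' / n * (q * (T / n)) = T' * T * (q / n ^ 2) := by field_simp
      _ ≤ (C / q * S') * (S / b) * (q / n ^ 2) := by gcongr
      _ = C / b * (S * S') / n ^ 2 := by field_simp
      _ ≤ C / b * (2 * n ^ 2) / n ^ 2 := by gcongr
      _ = _ := by field_simp

set_option maxHeartbeats 1000000 in
/-- The trade-off for a single network. -/
lemma exists_network_bounds {κ B : ℝ} (hκ : 2 < κ) (hB : 1 ≤ B) :
    ∃ c C N₀ : ℝ, 0 < c ∧ ∀ {n M : ℕ} [NeZero M] {α : ℝ} {N : System n M}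
      {act : Slot n → Finset (Fin n)} {own : Fin n → Fin M → ℕ → Prop} {holders : Fin M → ℕ → ℕ}
      {Regular : Fin n → Fin M → Finset ℕ → Prop}, NetworkProfile N own holders Regular →
      3 ≤ n → 0 < N.R → N.R ≤ B → N₀ ≤ n * N.R ^ 2 → 1 ≤ n * N.R ^ 2 → 0 < N.K → 2 + N.Δ ≤ κ →
      IsFairAllocation (κ * N.R) act →
      ∃ lam D : ℝ, N.throughput α act = ENNReal.ofReal lam ∧ N.avgDelay α = ENNReal.ofReal D ∧
        0 < lam ∧ 0 < D ∧ c ≤ lam * (n * N.R ^ 2 * D) ∧ lam * (n * N.R ^ 2 * D) ≤ C := by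
  obtain ⟨c₀, C₀, N₀, hc₀, hC₀, hfair⟩ := exists_fair_bounds hκ hB
  have hB0 : 0 < B := by linarith
  -- The area constant `1 / (4 B²)` times the factor `1 / 2` of `measureReal_hit_univ_bounds`.
  set b : ℝ := 1 / (8 * B ^ 2) with hb
  have hb0 : 0 < b := by positivity
  have hb1 : b ≤ 1 := by
    rw [hb, div_le_one (by positivity)]; nlinarith
  refine ⟨c₀ / 4, C₀ / b * 2, N₀, by positivity, ?_⟩
  intro n M _ α N act own holders Regular h hn hR hRB hN hN1 hK hNκ hact
  have hn0 : (0 : ℝ) < n := by exact_mod_cast (show 0 < n by omega)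
  set q : ℝ := n * N.R ^ 2 with hq
  have hq0 : 0 < q := by positivity
  set ψ : ℕ → ℝ := fun u => min 1 (u * N.R ^ 2) with hψ
  have hψ0 : ∀ u, 1 ≤ u → 0 < ψ u := fun u hu =>
    lt_min one_pos (mul_pos (by exact_mod_cast hu) (by positivity))
  have hψ1 : ∀ u, ψ u ≤ 1 := fun u => min_le_left _ _
  have hd0 : ∀ j m, ∀ y < N.K, 0 < rate own holders 1 ψ j m y := fun j m y hy => by
    unfold rate; split_ifs; exacts [one_pos, hψ0 _ (h.one_le m y hy)]
  -- rates of the active requesters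
  have ga1 : ∀ j m, ∀ y < N.K, c₀ / q * rate own holders 1 ψ j m y ≤
      rate own holders ((slotLaw n).real {w | j ∈ act w}) (hitProb N.R act) j m y := by
    intro j m y hy
    have hf := hfair hn hR hRB hN hact j
    refine rate_bounds (by rw [mul_one]; exact hf.1.1) fun ho => ?_
    obtain ⟨V, hV, hc⟩ := exists_finset_card_eq j (h.lt_nodes j m y hy ho)
    rw [← hc, hact.isSymmetricRule.hitProb_eq hV]
    exact (hf.2 V hV).1
  have ga2 : ∀ j m, ∀ y < N.K,
      rate own holders ((slotLaw n).real {w | j ∈ act w}) (hitProb N.R act) j m y ≤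
        C₀ / q * rate own holders 1 ψ j m y := by
    intro j m y hy
    have hf := hfair hn hR hRB hN hact j
    refine rate_bounds' (by rw [mul_one]; exact hf.1.2) fun ho => ?_
    obtain ⟨V, hV, hc⟩ := exists_finset_card_eq j (h.lt_nodes j m y hy ho)
    rw [← hc, hact.isSymmetricRule.hitProb_eq hV]
    exact (hf.2 V hV).2
  -- rates of a lone requester
  have halone : ∀ (j : Fin n) (V : Finset (Fin n)), j ∉ V →
      b * ψ V.card ≤ (slotLaw n).real (hit N.R (fun _ => Finset.univ) j V) ∧
      (slotLaw n).real (hit N.R (fun _ => Finset.univ) j V) ≤ 4 * ψ V.card := by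
    intro j V hV
    have ha := fun z => le_area_disc_of_le z hR.le hB hRB
    have ha1 : N.R ^ 2 / (4 * B ^ 2) ≤ 1 := (ha (0, 0)).trans measureReal_le_one
    obtain ⟨h1, h2⟩ := measureReal_hit_univ_bounds hR.le (by positivity) ha1 ha j V hV
    constructor
    · refine le_trans ?_ h1
      rw [le_div_iff₀ two_pos]
      refine le_min ?_ ?_
      · have : b * 2 ≤ 1 := by
          rw [hb, div_mul_eq_mul_div, div_le_one (by positivity)]; nlinarith
        calc b * ψ V.card * 2 = b * 2 * ψ V.card := by ring
          _ ≤ 1 * 1 := mul_le_mul this (hψ1 _) (le_min zero_le_one (by positivity)) zero_le_one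
          _ = 1 := one_mul 1
      · calc b * ψ V.card * 2 ≤ b * (V.card * N.R ^ 2) * 2 := by
              gcongr; exact min_le_right _ _
          _ = _ := by rw [hb]; field_simp; ring
    · refine h2.trans ?_
      simp only [hψ]
      rw [mul_min_of_nonneg _ _ (by norm_num : (0 : ℝ) ≤ 4)]
      refine min_le_min (by norm_num) (le_of_eq (by ring))
  have gb1 : ∀ j m, ∀ y < N.K, b * rate own holders 1 ψ j m y ≤
      rate own holders 1 (hitProb N.R fun _ : Slot n => Finset.univ) j m y := by
    intro j m y hy
    refine rate_bounds (by rw [mul_one]; exact hb1) fun ho => ?_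
    obtain ⟨V, hV, hc⟩ := exists_finset_card_eq j (h.lt_nodes j m y hy ho)
    rw [← hc, (isSymmetricRule_univ n).hitProb_eq hV]
    exact (halone j V hV).1
  have gb2 : ∀ j m, ∀ y < N.K,
      rate own holders 1 (hitProb N.R fun _ : Slot n => Finset.univ) j m y ≤
        4 * rate own holders 1 ψ j m y := by
    intro j m y hy
    refine rate_bounds' (by norm_num) fun ho => ?_
    obtain ⟨V, hV, hc⟩ := exists_finset_card_eq j (h.lt_nodes j m y hy ho)
    rw [← hc, (isSymmetricRule_univ n).hitProb_eq hV]
    exact (halone j V hV).2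
  have ga0 : ∀ j m, ∀ y < N.K,
      0 < rate own holders ((slotLaw n).real {w | j ∈ act w}) (hitProb N.R act) j m y :=
    fun j m y hy => lt_of_lt_of_le (mul_pos (by positivity) (hd0 j m y hy)) (ga1 j m y hy)
  have gb0 : ∀ j m, ∀ y < N.K,
      0 < rate own holders 1 (hitProb N.R fun _ : Slot n => Finset.univ) j m y :=
    fun j m y hy => lt_of_lt_of_le (mul_pos hb0 (hd0 j m y hy)) (gb1 j m y hy)
  have hthr := N.throughput_eq α hR.le hK hact.measurable h.node
    (fun j => h.hasRate_act hact hR hNκ j (ga0 j))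
  have hdel := N.avgDelay_eq α hR.le hK h.node (fun j => h.hasRate_alone hR j (gb0 j))
  -- comparison of the mean times
  set E : Fin n → ℝ := fun j => meanTime α N.K (rate own holders 1 ψ j) with hE
  set Ta : Fin n → ℝ := fun j => meanTime α N.K
    (rate own holders ((slotLaw n).real {w | j ∈ act w}) (hitProb N.R act) j) with hTa
  set Tb : Fin n → ℝ := fun j => meanTime α N.K
    (rate own holders 1 (hitProb N.R fun _ : Slot n => Finset.univ) j) with hTb
  have hE0 : ∀ j, 0 < E j := fun j => meanTime_pos α hK (hd0 j)
  have hTa0 : ∀ j, 0 < Ta j := fun j => meanTime_pos α hK (ga0 j)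
  have hTb0 : ∀ j, 0 < Tb j := fun j => meanTime_pos α hK (gb0 j)
  have hne : (Finset.univ : Finset (Fin n)).Nonempty := ⟨⟨0, by omega⟩, Finset.mem_univ _⟩
  have hlow : (n : ℝ) ^ 2 ≤ (∑ j, E j) * ∑ j, 1 / E j := by
    have := sq_card_le_sum_mul_sum_inv Finset.univ (fun j (_ : j ∈ Finset.univ) => hE0 j)
    simpa using this
  have hupp : (∑ j, E j) * ∑ j, 1 / E j ≤ 2 * n ^ 2 := by
    classical
    simp only [hE, meanTime_eq_sum]
    refine sum_mul_sum_inv_le _ ⟨(0, 0), by simpa using hK⟩ (a := fun i => (zipf α M i.1).toReal)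
      (ψ := fun i => ψ (holders i.1 i.2)) (fun j i => own j i.1 i.2)
      (fun i _ => zipf_toReal_pos α i.1) ?_ (fun i _ => hψ1 _) ?_
    · rintro ⟨m, y⟩ hi
      exact hψ0 _ (h.one_le m y (by simpa using hi))
    · rintro ⟨m, y⟩ hi
      have hy : y < N.K := by simpa using hi
      have h1 : ((Finset.univ.filter fun j => own j m y).card : ℝ) ≤ holders m y := by
        exact_mod_cast (by convert h.card_own m y hy)
      refine h1.trans ?_
      have h2 : (holders m y : ℝ) ≤ n := by exact_mod_cast h.le_nodes m y hy
      simp only [hψ]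
      rw [mul_min_of_nonneg _ _ hn0.le, mul_one]
      -- With `n R² ≥ 1` this shows `u ≤ n ψ u`, so the owners are few enough for
      -- `sum_mul_sum_inv_le`.
      refine le_min h2 ?_
      have h3 : (0 : ℝ) ≤ holders m y := by positivity
      calc (holders m y : ℝ) ≤ holders m y * (n * N.R ^ 2) := le_mul_of_one_le_right h3 hN1
        _ = _ := by ring
  have la1 : c₀ / q * ∑ j, 1 / E j ≤ ∑ j, 1 / Ta j := by
    rw [Finset.mul_sum]
    refine Finset.sum_le_sum fun j _ => ?_
    have h1 : c₀ / q * Ta j ≤ E j := meanTime_le_of_rate_le (by positivity) (hd0 j) (ga1 j)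
    rw [mul_one_div, div_le_div_iff₀ (hE0 j) (hTa0 j)]
    linarith
  have la2 : ∑ j, 1 / Ta j ≤ C₀ / q * ∑ j, 1 / E j := by
    rw [Finset.mul_sum]
    refine Finset.sum_le_sum fun j _ => ?_
    have h1 : E j ≤ C₀ / q * Ta j := meanTime_le_of_le_rate (ga0 j) (hd0 j) (ga2 j)
    rw [mul_one_div, div_le_div_iff₀ (hTa0 j) (hE0 j)]
    linarith
  have lb1 : ∑ j, E j ≤ 4 * ∑ j, Tb j := by
    rw [Finset.mul_sum]
    exact Finset.sum_le_sum fun j _ => meanTime_le_of_le_rate (gb0 j) (hd0 j) (gb2 j)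
  have lb2 : b * ∑ j, Tb j ≤ ∑ j, E j := by
    rw [Finset.mul_sum]
    exact Finset.sum_le_sum fun j _ => meanTime_le_of_rate_le hb0 (hd0 j) (gb1 j)
  have hSa : 0 < ∑ j, 1 / Ta j := Finset.sum_pos (fun j _ => one_div_pos.2 (hTa0 j)) hne
  have hSb : 0 < ∑ j, Tb j := Finset.sum_pos (fun j _ => hTb0 j) hne
  have hSE : 0 < ∑ j, E j := Finset.sum_pos (fun j _ => hE0 j) hne
  have hSEi : 0 < ∑ j, 1 / E j := Finset.sum_pos (fun j _ => one_div_pos.2 (hE0 j)) hne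
  obtain ⟨h1, h2⟩ := product_bounds hc₀ hC₀ hb0 hq0 hn0 hSE hSEi hSa hSb hlow hupp la1 la2 lb1 lb2
  exact ⟨(∑ j, 1 / Ta j) / n, (∑ j, Tb j) / n, hthr, hdel, div_pos hSa hn0, div_pos hSb hn0, h1, h2⟩

/-! ### The two kinds of placement -/

lemma useful_sequential_nonempty {n M K : ℕ} (R Δ : ℝ) (cache : Cache n M) (s : Fin n) (m : Fin M)
    (Y : Finset ℕ) :
    ((System.mk K R Δ cache (sequentialReception M)).useful s m Y).Nonempty ↔
      Y.card ∈ cache s m := by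
  constructor
  · rintro ⟨l, hl⟩
    obtain ⟨h1, h2⟩ := Finset.mem_inter.1 hl
    rwa [Finset.mem_singleton.1 h2] at h1
  · exact fun h => ⟨_, Finset.mem_inter.2 ⟨h, Finset.mem_singleton_self _⟩⟩

/-- Under sequential reception the received labels form an initial segment, so the next label is
`Y.card`. Its `X m` replicas are the holders, and the owners are these same nodes. -/
lemma IsUncodedPlacement.networkProfile {n M K S : ℕ} {X : Fin M → ℕ} {cache : Cache n M}
    (h : IsUncodedPlacement K S X cache) (R Δ : ℝ) :
    NetworkProfile (System.mk K R Δ cache (sequentialReception M)) (fun j m y => y ∈ cache j m)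
      (fun m _ => X m) (fun _ _ Y => Y = Finset.range Y.card) where
  node j :=
    { empty := fun m => by simp
      disjoint := fun m Y hY _ =>
        Finset.disjoint_singleton_left.2 (by rw [hY]; simp)
      own_iff := fun m Y _ _ => useful_sequential_nonempty R Δ cache j m Y
      card_eq := fun m Y _ hc _ => by
        rw [← h.replicas m Y.card hc]
        congr 1
        ext s
        rw [Finset.mem_filter, Finset.mem_filter, useful_sequential_nonempty]
      next := fun m Y hY _ s l hl _ => by
        have hl' : l = Y.card := Finset.mem_singleton.1 (Finset.mem_inter.1 (Finset.mem_of_min hl)).2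
        have hlY : l ∉ Y := by rw [hl', hY]; simp
        rw [Finset.card_insert_of_notMem hlY, Finset.range_add_one, ← hY, hl'] }
  one_le m _ _ := h.one_le m
  le_nodes m _ _ := h.le_nodes m
  lt_nodes j m y hy hj := by
    rw [← h.replicas m y hy]
    calc _ < (Finset.univ : Finset (Fin n)).card := by
          refine Finset.card_lt_card (Finset.filter_ssubset.2 ⟨j, Finset.mem_univ _, hj⟩)
      _ = n := by simp
  card_own m y hy := by
    rw [← h.replicas m y hy]
    exact le_of_eq (by congr)

/-- Each label sits at one node and each node has at most one label of `m`, so counting nodes is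
counting labels. -/
lemma IsCodedPlacement.card_filter_inter {n M K S : ℕ} {r : Fin M → ℕ} {cache : Cache n M}
    (h : IsCodedPlacement K S r cache) (m : Fin M) {T : Finset ℕ} (hT : T ⊆ Finset.range (r m)) :
    (Finset.univ.filter fun s => (cache s m ∩ T).Nonempty).card = T.card := by
  calc (Finset.univ.filter fun s => (cache s m ∩ T).Nonempty).card
      = ∑ s, (cache s m ∩ T).card := by
        rw [Finset.card_filter]
        refine Finset.sum_congr rfl fun s _ => ?_
        have h1 : (cache s m ∩ T).card ≤ 1 :=
          (Finset.card_le_card Finset.inter_subset_left).trans (h.distinct s m)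
        split_ifs with hs
        · have := hs.card_pos; omega
        · rw [Finset.not_nonempty_iff_eq_empty.1 hs, Finset.card_empty]
    _ = ∑ s, ∑ l ∈ T, if l ∈ cache s m then 1 else 0 := by
        refine Finset.sum_congr rfl fun s _ => ?_
        rw [Finset.inter_comm, ← Finset.filter_mem_eq_inter, Finset.card_filter]
    _ = ∑ l ∈ T, 1 := by
        rw [Finset.sum_comm]
        refine Finset.sum_congr rfl fun l hl => ?_
        rw [← Finset.card_filter]
        exact h.once m l (Finset.mem_range.1 (hT hl))
    _ = T.card := by simp

lemma IsCodedPlacement.card_filter_nonempty {n M K S : ℕ} {r : Fin M → ℕ} {cache : Cache n M}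
    (h : IsCodedPlacement K S r cache) (m : Fin M) :
    (Finset.univ.filter fun s => (cache s m).Nonempty).card = r m := by
  have h1 := h.card_filter_inter m (Finset.Subset.refl _)
  rw [Finset.card_range] at h1
  rw [← h1]
  congr 1
  ext s
  rw [Finset.mem_filter, Finset.mem_filter, Finset.inter_eq_left.2 (h.labels s m)]

/-- An own coded subpacket, being at distance zero, is the first one received. Hence a node can
serve itself only at `y = 0`, which the regularity condition records, and each label received
removes exactly one of the `r m` holders. -/
lemma IsCodedPlacement.networkProfile {n M K S : ℕ} {r : Fin M → ℕ} {cache : Cache n M}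
    (h : IsCodedPlacement K S r cache) (R Δ : ℝ) :
    NetworkProfile (System.mk K R Δ cache (randomReception r))
      (fun j m y => y = 0 ∧ (cache j m).Nonempty) (fun m y => r m - y)
      (fun j m Y => Y ⊆ Finset.range (r m) ∧ (Y.Nonempty → cache j m ⊆ Y)) := by
  have hrn : ∀ m, r m ≤ n := fun m => by
    rw [← h.card_filter_nonempty m]
    exact (Finset.card_filter_le _ _).trans (by simp)
  refine ⟨fun j => ⟨fun m => ⟨by simp, by simp⟩, ?_, ?_, ?_, ?_⟩, ?_, ?_, ?_, ?_⟩
  · intro m Y _ _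
    exact Finset.sdiff_disjoint
  · rintro m Y ⟨hY, hj⟩ _
    rcases Y.eq_empty_or_nonempty with rfl | hne
    · simp [System.useful, randomReception, Finset.inter_eq_left.2 (h.labels j m)]
    · have h1 : cache j m ∩ (Finset.range (r m) \ Y) = ∅ := by
        ext l
        simp only [Finset.mem_inter, Finset.mem_sdiff, Finset.notMem_empty, iff_false]
        exact fun hl => hl.2.2 (hj hne hl.1)
      simp [System.useful, randomReception, h1, hne.ne_empty]
  · rintro m Y ⟨hY, -⟩ _ _
    have h1 := h.card_filter_inter m (T := Finset.range (r m) \ Y) Finset.sdiff_subset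
    rw [Finset.card_sdiff_of_subset hY, Finset.card_range] at h1
    rw [← h1]
    rfl
  · rintro m Y ⟨hY, hj⟩ _ s l hl hs
    have hl' := Finset.mem_inter.1 (Finset.mem_of_min hl)
    refine ⟨Finset.insert_subset (Finset.mem_sdiff.1 hl'.2).1 hY, fun _ => ?_⟩
    rcases Y.eq_empty_or_nonempty with rfl | hne
    · rcases (cache j m).eq_empty_or_nonempty with hc | hc
      · rw [hc]; exact Finset.empty_subset _
      · have hsj := hs ⟨Finset.card_empty, hc⟩
        subst hsj
        intro k hk
        have := Finset.card_le_one.1 (h.distinct s m) k hk l hl'.1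
        simp [this]
    · exact (hj hne).trans (Finset.subset_insert _ _)
  · intro m y hy
    have := h.le_coded m
    have hy : y < K := hy
    show 1 ≤ r m - y
    omega
  · intro m y _
    exact (Nat.sub_le _ _).trans (hrn m)
  · intro j m y hy ho
    have hy : y < K := hy
    have h1 := h.le_coded m
    have h2 := hrn m
    show r m - y < n
    rcases Nat.eq_zero_or_pos y with rfl | hy0
    · have hj : ¬ (cache j m).Nonempty := fun hj => ho ⟨rfl, hj⟩
      have h3 : (Finset.univ.filter fun s => (cache s m).Nonempty).card <
          (Finset.univ : Finset (Fin n)).card :=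
        Finset.card_lt_card (Finset.filter_ssubset.2 ⟨j, Finset.mem_univ _, hj⟩)
      rw [h.card_filter_nonempty m, Finset.card_univ, Fintype.card_fin] at h3
      omega
    · omega
  · intro m y hy
    rcases Nat.eq_zero_or_pos y with rfl | hy0
    · rw [Nat.sub_zero, ← h.card_filter_nonempty m]
      exact le_of_eq (by congr 1; ext s; simp)
    · simp [hy0.ne']

/-! ### Asymptotics -/

/-- Uniform bounds for large networks imply the trade-off. -/
lemma tradeoff_of_bounds {R : ℕ → ℝ} {lam D : ℕ → ℝ≥0∞} {c C : ℝ} (hc : 0 < c)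
    (hR : ∀ n, 0 < R n)
    (h : ∀ᶠ n : ℕ in atTop, ∃ l d : ℝ, lam n = ENNReal.ofReal l ∧ D n = ENNReal.ofReal d ∧ 0 < l ∧
      0 < d ∧ c ≤ l * (n * R n ^ 2 * d) ∧ l * (n * R n ^ 2 * d) ≤ C) : Tradeoff R lam D := by
  refine ⟨?_, ?_, ?_⟩
  · filter_upwards [h] with n hn
    obtain ⟨l, d, hl, hd, hl0, hd0, -⟩ := hn
    rw [hl, hd]
    exact ⟨ENNReal.ofReal_pos.2 hd0, ENNReal.ofReal_lt_top, ENNReal.ofReal_lt_top⟩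
  · refine IsBigO.of_bound C ?_
    filter_upwards [h, eventually_gt_atTop 0] with n hn hn0
    obtain ⟨l, d, hl, hd, hl0, hd0, -, h2⟩ := hn
    have hn0 : (0 : ℝ) < n := by exact_mod_cast hn0
    have hRn := hR n
    rw [hl, hd, ENNReal.toReal_ofReal hl0.le, ENNReal.toReal_ofReal hd0.le, Real.norm_eq_abs,
      Real.norm_eq_abs, abs_of_pos hl0, abs_of_pos (by positivity), mul_one_div,
      le_div_iff₀ (by positivity)]
    exact h2
  · refine IsBigO.of_bound (1 / c) ?_
    filter_upwards [h, eventually_gt_atTop 0] with n hn hn0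
    obtain ⟨l, d, hl, hd, hl0, hd0, h1, -⟩ := hn
    have hn0 : (0 : ℝ) < n := by exact_mod_cast hn0
    have hRn := hR n
    rw [hl, hd, ENNReal.toReal_ofReal hl0.le, ENNReal.toReal_ofReal hd0.le, Real.norm_eq_abs,
      Real.norm_eq_abs, abs_of_pos hl0, abs_of_pos (by positivity), div_mul_eq_mul_div, one_mul,
      div_le_div_iff₀ (by positivity) hc]
    linarith

/-- The number of nodes in a transmission range tends to infinity. -/
lemma tendsto_mul_sq_atTop {R : ℕ → ℝ}
    (hR : (fun n : ℕ => Real.sqrt (Real.log n / n)) =O[atTop] R) :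
    Tendsto (fun n : ℕ => (n : ℝ) * R n ^ 2) atTop atTop := by
  obtain ⟨C, hC, hb⟩ := hR.exists_pos
  have h1 : Tendsto (fun n : ℕ => Real.log n / C ^ 2) atTop atTop :=
    (Real.tendsto_log_atTop.comp tendsto_natCast_atTop_atTop).atTop_div_const (by positivity)
  refine tendsto_atTop_mono' _ ?_ h1
  filter_upwards [hb.bound, eventually_ge_atTop 1] with n hn hn1
  have hn0 : (0 : ℝ) < n := by exact_mod_cast hn1
  have hlog : 0 ≤ Real.log n / n := div_nonneg (Real.log_natCast_nonneg n) hn0.le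
  rw [Real.norm_eq_abs, abs_of_nonneg (Real.sqrt_nonneg _), Real.norm_eq_abs] at hn
  have h2 := pow_le_pow_left₀ (Real.sqrt_nonneg _) hn 2
  rw [Real.sq_sqrt hlog, mul_pow, sq_abs, div_le_iff₀ hn0] at h2
  rw [div_le_iff₀ (by positivity)]
  linarith

/-- The upper bound on `R` supplies `B`, the lower one makes `n R²` pass every threshold, and `K` is
eventually positive as it is of order `n ^ γ`. Strictness `κ > 2` comes from `Δ > 0`. -/
lemma tradeoff_of_networkProfile {α γ Δ κ : ℝ} (hΔ : 0 < Δ) (hκ : 2 + Δ ≤ κ) {M K : ℕ → ℕ}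
    [∀ n, NeZero (M n)] (hK : (fun n => (K n : ℝ)) =Θ[atTop] fun n : ℕ => (n : ℝ) ^ γ) {R : ℕ → ℝ}
    (hR : ∀ n, 0 < R n) (hRlow : (fun n : ℕ => Real.sqrt (Real.log n / n)) =O[atTop] R)
    (hRup : R =O[atTop] fun _ => (1 : ℝ)) {act : ∀ n, Slot n → Finset (Fin n)}
    (hact : ∀ᶠ n in atTop, IsFairAllocation (κ * R n) (act n)) {cache : ∀ n, Cache n (M n)}
    {wanted : ∀ n, Reception (M n)}
    (h : ∀ᶠ n in atTop, ∃ own holders Regular,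
      NetworkProfile (System.mk (K n) (R n) Δ (cache n) (wanted n)) own holders Regular) :
    Tradeoff R (fun n => (System.mk (K n) (R n) Δ (cache n) (wanted n)).throughput α (act n))
      (fun n => (System.mk (K n) (R n) Δ (cache n) (wanted n)).avgDelay α) := by
  obtain ⟨B₀, -, hB₀⟩ := hRup.exists_pos
  obtain ⟨c, C, N₀, hc, hbd⟩ := exists_network_bounds (κ := κ) (B := max 1 B₀) (by linarith)
    (le_max_left _ _)
  have hlarge := tendsto_mul_sq_atTop hRlow
  obtain ⟨L, -, hL⟩ := hK.2.exists_pos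
  refine tradeoff_of_bounds hc hR (C := C) ?_
  filter_upwards [hB₀.bound, hlarge.eventually_ge_atTop N₀, hlarge.eventually_ge_atTop 1, hL.bound,
    hact, h, eventually_ge_atTop 3] with n h1 h2 h3 h4 h5 h6 h7
  obtain ⟨own, holders, Regular, hprof⟩ := h6
  refine hbd hprof h7 (hR n) ?_ h2 h3 ?_ hκ h5
  · rw [norm_one, mul_one] at h1
    exact (Real.le_norm_self _).trans (h1.trans (le_max_right _ _))
  · rcases Nat.eq_zero_or_pos (K n) with h0 | h0
    · rw [h0, Nat.cast_zero, norm_zero, mul_zero, norm_le_zero_iff] at h4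
      have : (0 : ℝ) < (n : ℝ) ^ γ := Real.rpow_pos_of_pos (by exact_mod_cast (by omega : 0 < n)) _
      linarith
    · exact h0

end ContentNetwork

end

/-! ### The trade-off for both placements -/

theorem theorem1
    (α β γ Δ κ : ℝ) (hα : 0 < α) (hβ₀ : 0 < β) (hβ₁ : β < 1) (hγ₀ : 0 < γ) (hγ₁ : γ < 1)
    (hΔ : 0 < Δ) (hκ : 2 + Δ ≤ κ)
    (M K S : ℕ → ℕ) [∀ n, NeZero (M n)]
    (hM : (fun n => (M n : ℝ)) =Θ[atTop] fun n : ℕ => (n : ℝ) ^ β)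
    (hK : (fun n => (K n : ℝ)) =Θ[atTop] fun n : ℕ => (n : ℝ) ^ γ)
    (hS : (fun n => (S n : ℝ)) =Θ[atTop] fun n => (K n : ℝ))
    (R : ℕ → ℝ) (hR : ∀ n, 0 < R n)
    (hRlow : (fun n : ℕ => Real.sqrt (Real.log n / n)) =O[atTop] R)
    (hRup : R =O[atTop] fun _ => (1 : ℝ))
    (act : ∀ n, ContentNetwork.Slot n → Finset (Fin n))
    (hact : ∀ᶠ n in atTop, ContentNetwork.IsFairAllocation (κ * R n) (act n)) :
    (∀ (X : ∀ n, Fin (M n) → ℕ) (cache : ∀ n, ContentNetwork.Cache n (M n)),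
      (∀ᶠ n in atTop, ContentNetwork.IsUncodedPlacement (K n) (S n) (X n) (cache n)) →
      ContentNetwork.Tradeoff R
        (fun n => (ContentNetwork.System.mk (K n) (R n) Δ (cache n)
          (ContentNetwork.sequentialReception (M n))).throughput α (act n))
        (fun n => (ContentNetwork.System.mk (K n) (R n) Δ (cache n)
          (ContentNetwork.sequentialReception (M n))).avgDelay α)) ∧
    (∀ (r : ∀ n, Fin (M n) → ℕ) (cache : ∀ n, ContentNetwork.Cache n (M n)),
      (∀ᶠ n in atTop, ContentNetwork.IsCodedPlacement (K n) (S n) (r n) (cache n)) →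
      ContentNetwork.Tradeoff R
        (fun n => (ContentNetwork.System.mk (K n) (R n) Δ (cache n)
          (ContentNetwork.randomReception (r n))).throughput α (act n))
        (fun n => (ContentNetwork.System.mk (K n) (R n) Δ (cache n)
          (ContentNetwork.randomReception (r n))).avgDelay α)) := by
  constructor
  · intro X cache h
    exact ContentNetwork.tradeoff_of_networkProfile hΔ hκ hK hR hRlow hRup hact
      (h.mono fun n hn => ⟨_, _, _, hn.networkProfile (R n) Δ⟩)
  · intro r cache h
    exact ContentNetwork.tradeoff_of_networkProfile hΔ hκ hK hR hRlow hRup hact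
      (h.mono fun n hn => ⟨_, _, _, hn.networkProfile (R n) Δ⟩)
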